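/- Let $A$ be a pro-$C^*$-algebra, i.e. a complete Hausdorff topological $*$-algebra whose topology is given by a directed family $\{p_\lambda\}_{\lambda\in\Lambda}$ of $C^*$-seminorms. A Hilbert pro-$C^*$-bimodule $(X,A)$ is a complex vector space $X$ that is a right Hilbert $A$-module (with $A$-valued inner product $\langle\cdot,\cdot\rangle_A$, linear in the second variable) and a left Hilbert $A$-module (with inner product ${}_A\langle\cdot,\cdot\rangle$, linear in the first variable), complete for the seminorms $p_\lambda^A(x)=p_\lambda(\langle x,x\rangle_A)^{1/2}$ and for the seminorms ${}^Ap_\lambda(x)=p_\lambda({}_A\langle x,x\rangle)^{1/2}$, respectively, such that ${}_A\langle x,y\rangle z=x\langle y,z\rangle_A$, $p^A_\lambda(ax)\le p_\lambda(a)p^A_\lambda(x)$ and ${}^Ap_\lambda(xa)\le p_\lambda(a)\,{}^Ap_\lambda(x)$ for all $x,y,z\in X$, $a\in A$, $\lambda\in\Lambda$. It is full if the closed $*$-subalgebra of $A$ generated by the right inner products, and the one generated by the left inner products, are both equal to $A$. For Hilbert $A$-modules $Y,Z$ let $L_A(Y,Z)$ be the space of adjointable module maps $Y\to Z$, with the seminorms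 $p_{\lambda,L_A(Y,Z)}(T)=\sup\{p_\lambda^A(Ty): p_\lambda^A(y)\le 1\}$, and let $L_A(Y)=L_A(Y,Y)$. Regard $A$ as a right Hilbert $A$-module with $\langle a,b\rangle_A=a^*b$, and put $M(A)=L_A(A)$ and $\iota_A:A\to M(A)$, $\iota_A(b)(a)=ba$. Let $(X,A)$ be a full Hilbert pro-$C^*$-bimodule. The suprema defining the seminorms of $M(A)$, $L_A(X)$ and $L_A(A,X)$ are finite, and there is a unique pro-$C^*$-isomorphism $\Psi:M(A)\to L_A(X)$ with $\Psi(\iota_A(a))(x)=ax$ for all $a\in A$, $x\in X$. The space $M(X)=L_A(A,X)$ is a Hilbert pro-$C^*$-bimodule over $M(A)$ with $$m\cdot T=\Psi(m)\circ T,\quad T\cdot m=T\circ m,\quad {}_{M(A)}\langle T_1,T_2\rangle=\Psi^{-1}(T_1\circ T_2^*),\quad \langle T_1,T_2\rangle_{M(A)}=T_1^*\circ T_2 ,$$ called the multiplier bimodule of $X$; its topology is given by the seminorms $p_\lambda^{M(A)}(T)=p_{\lambda,L_A(A)}(\langle T,T\rangle_{M(A)})^{1/2}$. The strict topology on $M(X)$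 is given by the seminorms $T\mapsto p_\lambda^{M(A)}(T\cdot\iota_A(a))+p_\lambda^{M(A)}(\iota_A(a)\cdot T)$, $\lambda\in\Lambda$, $a\in A$. Define $\iota_X:X\to M(X)$ by $\iota_X(x)(a)=xa$. Then: 1. $M(X)$ is complete with respect to the strict topology. 2. $(\iota_X,\iota_A):(X,A)\to(M(X),M(A))$ is a nondegenerate morphism of Hilbert pro-$C^*$-bimodules; that is, $\iota_A$ is a continuous $*$-morphism, $\iota_X(xa)=\iota_X(x)\cdot\iota_A(a)$, $\iota_X(ax)=\iota_A(a)\cdot\iota_X(x)$, $\langle\iota_X(x),\iota_X(y)\rangle_{M(A)}=\iota_A(\langle x,y\rangle_A)$ and ${}_{M(A)}\langle\iota_X(x),\iota_X(y)\rangle=\iota_A({}_A\langle x,y\rangle)$ for all $x,y\in X$, $a\in A$, and the closed linear spans of $\{\iota_A(a)(b):a,b\in A\}$ and of $\{\iota_X(x)(a):x\in X,\ a\in A\}$ are $A$ and $X$, respectively. 3. $\iota_X$ is an injective linear map with $p_\lambda^{M(A)}(\iota_X(x))=p_\lambda^A(x)$ for all $x\in X$, $\lambda\in\Lambda$, and its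 range is a closed $M(A)$-$M(A)$ sub-bimodule of $M(X)$ that is dense in $M(X)$ with respect to the strict topology. -/

import Mathlib

/-!
Hilbert pro-C*-bimodules and their multiplier bimodules.
Families of seminorms are given as functions `p : Λ → E → ℝ`.
-/

/-- The uniform structure given by a family `p` of seminorms: the coarsest one for which all the sets
`{(x, y) | p i (x - y) < ε}` are entourages. -/
@[reducible] def seminormUniformity {ι E : Type*} [AddGroup E] (p : ι → E → ℝ) : UniformSpace E :=
  sSup {u : UniformSpace E | ∀ i, ∀ ε > 0, {z : E × E | p i (z.1 - z.2) < ε} ∈ u.uniformity}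

/-- The topology given by a family of seminorms. -/
@[reducible] def seminormTopology {ι E : Type*} [AddGroup E] (p : ι → E → ℝ) : TopologicalSpace E :=
  (seminormUniformity p).toTopologicalSpace

/-- For honest seminorms this is the usual uniform structure. -/
theorem seminormUniformity_eq_iInf {ι E : Type*} [AddCommGroup E] [Module ℂ E]
    (p : ι → Seminorm ℂ E) :
    seminormUniformity (fun i x => p i x) =
      ⨅ i, (p i).toSeminormedAddCommGroup.toUniformSpace := by
  apply le_antisymm
  · refine sSup_le fun u hu => le_iInf fun i => ?_
    let _ := (p i).toSeminormedAddCommGroup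
    intro s hs
    obtain ⟨ε, hε, h⟩ := Metric.mem_uniformity_dist.1 hs
    refine Filter.mem_of_superset (hu i ε hε) ?_
    rintro ⟨x, y⟩ hxy
    refine h ?_
    rw [dist_eq_norm]
    exact hxy
  · refine le_sSup fun i ε hε => ?_
    have : (p i).toSeminormedAddCommGroup.toUniformSpace.uniformity ≥
        (⨅ i, (p i).toSeminormedAddCommGroup.toUniformSpace).uniformity :=
      iInf_le (fun i => (p i).toSeminormedAddCommGroup.toUniformSpace) i
    refine this ?_
    let _ := (p i).toSeminormedAddCommGroup
    refine Filter.mem_of_superset (Metric.dist_mem_uniformity hε) ?_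
    rintro ⟨x, y⟩ hxy
    have hxy' : dist x y < ε := hxy
    rw [dist_eq_norm] at hxy'
    exact hxy'

section Algebras

variable {Λ A : Type*} [NonUnitalRing A] [StarRing A] [Module ℂ A]

/-- `A` is a pro-C*-algebra with topology given by the family `p`: `p` is a directed separating
family of C*-seminorms in which `A` is complete. -/
structure IsProCStarAlgebra (p : Λ → A → ℝ) : Prop where
  add_le : ∀ i a b, p i (a + b) ≤ p i a + p i b
  smul_eq : ∀ i (c : ℂ) a, p i (c • a) = ‖c‖ * p i a
  mul_le : ∀ i a b, p i (a * b) ≤ p i a * p i b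
  star_mul_self : ∀ i a, p i (star a * a) = p i a ^ 2
  directed : Directed (· ≤ ·) p
  separating : ∀ a, (∀ i, p i a = 0) → a = 0
  complete : @CompleteSpace A (seminormUniformity p)

/-- Positive elements of a pro-C*-algebra. -/
def IsPositiveElt (a : A) : Prop := ∃ b : A, a = star b * b

/-- Continuity of a *-morphism in terms of the families of C*-seminorms. -/
def SeminormContinuous {Δ B C : Type*} (p : Λ → B → ℝ) (q : Δ → C → ℝ) (f : B → C) : Prop :=
  ∀ d, ∃ i, ∀ a, q d (f a) ≤ p i a

end Algebras

section Modules

/-- A linear space `X` that is a right `A`-module with a right `A`-valued inner product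
(algebraic part of the notion of a right Hilbert module). -/
structure RightInnerModule (A X : Type*) [NonUnitalRing A] [StarRing A] [Module ℂ A]
    [AddCommGroup X] [Module ℂ X] where
  /-- `act x a` is `x a`. -/
  act : X → A → X
  add_act : ∀ x y a, act (x + y) a = act x a + act y a
  act_add : ∀ x a b, act x (a + b) = act x a + act x b
  act_mul : ∀ x a b, act x (a * b) = act (act x a) b
  smul_act : ∀ (c : ℂ) x a, act (c • x) a = c • act x a
  act_smul : ∀ (c : ℂ) x a, act x (c • a) = c • act x a
  inner : X → X → A
  inner_add_right : ∀ x y z, inner x (y + z) = inner x y + inner x z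
  inner_smul_right : ∀ (c : ℂ) x y, inner x (c • y) = c • inner x y
  inner_act_right : ∀ x y a, inner x (act y a) = inner x y * a
  star_inner : ∀ x y, star (inner x y) = inner y x

/-- A linear space `X` that is a left `A`-module with a left `A`-valued inner product
(algebraic part of the notion of a left Hilbert module). -/
structure LeftInnerModule (A X : Type*) [NonUnitalRing A] [StarRing A] [Module ℂ A]
    [AddCommGroup X] [Module ℂ X] where
  /-- `act a x` is `a x`. -/
  act : A → X → X
  act_add : ∀ a x y, act a (x + y) = act a x + act a y
  add_act : ∀ a b x, act (a + b) x = act a x + act b x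
  mul_act : ∀ a b x, act (a * b) x = act a (act b x)
  act_smul : ∀ (c : ℂ) a x, act a (c • x) = c • act a x
  smul_act : ∀ (c : ℂ) a x, act (c • a) x = c • act a x
  inner : X → X → A
  inner_add_left : ∀ x y z, inner (x + y) z = inner x z + inner y z
  inner_smul_left : ∀ (c : ℂ) x y, inner (c • x) y = c • inner x y
  inner_act_left : ∀ a x y, inner (act a x) y = a * inner x y
  star_inner : ∀ x y, star (inner x y) = inner y x

/-- The algebraic part of the notion of a Hilbert `A`-`B` bimodule. -/
structure InnerBimodule (A B X : Type*) [NonUnitalRing A] [StarRing A] [Module ℂ A]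
    [NonUnitalRing B] [StarRing B] [Module ℂ B] [AddCommGroup X] [Module ℂ X] where
  left : LeftInnerModule A X
  right : RightInnerModule B X
  inner_act : ∀ x y z, left.act (left.inner x y) z = right.act x (right.inner y z)

variable {Λ A B X Y : Type*}
  [NonUnitalRing A] [StarRing A] [Module ℂ A]
  [NonUnitalRing B] [StarRing B] [Module ℂ B]
  [AddCommGroup X] [Module ℂ X] [AddCommGroup Y] [Module ℂ Y]

/-- The seminorms `x ↦ p i ⟨x, x⟩ ^ (1/2)`. -/
noncomputable def RightInnerModule.seminorm (R : RightInnerModule A X) (p : Λ → A → ℝ)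
    (i : Λ) (x : X) : ℝ := √(p i (R.inner x x))

/-- The seminorms `x ↦ p i ⟨x, x⟩ ^ (1/2)`. -/
noncomputable def LeftInnerModule.seminorm (L : LeftInnerModule A X) (p : Λ → A → ℝ)
    (i : Λ) (x : X) : ℝ := √(p i (L.inner x x))

/-- `X` is a right Hilbert pro-C*-module. -/
structure RightInnerModule.IsHilbert (R : RightInnerModule A X) (p : Λ → A → ℝ) : Prop where
  positive : ∀ x, IsPositiveElt (R.inner x x)
  definite : ∀ x, R.inner x x = 0 ↔ x = 0
  complete : @CompleteSpace X (seminormUniformity (R.seminorm p))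

/-- `X` is a left Hilbert pro-C*-module. -/
structure LeftInnerModule.IsHilbert (L : LeftInnerModule A X) (p : Λ → A → ℝ) : Prop where
  positive : ∀ x, IsPositiveElt (L.inner x x)
  definite : ∀ x, L.inner x x = 0 ↔ x = 0
  complete : @CompleteSpace X (seminormUniformity (L.seminorm p))

/-- `X` is a Hilbert `A`-`B` pro-C*-bimodule, the topologies of the pro-C*-algebras `A` and `B` being
given by the families `p` and `q` of C*-seminorms. -/
structure InnerBimodule.IsHilbert (M : InnerBimodule A B X) (p : Λ → A → ℝ) (q : Λ → B → ℝ) :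
    Prop where
  left_algebra : IsProCStarAlgebra p
  right_algebra : IsProCStarAlgebra q
  left_isHilbert : M.left.IsHilbert p
  right_isHilbert : M.right.IsHilbert q
  left_bound : ∀ i a x, M.right.seminorm q i (M.left.act a x) ≤ p i a * M.right.seminorm q i x
  right_bound : ∀ i x b, M.left.seminorm p i (M.right.act x b) ≤ q i b * M.left.seminorm p i x

/-- The bimodule is full: on both sides, the closed *-subalgebra generated by the inner products is
the whole algebra. -/
structure InnerBimodule.IsFull [IsScalarTower ℂ A A] [SMulCommClass ℂ A A] [StarModule ℂ A]
    [IsScalarTower ℂ B B] [SMulCommClass ℂ B B] [StarModule ℂ B]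
    (M : InnerBimodule A B X) (p : Λ → A → ℝ) (q : Λ → B → ℝ) : Prop where
  left_full : @closure A (seminormTopology p)
    (NonUnitalStarAlgebra.adjoin ℂ {a | ∃ x y, a = M.left.inner x y} : Set A) = Set.univ
  right_full : @closure B (seminormTopology q)
    (NonUnitalStarAlgebra.adjoin ℂ {b | ∃ x y, b = M.right.inner x y} : Set B) = Set.univ

/-- A linear subspace that is stable under both actions. -/
def InnerBimodule.IsSubBimodule (M : InnerBimodule A B X) (S : Submodule ℂ X) : Prop :=
  (∀ a, ∀ x ∈ S, M.left.act a x ∈ S) ∧ (∀ x ∈ S, ∀ b, M.right.act x b ∈ S)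

theorem RightInnerModule.inner_add_left (R : RightInnerModule A X) (x y z : X) :
    R.inner (x + y) z = R.inner x z + R.inner y z := by
  rw [← R.star_inner z, R.inner_add_right, star_add, R.star_inner, R.star_inner]

theorem RightInnerModule.inner_act_left (R : RightInnerModule A X) (x y : X) (a : A) :
    R.inner (R.act x a) y = star a * R.inner x y := by
  rw [← R.star_inner y, R.inner_act_right, star_mul, R.star_inner]

theorem RightInnerModule.inner_smul_left [StarModule ℂ A] (R : RightInnerModule A X)
    (c : ℂ) (x y : X) : R.inner (c • x) y = star c • R.inner x y := by
  rw [← R.star_inner y, R.inner_smul_right, star_smul, R.star_inner]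

theorem RightInnerModule.inner_zero_right (R : RightInnerModule A X) (x : X) :
    R.inner x 0 = 0 := by
  simpa using R.inner_add_right x 0 0

theorem RightInnerModule.inner_zero_left (R : RightInnerModule A X) (x : X) :
    R.inner 0 x = 0 := by
  simpa using R.inner_add_left 0 0 x

theorem RightInnerModule.inner_neg_right (R : RightInnerModule A X) (x y : X) :
    R.inner x (-y) = -R.inner x y := by
  have := R.inner_add_right x y (-y)
  rw [add_neg_cancel, R.inner_zero_right] at this
  exact eq_neg_of_add_eq_zero_right this.symm

theorem RightInnerModule.inner_neg_left (R : RightInnerModule A X) (x y : X) :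
    R.inner (-x) y = -R.inner x y := by
  rw [← R.star_inner y, R.inner_neg_right, star_neg, R.star_inner]

theorem RightInnerModule.zero_act (R : RightInnerModule A X) (a : A) : R.act 0 a = 0 := by
  simpa using R.add_act 0 0 a

theorem RightInnerModule.neg_act (R : RightInnerModule A X) (x : X) (a : A) :
    R.act (-x) a = -R.act x a := by
  have := R.add_act x (-x) a
  rw [add_neg_cancel, R.zero_act] at this
  exact eq_neg_of_add_eq_zero_right this.symm

/-- The algebra as a right module over itself, with `⟨a, b⟩ = a* b`. -/
def RightInnerModule.self (A : Type*) [NonUnitalRing A] [StarRing A] [Module ℂ A]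
    [IsScalarTower ℂ A A] [SMulCommClass ℂ A A] : RightInnerModule A A where
  act x a := x * a
  add_act := add_mul
  act_add := mul_add
  act_mul x a b := (mul_assoc x a b).symm
  smul_act := smul_mul_assoc
  act_smul c x a := mul_smul_comm c x a
  inner x y := star x * y
  inner_add_right x := mul_add (star x)
  inner_smul_right c x y := mul_smul_comm c (star x) y
  inner_act_right x y a := (mul_assoc (star x) y a).symm
  star_inner x y := by rw [star_mul, star_star]

/-- The space `L_A(X, Y)` of adjointable module maps from `X` to `Y`. An element is recorded together
with its adjoint, which is unique when the inner product of `X` is definite. -/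
@[ext]
structure Adjointable (R : RightInnerModule A X) (S : RightInnerModule A Y) where
  map : X →ₗ[ℂ] Y
  adj : Y →ₗ[ℂ] X
  map_act : ∀ x a, map (R.act x a) = S.act (map x) a
  adj_act : ∀ y a, adj (S.act y a) = R.act (adj y) a
  inner_map : ∀ x y, S.inner (map x) y = R.inner x (adj y)

namespace Adjointable

variable {Z : Type*} [AddCommGroup Z] [Module ℂ Z]
  {R : RightInnerModule A X} {S : RightInnerModule A Y} {U : RightInnerModule A Z}

/-- The adjoint map. -/
def adjoint (T : Adjointable R S) : Adjointable S R where
  map := T.adj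
  adj := T.map
  map_act := T.adj_act
  adj_act := T.map_act
  inner_map y x := by rw [← R.star_inner, ← T.inner_map, S.star_inner]

/-- Composition of adjointable maps. -/
def comp (T : Adjointable S U) (V : Adjointable R S) : Adjointable R U where
  map := T.map ∘ₗ V.map
  adj := V.adj ∘ₗ T.adj
  map_act x a := by simp [V.map_act, T.map_act]
  adj_act x a := by simp [V.adj_act, T.adj_act]
  inner_map x y := by simp [T.inner_map, V.inner_map]

instance : Zero (Adjointable R S) where
  zero :=
    { map := 0
      adj := 0
      map_act := fun x a => by simp [S.zero_act]
      adj_act := fun x a => by simp [R.zero_act]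
      inner_map := fun x y => by simp [S.inner_zero_left, R.inner_zero_right] }

instance : Add (Adjointable R S) where
  add T V :=
    { map := T.map + V.map
      adj := T.adj + V.adj
      map_act := fun x a => by simp [T.map_act, V.map_act, S.add_act]
      adj_act := fun x a => by simp [T.adj_act, V.adj_act, R.add_act]
      inner_map := fun x y => by
        simp [S.inner_add_left, R.inner_add_right, T.inner_map, V.inner_map] }

instance : Neg (Adjointable R S) where
  neg T :=
    { map := -T.map
      adj := -T.adj
      map_act := fun x a => by simp [T.map_act, S.neg_act]
      adj_act := fun x a => by simp [T.adj_act, R.neg_act]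
      inner_map := fun x y => by simp [S.inner_neg_left, R.inner_neg_right, T.inner_map] }

instance [StarModule ℂ A] : SMul ℂ (Adjointable R S) where
  smul c T :=
    { map := c • T.map
      adj := star c • T.adj
      map_act := fun x a => by simp [T.map_act, S.smul_act]
      adj_act := fun x a => by simp [T.adj_act, R.smul_act]
      inner_map := fun x y => by
        rw [LinearMap.smul_apply, LinearMap.smul_apply, S.inner_smul_left, R.inner_smul_right,
          T.inner_map] }

@[simp] theorem zero_map : (0 : Adjointable R S).map = 0 := rfl
@[simp] theorem zero_adj : (0 : Adjointable R S).adj = 0 := rfl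
@[simp] theorem add_map (T V : Adjointable R S) : (T + V).map = T.map + V.map := rfl
@[simp] theorem add_adj (T V : Adjointable R S) : (T + V).adj = T.adj + V.adj := rfl
@[simp] theorem neg_map (T : Adjointable R S) : (-T).map = -T.map := rfl
@[simp] theorem neg_adj (T : Adjointable R S) : (-T).adj = -T.adj := rfl
@[simp] theorem smul_map [StarModule ℂ A] (c : ℂ) (T : Adjointable R S) :
    (c • T).map = c • T.map := rfl
@[simp] theorem smul_adj [StarModule ℂ A] (c : ℂ) (T : Adjointable R S) :
    (c • T).adj = star c • T.adj := rfl
@[simp] theorem comp_map (T : Adjointable S U) (V : Adjointable R S) :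
    (T.comp V).map = T.map ∘ₗ V.map := rfl
@[simp] theorem comp_adj (T : Adjointable S U) (V : Adjointable R S) :
    (T.comp V).adj = V.adj ∘ₗ T.adj := rfl
@[simp] theorem adjoint_map (T : Adjointable R S) : T.adjoint.map = T.adj := rfl
@[simp] theorem adjoint_adj (T : Adjointable R S) : T.adjoint.adj = T.map := rfl

instance : AddCommGroup (Adjointable R S) :=
  { AddGroup.ofLeftAxioms (G := Adjointable R S)
      (fun T V W => by ext1 <;> simp [add_assoc])
      (fun T => by ext1 <;> simp)
      (fun T => by ext1 <;> simp) with
    add_comm := fun T V => by ext1 <;> simp [add_comm] }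

instance [StarModule ℂ A] : Module ℂ (Adjointable R S) where
  one_smul T := by ext1 <;> simp
  mul_smul c d T := by
    apply Adjointable.ext
    · exact mul_smul c d T.map
    · simp only [smul_adj, star_mul']
      exact mul_smul (star c) (star d) T.adj
  smul_zero c := by ext1 <;> simp
  smul_add c T V := by ext1 <;> simp
  add_smul c d T := by ext1 <;> simp [add_smul]
  zero_smul T := by ext1 <;> simp

/-- `L_A(X)` is a *-algebra under composition and adjunction. -/
instance : NonUnitalRing (Adjointable R R) where
  mul T V := T.comp V
  left_distrib T V W := by
    apply Adjointable.ext
    · exact LinearMap.comp_add _ _ _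
    · exact LinearMap.add_comp _ _ _
  right_distrib T V W := by
    apply Adjointable.ext
    · exact LinearMap.add_comp _ _ _
    · exact LinearMap.comp_add _ _ _
  zero_mul _ := by
    apply Adjointable.ext
    · exact LinearMap.zero_comp _
    · exact LinearMap.comp_zero _
  mul_zero _ := by
    apply Adjointable.ext
    · exact LinearMap.comp_zero _
    · exact LinearMap.zero_comp _
  mul_assoc _ _ _ := rfl

theorem mul_def (T V : Adjointable R R) : T * V = T.comp V := rfl

instance : StarRing (Adjointable R R) where
  star T := T.adjoint
  star_involutive _ := rfl
  star_mul _ _ := rfl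
  star_add _ _ := rfl

theorem star_def (T : Adjointable R R) : star T = T.adjoint := rfl

instance [StarModule ℂ A] : IsScalarTower ℂ (Adjointable R R) (Adjointable R R) where
  smul_assoc c T V := by
    apply Adjointable.ext
    · exact LinearMap.smul_comp _ _ _
    · exact LinearMap.comp_smul _ _ _

instance [StarModule ℂ A] : SMulCommClass ℂ (Adjointable R R) (Adjointable R R) where
  smul_comm c T V := by
    apply Adjointable.ext
    · exact (LinearMap.comp_smul _ _ _).symm
    · exact (LinearMap.smul_comp _ _ _).symm

instance [StarModule ℂ A] : StarModule ℂ (Adjointable R R) where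
  star_smul c T := by
    apply Adjointable.ext
    · rfl
    · simp [star_def]

/-- The values of which the operator seminorm is the supremum. -/
def unitBallValues (p : Λ → A → ℝ) (i : Λ) (T : Adjointable R S) : Set ℝ :=
  {r | ∃ x, R.seminorm p i x ≤ 1 ∧ r = S.seminorm p i (T.map x)}

/-- The operator seminorms of `L_A(X, Y)`. -/
noncomputable def opSeminorm (p : Λ → A → ℝ) (i : Λ) (T : Adjointable R S) : ℝ :=
  sSup (T.unitBallValues p i)

end Adjointable

end Modules

section Multipliers

variable {Λ A X : Type*} [NonUnitalRing A] [StarRing A] [Module ℂ A]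
  [IsScalarTower ℂ A A] [SMulCommClass ℂ A A] [StarModule ℂ A]
  [AddCommGroup X] [Module ℂ X]

/-- The multiplier algebra `M(A) = L_A(A)`. -/
abbrev MultiplierAlgebra (A : Type*) [NonUnitalRing A] [StarRing A] [Module ℂ A]
    [IsScalarTower ℂ A A] [SMulCommClass ℂ A A] : Type _ :=
  Adjointable (RightInnerModule.self A) (RightInnerModule.self A)

/-- The space `M(X) = L_A(A, X)`. -/
abbrev MultiplierSpace (R : RightInnerModule A X) : Type _ :=
  Adjointable (RightInnerModule.self A) R

/-- The canonical map `A → M(A)`, `ι_A(b)(a) = b a`. -/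
def iotaA (A : Type*) [NonUnitalRing A] [StarRing A] [Module ℂ A]
    [IsScalarTower ℂ A A] [SMulCommClass ℂ A A] [StarModule ℂ A] :
    A →⋆ₙₐ[ℂ] MultiplierAlgebra A where
  toFun b :=
    { map := LinearMap.mulLeft ℂ b
      adj := LinearMap.mulLeft ℂ (star b)
      map_act := fun x a => (mul_assoc b x a).symm
      adj_act := fun x a => (mul_assoc (star b) x a).symm
      inner_map := fun x y => by
        simp only [RightInnerModule.self, LinearMap.mulLeft_apply, star_mul, mul_assoc] }
  map_smul' c b := by
    ext a <;> simp [smul_mul_assoc]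
  map_zero' := by ext a <;> simp
  map_add' b c := by ext a <;> simp [add_mul]
  map_mul' b c := by ext a <;> simp [Adjointable.mul_def]
  map_star' b := by ext a <;> simp [Adjointable.star_def]

/-- The canonical map `X → M(X)`, `ι_X(x)(a) = x a`; its adjoint is `y ↦ ⟨x, y⟩`. -/
def iotaX (R : RightInnerModule A X) : X →ₗ[ℂ] MultiplierSpace R where
  toFun x :=
    { map :=
        { toFun := fun a => R.act x a
          map_add' := R.act_add x
          map_smul' := fun c a => R.act_smul c x a }
      adj :=
        { toFun := fun y => R.inner x y
          map_add' := R.inner_add_right x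
          map_smul' := fun c y => R.inner_smul_right c x y }
      map_act := fun a b => R.act_mul x a b
      adj_act := fun y a => R.inner_act_right x y a
      inner_map := fun a y => R.inner_act_left x y a }
  map_add' x y := by
    ext a
    · exact R.add_act x y a
    · exact R.inner_add_left x y a
  map_smul' c x := by
    ext a
    · exact R.smul_act c x a
    · exact R.inner_smul_left c x a

/-- `Ψ` is the pro-C*-isomorphism `M(A) → L_A(X)` extending the left action of `A` on `X`. -/
structure IsLeftActionExtension (p : Λ → A → ℝ) (𝓧 : InnerBimodule A A X)
    (Ψ : MultiplierAlgebra A ≃⋆ₐ[ℂ] Adjointable 𝓧.right 𝓧.right) : Prop where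
  extends_act : ∀ a x, (Ψ (iotaA A a)).map x = 𝓧.left.act a x
  continuous : SeminormContinuous (Adjointable.opSeminorm p) (Adjointable.opSeminorm p) Ψ
  continuous_symm : SeminormContinuous (Adjointable.opSeminorm p) (Adjointable.opSeminorm p) Ψ.symm

/-- The `M(A)`-`M(A)` bimodule structure of `M(X) = L_A(A, X)`, where `Ψ` is the extension to
`M(A)` of the left action of `A` on `X`:
`m T = Ψ(m) ∘ T`, `T m = T ∘ m`, with inner products `Ψ⁻¹(T₁ ∘ T₂*)` and `T₁* ∘ T₂`. -/
def multiplierBimodule (𝓧 : InnerBimodule A A X)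
    (Ψ : MultiplierAlgebra A ≃⋆ₐ[ℂ] Adjointable 𝓧.right 𝓧.right) :
    InnerBimodule (MultiplierAlgebra A) (MultiplierAlgebra A) (MultiplierSpace 𝓧.right) where
  left :=
    { act := fun m T => (Ψ m).comp T
      act_add := fun m T V => by ext a <;> simp
      add_act := fun m n T => by rw [map_add]; ext a <;> simp
      mul_act := fun m n T => by rw [map_mul]; rfl
      act_smul := fun c m T => by ext a <;> simp
      smul_act := fun c m T => by rw [map_smul]; ext a <;> simp
      inner := fun T V => Ψ.symm (T.comp V.adjoint)
      inner_add_left := fun T V W => by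
        rw [← map_add]; congr 1; ext a <;> simp
      inner_smul_left := fun c T V => by
        rw [← map_smul]; congr 1; ext a <;> simp
      inner_act_left := fun m T V => by
        apply Ψ.injective
        change Ψ (Ψ.symm _) = Ψ (m * Ψ.symm _)
        rw [map_mul, Ψ.apply_symm_apply, Ψ.apply_symm_apply]
        rfl
      star_inner := fun T V => by
        rw [← map_star]; rfl }
  right :=
    { act := fun T m => T.comp m
      add_act := fun T V m => by ext a <;> simp
      act_add := fun T m n => by ext a <;> simp
      act_mul := fun T m n => rfl
      smul_act := fun c T m => by ext a <;> simp
      act_smul := fun c T m => by ext a <;> simp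
      inner := fun T V => T.adjoint.comp V
      inner_add_right := fun T V W => by ext a <;> simp
      inner_smul_right := fun c T V => by ext a <;> simp
      inner_act_right := fun T V m => rfl
      star_inner := fun T V => rfl }
  inner_act T V W := by
    change (Ψ (Ψ.symm (T.comp V.adjoint))).comp W = T.comp (V.adjoint.comp W)
    rw [Ψ.apply_symm_apply]
    rfl

/-- The seminorms `T ↦ ‖T a‖_i + ‖a T‖_i`, for `i : Λ` and `a : A`, of the strict topology on
`M(X)`. -/
noncomputable def strictSeminorm (p : Λ → A → ℝ) (𝓧 : InnerBimodule A A X)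
    (Ψ : MultiplierAlgebra A ≃⋆ₐ[ℂ] Adjointable 𝓧.right 𝓧.right)
    (ia : Λ × A) (T : MultiplierSpace 𝓧.right) : ℝ :=
  (multiplierBimodule 𝓧 Ψ).right.seminorm (Adjointable.opSeminorm p) ia.1
      ((multiplierBimodule 𝓧 Ψ).right.act T (iotaA A ia.2)) +
    (multiplierBimodule 𝓧 Ψ).right.seminorm (Adjointable.opSeminorm p) ia.1
      ((multiplierBimodule 𝓧 Ψ).left.act (iotaA A ia.2) T)

end Multipliers

section Morphisms

variable {Λ Δ A B X Y : Type*}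
  [NonUnitalRing A] [StarRing A] [Module ℂ A]
  [NonUnitalRing B] [StarRing B] [Module ℂ B]
  [AddCommGroup X] [Module ℂ X] [AddCommGroup Y] [Module ℂ Y]

/-- `(Φ, φ)` is a morphism of Hilbert pro-C*-bimodules from `(X, A)` to `(Y, B)`. -/
structure IsBimoduleMorphism (p : Λ → A → ℝ) (q : Δ → B → ℝ)
    (𝓧 : InnerBimodule A A X) (𝓨 : InnerBimodule B B Y) (Φ : X → Y) (φ : A →⋆ₙₐ[ℂ] B) :
    Prop where
  continuous : SeminormContinuous p q φ
  map_right_act : ∀ x a, Φ (𝓧.right.act x a) = 𝓨.right.act (Φ x) (φ a)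
  map_left_act : ∀ a x, Φ (𝓧.left.act a x) = 𝓨.left.act (φ a) (Φ x)
  map_right_inner : ∀ x y, 𝓨.right.inner (Φ x) (Φ y) = φ (𝓧.right.inner x y)
  map_left_inner : ∀ x y, 𝓨.left.inner (Φ x) (Φ y) = φ (𝓧.left.inner x y)

/-- Nondegeneracy of a morphism `(Φ, φ)` from `(X, A)` to `(M(Y), M(B))`: the closed linear spans of
`φ(A) B` and `Φ(X) B` are `B` and `Y`. -/
structure IsNondegenerateMorphism [IsScalarTower ℂ B B] [SMulCommClass ℂ B B] [StarModule ℂ B]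
    (q : Δ → B → ℝ) (S : RightInnerModule B Y)
    (Φ : X → MultiplierSpace S) (φ : A →⋆ₙₐ[ℂ] MultiplierAlgebra B) : Prop where
  algebra : @closure B (seminormTopology q)
    (Submodule.span ℂ {c : B | ∃ a b, c = (φ a).map b} : Set B) = Set.univ
  module : @closure Y (seminormTopology (S.seminorm q))
    (Submodule.span ℂ {y : Y | ∃ x b, y = (Φ x).map b} : Set Y) = Set.univ

end Morphisms

-- The argument works one seminorm at a time. Completing `A` for `p i` gives a C*-algebra `B` and a
-- *-morphism `φ : A → B` with `‖φ a‖ = p i a`, so estimates in `p i` are norm estimates in a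
-- C*-algebra. Completeness of `A` makes polynomial functional calculus converge for all seminorms
-- simultaneously, which yields elements `g(h)` for self-adjoint `h` and continuous `g` with `g 0 =
-- 0` (`IsProCStarAlgebra.exists_cfcₙ`). Three consequences carry the rest: an approximate unit; a
-- cut-off moving a vector from one unit ball into all of them without changing its class for the
-- given seminorm (`RightInnerModule.exists_bounded`); and the factorization `x = y b` with `b = ⟨x,
-- x⟩^(1/4)` (`RightInnerModule.IsHilbert.exists_act_eq`).
--
-- An adjointable map is closed-graph-like in each seminorm, so a uniform boundedness argument on
-- the uniformly bounded vectors, followed by the cut-off, bounds it for each seminorm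
-- (`Adjointable.exists_bound`). Hence all operator seminorms are finite and `L_A(X)` is a
-- pro-C*-algebra.
--
-- By fullness, `a ↦ (x ↦ a x)` has the same kernel for the `i`-th operator seminorm as `p i`; two
-- C*-seminorms, one dominated by the other and with equal kernels, agree, so the left action is
-- isometric (`InnerBimodule.IsHilbert.opSeminorm_leftMul`). A multiplier `m` acts on `X` by `b y ↦
-- m(b) y`. Conversely, an operator `S` maps the image of `A` in `L_A(X)` into itself, because `S`
-- composed with the action of `⟨x, y⟩` is the action of `⟨S x, y⟩`; so `S` comes from a multiplier.
-- This gives `Ψ`, isometric for each seminorm.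
--
-- For the strict topology, both `T a = ι_X(T(a))` and `a T` lie in `ι_X(X)`. A strictly Cauchy net
-- converges pointwise, and so do its adjoints, since `T*(b y) = (b* T)* y`; the limit is therefore
-- adjointable. Density follows from `T e_k → T` for an approximate unit, and closedness of the
-- range from `ι_X` being isometric on a complete space.

universe u

open Filter Topology
-- Completion of a *-algebra with a C*-seminorm
open UniformSpace Completion in
/-- The multiplication of the completion of a seminormed non-unital ring. -/
@[reducible] noncomputable def nonUnitalCompletionMul (A : Type*) [NonUnitalSeminormedRing A] :
    Mul (Completion A) :=
  ⟨Function.curry <| (isDenseInducing_coe.prodMap isDenseInducing_coe).extend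
    ((↑) ∘ Function.uncurry (· * ·))⟩

section Completion

open UniformSpace Completion

variable {A : Type*} [NonUnitalSeminormedRing A]

attribute [local instance] nonUnitalCompletionMul

theorem completion_coe_mul (a b : A) : ((a * b : A) : Completion A) = a * b :=
  ((isDenseInducing_coe.prodMap isDenseInducing_coe).extend_eq
      ((continuous_coe A).comp (@continuous_mul A _ _ _)) (a, b)).symm

theorem completion_continuousMul : ContinuousMul (Completion A) where
  continuous_mul := by
    let m := (AddMonoidHom.mul : A →+ A →+ A).compr₂ toCompl
    have : Continuous fun p : A × A => m p.1 p.2 := (continuous_coe A).comp continuous_mul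
    have di : IsDenseInducing (toCompl : A → Completion A) := isDenseInducing_coe
    exact (di.extend_Z_bilin di this :)

attribute [local instance] completion_continuousMul

/-- The completion of a seminormed non-unital ring. -/
@[reducible] noncomputable def nonUnitalCompletionRing (A : Type*) [NonUnitalSeminormedRing A] :
    NonUnitalNormedRing (Completion A) where
  __ : NormedAddCommGroup (Completion A) := inferInstance
  __ : Mul (Completion A) := nonUnitalCompletionMul A
  zero_mul a :=
    Completion.induction_on a (isClosed_eq (by fun_prop) continuous_const)
      fun a => by rw [← coe_zero, ← completion_coe_mul, zero_mul]
  mul_zero a :=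
    Completion.induction_on a (isClosed_eq (by fun_prop) continuous_const)
      fun a => by rw [← coe_zero, ← completion_coe_mul, mul_zero]
  mul_assoc a b c :=
    Completion.induction_on₃ a b c (isClosed_eq (by fun_prop) (by fun_prop))
      fun a b c => by simp only [← completion_coe_mul, mul_assoc]
  left_distrib a b c :=
    Completion.induction_on₃ a b c (isClosed_eq (by fun_prop) (by fun_prop))
      fun a b c => by simp only [← completion_coe_mul, ← coe_add, mul_add]
  right_distrib a b c :=
    Completion.induction_on₃ a b c (isClosed_eq (by fun_prop) (by fun_prop))
      fun a b c => by simp only [← completion_coe_mul, ← coe_add, add_mul]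
  norm_mul_le x y := by
    induction x, y using induction_on₂ with
    | hp => apply isClosed_le <;> fun_prop
    | ih x y => simpa only [← completion_coe_mul, norm_coe] using norm_mul_le x y

attribute [local instance] nonUnitalCompletionRing

theorem completion_smul_mul [NormedSpace ℂ A] [IsScalarTower ℂ A A] (c : ℂ) (a b : Completion A) :
    c • a * b = c • (a * b) := by
  have hs : Continuous fun z : Completion A => c • z := continuous_const_smul c
  refine Completion.induction_on₂ a b ?_ fun a b => ?_
  · exact isClosed_eq ((hs.comp continuous_fst).mul continuous_snd) (hs.comp continuous_mul)
  · rw [← coe_smul, ← completion_coe_mul, ← completion_coe_mul, ← coe_smul, smul_mul_assoc]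

theorem completion_mul_smul [NormedSpace ℂ A] [SMulCommClass ℂ A A] (c : ℂ) (a b : Completion A) :
    a * c • b = c • (a * b) := by
  have hs : Continuous fun z : Completion A => c • z := continuous_const_smul c
  refine Completion.induction_on₂ a b ?_ fun a b => ?_
  · exact isClosed_eq (continuous_fst.mul (hs.comp continuous_snd)) (hs.comp continuous_mul)
  · rw [← coe_smul, ← completion_coe_mul, ← completion_coe_mul, ← coe_smul, mul_smul_comm]

variable [StarRing A]

/-- Cancel `‖a‖` in `‖a‖² = ‖a* a‖ ≤ ‖a*‖ ‖a‖`, then exchange `a` and `a*`. In particular the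
involution is isometric and extends to the completion. -/
theorem norm_star_of_norm_star_mul_self (h : ∀ a : A, ‖star a * a‖ = ‖a‖ ^ 2) (a : A) :
    ‖star a‖ = ‖a‖ := by
  have hle (a : A) : ‖a‖ ≤ ‖star a‖ := by
    have := norm_mul_le (star a) a
    rw [h, sq] at this
    rcases (norm_nonneg a).eq_or_lt with h0 | h0
    · rw [← h0]; positivity
    · exact le_of_mul_le_mul_right this h0
  exact le_antisymm (by simpa using hle (star a)) (hle a)

/-- The involution of the completion. -/
@[reducible] noncomputable def completionStar (A : Type*) [NonUnitalSeminormedRing A]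
    [StarRing A] : Star (Completion A) := ⟨Completion.map star⟩

attribute [local instance] completionStar

theorem completion_coe_star (h : ∀ a : A, ‖star a * a‖ = ‖a‖ ^ 2) (a : A) :
    ((star a : A) : Completion A) = star (a : Completion A) :=
  (Completion.map_coe (AddMonoidHomClass.isometry_of_norm (starAddEquiv : A ≃+ A)
    (norm_star_of_norm_star_mul_self h)).uniformContinuous a).symm

theorem completion_continuous_star : Continuous (star : Completion A → Completion A) :=
  Completion.continuous_map

/-- The completion as a *-ring. -/
@[reducible] noncomputable def completionStarRing (h : ∀ a : A, ‖star a * a‖ = ‖a‖ ^ 2) :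
    StarRing (Completion A) :=
  have hc : Continuous (star : Completion A → Completion A) := completion_continuous_star
  { star_involutive := fun a =>
      Completion.induction_on a (isClosed_eq (by fun_prop) (by fun_prop))
        fun a => by simp only [← completion_coe_star h, star_star]
    star_mul := fun a b =>
      Completion.induction_on₂ a b (isClosed_eq (by fun_prop) (by fun_prop))
        fun a b => by simp only [← completion_coe_star h, ← completion_coe_mul, star_mul]
    star_add := fun a b =>
      Completion.induction_on₂ a b (isClosed_eq (by fun_prop) (by fun_prop))
        fun a b => by simp only [← completion_coe_star h, ← coe_add, star_add] }

theorem completion_norm_mul_self_le (h : ∀ a : A, ‖star a * a‖ = ‖a‖ ^ 2) (a : Completion A) :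
    ‖a‖ * ‖a‖ ≤ ‖star a * a‖ := by
  have hc : Continuous (star : Completion A → Completion A) := completion_continuous_star
  refine Completion.induction_on a (isClosed_le (by fun_prop) (by fun_prop)) fun a => ?_
  rw [← completion_coe_star h, ← completion_coe_mul, norm_coe, norm_coe, h, sq]

theorem completion_star_smul [NormedSpace ℂ A] [StarModule ℂ A]
    (h : ∀ a : A, ‖star a * a‖ = ‖a‖ ^ 2) (c : ℂ) (a : Completion A) :
    star (c • a) = star c • star a := by
  have hc : Continuous (star : Completion A → Completion A) := completion_continuous_star
  refine Completion.induction_on a (isClosed_eq (hc.comp (continuous_const_smul c))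
    ((continuous_const_smul (star c)).comp hc)) fun a => ?_
  rw [← coe_smul, ← completion_coe_star h, ← completion_coe_star h, ← coe_smul, star_smul]

/-- The completion of a non-unital *-algebra with a C*-seminorm. -/
@[reducible] noncomputable def completionCStarAlgebra (A : Type*) [NonUnitalSeminormedRing A]
    [StarRing A] [NormedSpace ℂ A] [IsScalarTower ℂ A A] [SMulCommClass ℂ A A] [StarModule ℂ A]
    (h : ∀ a : A, ‖star a * a‖ = ‖a‖ ^ 2) :
    NonUnitalCStarAlgebra (Completion A) :=
  { nonUnitalCompletionRing A, completionStarRing h,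
    (inferInstance : NormedSpace ℂ (Completion A)) with
    norm_mul_self_le := completion_norm_mul_self_le h
    complete := CompleteSpace.complete
    smul_assoc := completion_smul_mul
    smul_comm := fun c a b => (completion_mul_smul c a b).symm
    star_smul := completion_star_smul h }

theorem exists_cstarAlgebra_of_norm {A : Type u} [NonUnitalSeminormedRing A]
    [StarRing A] [NormedSpace ℂ A] [IsScalarTower ℂ A A] [SMulCommClass ℂ A A] [StarModule ℂ A]
    (h : ∀ a : A, ‖star a * a‖ = ‖a‖ ^ 2) :
    ∃ (B : Type u) (_ : NonUnitalCStarAlgebra B) (φ : A →⋆ₙₐ[ℂ] B), ∀ a, ‖φ a‖ = ‖a‖ :=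
  ⟨Completion A, completionCStarAlgebra A h,
    letI := completionCStarAlgebra A h
    { toFun := fun a => (a : Completion A)
      map_smul' := fun c a => coe_smul c a
      map_zero' := coe_zero
      map_add' := fun a b => coe_add a b
      map_mul' := fun a b => completion_coe_mul a b
      map_star' := fun a => completion_coe_star h a }, fun a => norm_coe a⟩

end Completion

/-- A C*-seminorm. -/
structure IsCStarSeminorm {A : Type*} [NonUnitalRing A] [StarRing A] [Module ℂ A] (q : A → ℝ) :
    Prop where
  add_le : ∀ a b, q (a + b) ≤ q a + q b
  smul_eq : ∀ (c : ℂ) a, q (c • a) = ‖c‖ * q a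
  mul_le : ∀ a b, q (a * b) ≤ q a * q b
  star_mul_self : ∀ a, q (star a * a) = q a ^ 2

/-- The Hausdorff completion for `q` divides out the kernel of `q` by itself, so no quotient algebra
has to be formed. -/
theorem IsCStarSeminorm.exists_cstarAlgebra {A : Type u} [NonUnitalRing A] [StarRing A] [Module ℂ A]
    [IsScalarTower ℂ A A] [SMulCommClass ℂ A A] [StarModule ℂ A] {q : A → ℝ}
    (hq : IsCStarSeminorm q) :
    ∃ (B : Type u) (_ : NonUnitalCStarAlgebra B) (φ : A →⋆ₙₐ[ℂ] B), ∀ a, ‖φ a‖ = q a := by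
  have hz : q 0 = 0 := by simpa using hq.smul_eq 0 0
  have hn (a : A) : q (-a) = q a := by simpa using hq.smul_eq (-1) a
  let r : AddGroupSeminorm A :=
    { toFun := q
      map_zero' := hz
      add_le' := hq.add_le
      neg' := hn }
  let sg : SeminormedAddCommGroup A := r.toSeminormedAddCommGroup
  let _ : NonUnitalSeminormedRing A :=
    { ‹NonUnitalRing A› with
      toNorm := sg.toNorm
      toPseudoMetricSpace := sg.toPseudoMetricSpace
      dist_eq := sg.dist_eq
      norm_mul_le := hq.mul_le }
  let _ : NormedSpace ℂ A :=
    { ‹Module ℂ A› with norm_smul_le := fun c a => (hq.smul_eq c a).le }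
  exact exists_cstarAlgebra_of_norm (A := A) hq.star_mul_self

/-! ### Convergence and completeness for families of seminorms -/

section SeminormTopology

/-- A family of functions each of which is a seminorm. -/
def IsSeminormFamily {ι E : Type*} [AddCommGroup E] [Module ℂ E] (p : ι → E → ℝ) : Prop :=
  ∃ s : ι → Seminorm ℂ E, p = fun i x => s i x

variable {ι E : Type*} [AddCommGroup E] [Module ℂ E] {p : ι → E → ℝ}

theorem IsSeminormFamily.of_add_le_smul_eq (hadd : ∀ i x y, p i (x + y) ≤ p i x + p i y)
    (hsmul : ∀ i (c : ℂ) x, p i (c • x) = ‖c‖ * p i x) : IsSeminormFamily p :=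
  ⟨fun i => Seminorm.of (p i) (hadd i) (hsmul i), rfl⟩

namespace IsSeminormFamily

theorem add_le (hp : IsSeminormFamily p) (i : ι) (x y : E) : p i (x + y) ≤ p i x + p i y := by
  obtain ⟨s, rfl⟩ := hp; exact map_add_le_add (s i) x y

theorem sub_le (hp : IsSeminormFamily p) (i : ι) (x y : E) : p i (x - y) ≤ p i x + p i y := by
  obtain ⟨s, rfl⟩ := hp; exact map_sub_le_add (s i) x y

theorem smul_eq (hp : IsSeminormFamily p) (i : ι) (c : ℂ) (x : E) : p i (c • x) = ‖c‖ * p i x := by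
  obtain ⟨s, rfl⟩ := hp; exact map_smul_eq_mul (s i) c x

theorem nonneg (hp : IsSeminormFamily p) (i : ι) (x : E) : 0 ≤ p i x := by
  obtain ⟨s, rfl⟩ := hp; exact apply_nonneg (s i) x

theorem zero (hp : IsSeminormFamily p) (i : ι) : p i 0 = 0 := by
  obtain ⟨s, rfl⟩ := hp; exact map_zero (s i)

theorem sub_comm (hp : IsSeminormFamily p) (i : ι) (x y : E) : p i (x - y) = p i (y - x) := by
  obtain ⟨s, rfl⟩ := hp; exact map_sub_rev (s i) x y

theorem le_add_sub (hp : IsSeminormFamily p) (i : ι) (x y : E) : p i x ≤ p i y + p i (x - y) := by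
  simpa using hp.add_le i y (x - y)

theorem eq_of_sub_eq_zero (hp : IsSeminormFamily p) {i : ι} {x y : E} (h : p i (x - y) = 0) :
    p i x = p i y :=
  le_antisymm (by simpa [h] using hp.le_add_sub i x y)
    (by simpa [hp.sub_comm i y x, h] using hp.le_add_sub i y x)

theorem tendsto_of_tendsto_sub (hp : IsSeminormFamily p) {κ : Type*} {l : Filter κ} {u : κ → E}
    {x : E} {i : ι}
    (h : Tendsto (fun k => p i (u k - x)) l (𝓝 0)) :
    Tendsto (fun k => p i (u k)) l (𝓝 (p i x)) := by
  rw [tendsto_iff_dist_tendsto_zero]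
  refine squeeze_zero (fun _ => dist_nonneg) (fun k => ?_) h
  rw [Real.dist_eq, abs_sub_le_iff]
  constructor
  · linarith [hp.le_add_sub i (u k) x]
  · linarith [hp.le_add_sub i x (u k), hp.sub_comm i x (u k)]

theorem tendsto_unique (hp : IsSeminormFamily p) {κ : Type*} {l : Filter κ} [l.NeBot]
    {u : κ → E} {x y : E} {i : ι}
    (hx : Tendsto (fun k => p i (u k - x)) l (𝓝 0))
    (hy : Tendsto (fun k => p i (u k - y)) l (𝓝 0)) : p i (x - y) = 0 := by
  refine le_antisymm (ge_of_tendsto' (by simpa using hy.add hx) fun k => ?_) (hp.nonneg _ _)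
  simpa using hp.sub_le i (u k - y) (u k - x)

theorem uniformity_eq (hp : IsSeminormFamily p) : @uniformity E (seminormUniformity p) =
    ⨅ i, comap (fun z : E × E => p i (z.1 - z.2)) (𝓝 0) := by
  obtain ⟨s, rfl⟩ := hp
  rw [seminormUniformity_eq_iInf, iInf_uniformity]
  refine iInf_congr fun i => ?_
  let _ := (s i).toSeminormedAddCommGroup
  rw [Metric.uniformity_eq_comap_nhds_zero]
  simp only [dist_eq_norm]
  rfl

theorem nhds_eq (hp : IsSeminormFamily p) (x : E) : @nhds E (seminormTopology p) x =
    ⨅ i, comap (fun y => p i (y - x)) (𝓝 0) := by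
  rw [@nhds_eq_comap_uniformity E (seminormUniformity p), hp.uniformity_eq, comap_iInf]
  refine iInf_congr fun i => ?_
  rw [comap_comap]
  congr 1
  ext y
  exact hp.sub_comm i x y

theorem tendsto_nhds_iff (hp : IsSeminormFamily p) {κ : Type*} {l : Filter κ} {u : κ → E} {x : E} :
    Tendsto u l (@nhds E (seminormTopology p) x) ↔
      ∀ i, Tendsto (fun k => p i (u k - x)) l (𝓝 0) := by
  rw [hp.nhds_eq, tendsto_iInf]
  exact forall_congr' fun i => tendsto_comap_iff

theorem mem_closure_of_tendsto (hp : IsSeminormFamily p) {κ : Type*} {l : Filter κ} [l.NeBot]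
    {u : κ → E} {x : E} {S : Set E}
    (h : ∀ i, Tendsto (fun k => p i (u k - x)) l (𝓝 0)) (hS : ∀ k, u k ∈ S) :
    x ∈ @closure E (seminormTopology p) S :=
  let _ := seminormTopology p
  _root_.mem_closure_of_tendsto (hp.tendsto_nhds_iff.2 h) (Eventually.of_forall hS)

theorem exists_tendsto_of_mem_closure (hp : IsSeminormFamily p) {x : E} {S : Set E}
    (h : x ∈ @closure E (seminormTopology p) S) :
    ∃ l : Filter S, l.NeBot ∧ ∀ i, Tendsto (fun y : S => p i (y - x)) l (𝓝 0) := by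
  let _ := seminormTopology p
  refine ⟨comap (↑) (𝓝 x), mem_closure_iff_comap_neBot.1 h, ?_⟩
  exact hp.tendsto_nhds_iff.1 tendsto_comap

/-- This form replaces the uniform structure by convergence to zero of real functions, one for each
seminorm. -/
theorem completeSpace_iff (hp : IsSeminormFamily p) : @CompleteSpace E (seminormUniformity p) ↔
    ∀ F : Filter E, F.NeBot →
      (∀ i, Tendsto (fun z : E × E => p i (z.1 - z.2)) (F ×ˢ F) (𝓝 0)) →
      ∃ x, ∀ i, Tendsto (fun y => p i (y - x)) F (𝓝 0) := by
  let _ := seminormUniformity p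
  have key (F : Filter E) : F ×ˢ F ≤ uniformity E ↔
      ∀ i, Tendsto (fun z : E × E => p i (z.1 - z.2)) (F ×ˢ F) (𝓝 0) := by
    rw [show uniformity E = _ from hp.uniformity_eq, le_iInf_iff]
    exact forall_congr' fun i => tendsto_iff_comap.symm
  have key2 (F : Filter E) (x : E) : F ≤ 𝓝 x ↔
      ∀ i, Tendsto (fun y => p i (y - x)) F (𝓝 0) :=
    hp.tendsto_nhds_iff (u := id)
  constructor
  · intro hc F hF h
    obtain ⟨x, hx⟩ := hc.complete ⟨hF, (key F).2 h⟩
    exact ⟨x, (key2 F x).1 hx⟩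
  · intro h
    refine ⟨fun {F} hF => ?_⟩
    obtain ⟨x, hx⟩ := h F hF.1 ((key F).1 hF.2)
    exact ⟨x, (key2 F x).2 hx⟩

theorem exists_tendsto (hp : IsSeminormFamily p)
    (hc : @CompleteSpace E (seminormUniformity p)) {κ : Type*} {l : Filter κ} [l.NeBot] {u : κ → E}
    (h : ∀ i, Tendsto (fun z : κ × κ => p i (u z.1 - u z.2)) (l ×ˢ l) (𝓝 0)) :
    ∃ x, ∀ i, Tendsto (fun k => p i (u k - x)) l (𝓝 0) := by
  obtain ⟨x, hx⟩ := hp.completeSpace_iff.1 hc (map u l) inferInstance fun i => by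
    rw [prod_map_map_eq, tendsto_map'_iff]
    exact h i
  exact ⟨x, fun i => tendsto_map'_iff.1 (hx i)⟩

/-- Completeness in terms of a sequence with explicit Cauchy estimates. -/
theorem exists_tendsto_of_dist_le (hp : IsSeminormFamily p)
    (hc : @CompleteSpace E (seminormUniformity p)) {u : ℕ → E} {b : ℕ → ℝ}
    (hb : Tendsto b atTop (𝓝 0))
    (h : ∀ i, ∀ᶠ n in atTop, ∀ᶠ m in atTop, p i (u n - u m) ≤ b n) :
    ∃ x, ∀ i, Tendsto (fun k => p i (u k - x)) atTop (𝓝 0) := by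
  refine hp.exists_tendsto hc fun i => ?_
  rw [Metric.tendsto_nhds]
  intro ε hε
  obtain ⟨n, hn, hbn⟩ := ((h i).and (hb.eventually (gt_mem_nhds (half_pos hε)))).exists
  filter_upwards [hn.prod_mk hn] with z hz
  rw [Real.dist_eq, sub_zero, abs_of_nonneg (hp.nonneg _ _)]
  have := hp.sub_le i (u n - u z.2) (u n - u z.1)
  rw [sub_sub_sub_cancel_left] at this
  linarith [hz.1, hz.2]

/-- A Cauchy net whose terms are small apart from each other stays close to its limit. -/
theorem tendsto_sub_le (hp : IsSeminormFamily p) {κ : Type*} {l : Filter κ} [l.NeBot]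
    {u : κ → E} {x y : E} {i : ι} {c : ℝ}
    (h : Tendsto (fun k => p i (u k - x)) l (𝓝 0)) (hc : ∀ᶠ k in l, p i (y - u k) ≤ c) :
    p i (y - x) ≤ c := by
  have h1 : Tendsto (fun k => p i (y - u k)) l (𝓝 (p i (y - x))) := by
    have := hp.tendsto_of_tendsto_sub (u := fun k => u k - y) (x := x - y) (i := i) (l := l)
      (by simpa using h)
    simpa only [hp.sub_comm i y] using this
  exact le_of_tendsto h1 hc

end IsSeminormFamily

end SeminormTopology

/-! ### C*-seminorms and functional calculus in pro-C*-algebras -/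

namespace IsCStarSeminorm

variable {A : Type*} [NonUnitalRing A] [StarRing A] [Module ℂ A] {q : A → ℝ}

theorem zero (hq : IsCStarSeminorm q) : q 0 = 0 := by simpa using hq.smul_eq 0 0

theorem neg (hq : IsCStarSeminorm q) (a : A) : q (-a) = q a := by simpa using hq.smul_eq (-1) a

theorem nonneg (hq : IsCStarSeminorm q) (a : A) : 0 ≤ q a := by
  have := hq.add_le a (-a)
  rw [add_neg_cancel, hq.zero, hq.neg] at this
  linarith

theorem star_eq (hq : IsCStarSeminorm q) (a : A) : q (star a) = q a := by
  have hle (a : A) : q a ≤ q (star a) := by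
    have := hq.mul_le (star a) a
    rw [hq.star_mul_self, sq] at this
    rcases (hq.nonneg a).eq_or_lt with h0 | h0
    · rw [← h0]; exact hq.nonneg _
    · exact le_of_mul_le_mul_right this h0
  exact le_antisymm (by simpa using hle (star a)) (hle a)

theorem self_mul_star (hq : IsCStarSeminorm q) (a : A) : q (a * star a) = q a ^ 2 := by
  simpa [hq.star_eq] using hq.star_mul_self (star a)

end IsCStarSeminorm

/-- A *-morphism preserves continuous functional calculus on polynomials without constant term. -/
theorem exists_map_eq_cfcₙ_polynomial {A : Type u} [NonUnitalRing A] [StarRing A] [Module ℂ A]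
    {h : A} (hh : star h = h) (P : Polynomial ℝ) :
    ∃ c : A, ∀ (B : Type u) [NonUnitalCStarAlgebra B] (φ : A →⋆ₙₐ[ℂ] B),
      φ c = cfcₙ (fun t => P.eval t - P.eval 0) (φ h) := by
  -- `pw k` is the power `h ^ (k + 1)`; without a unit there is no zeroth power, which is why the
  -- constant term of `P` is removed.
  let pw : ℕ → A := fun n => n.rec h fun _ c => h * c
  refine ⟨∑ k ∈ Finset.range P.natDegree, ((P.coeff (k + 1) : ℝ) : ℂ) • pw k, fun B _ φ => ?_⟩
  have hsa : IsSelfAdjoint (φ h) := by rw [IsSelfAdjoint, ← map_star, hh]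
  have hpw (k : ℕ) : φ (pw k) = cfcₙ (fun t : ℝ => t ^ (k + 1)) (φ h) := by
    induction k with
    | zero => simp [pw, cfcₙ_id' ℝ (φ h)]
    | succ k ih =>
      change φ (h * pw k) = _
      rw [map_mul, ih]
      nth_rw 1 [← cfcₙ_id' ℝ (φ h)]
      rw [← cfcₙ_mul (fun t : ℝ => t) (fun t : ℝ => t ^ (k + 1)) (φ h)]
      congr 1
      ext t
      ring
  have hP : (fun t => P.eval t - P.eval 0) =
      ∑ k ∈ Finset.range P.natDegree, fun t : ℝ => P.coeff (k + 1) • t ^ (k + 1) := by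
    ext t
    rw [Finset.sum_apply, Polynomial.eval_eq_sum_range, Finset.sum_range_succ',
      ← Polynomial.coeff_zero_eq_eval_zero]
    simp
  rw [hP, cfcₙ_sum (fun k (t : ℝ) => P.coeff (k + 1) • t ^ (k + 1)) (φ h) (Finset.range P.natDegree)
    (fun k _ => by fun_prop) (fun k _ => by simp), map_sum]
  refine Finset.sum_congr rfl fun k _ => ?_
  rw [map_smul, hpw, cfcₙ_smul (P.coeff (k + 1)) (fun t : ℝ => t ^ (k + 1)) (φ h)]
  exact Complex.coe_smul _ _

namespace IsProCStarAlgebra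

variable {Λ : Type*} {A : Type u} [NonUnitalRing A] [StarRing A] [Module ℂ A]
  {p : Λ → A → ℝ}

theorem isSeminormFamily (hp : IsProCStarAlgebra p) : IsSeminormFamily p :=
  .of_add_le_smul_eq hp.add_le hp.smul_eq

theorem isCStarSeminorm (hp : IsProCStarAlgebra p) (i : Λ) : IsCStarSeminorm (p i) :=
  ⟨hp.add_le i, hp.smul_eq i, hp.mul_le i, hp.star_mul_self i⟩

theorem eq_of_sub_eq_zero (hp : IsProCStarAlgebra p) {a b : A} (h : ∀ i, p i (a - b) = 0) :
    a = b :=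
  sub_eq_zero.1 (hp.separating _ h)

variable [IsScalarTower ℂ A A] [SMulCommClass ℂ A A] [StarModule ℂ A]

/-- The restriction of a C*-seminorm to a level of a pro-C*-algebra, realised in a C*-algebra. -/
theorem exists_cstarAlgebra (hp : IsProCStarAlgebra p) (i : Λ) :
    ∃ (B : Type u) (_ : NonUnitalCStarAlgebra B) (φ : A →⋆ₙₐ[ℂ] B), ∀ a, ‖φ a‖ = p i a :=
  (hp.isCStarSeminorm i).exists_cstarAlgebra

/-- Continuous functional calculus in pro-C*-algebras. -/
theorem exists_cfcₙ (hp : IsProCStarAlgebra p) {h : A} (hh : star h = h) {g : ℝ → ℝ}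
    (hg : Continuous g) (hg0 : g 0 = 0) :
    ∃ c : A, star c = c ∧ ∀ (B : Type u) [NonUnitalCStarAlgebra B] (φ : A →⋆ₙₐ[ℂ] B),
      (∃ i, ∀ a, ‖φ a‖ ≤ p i a) → φ c = cfcₙ g (φ h) := by
  -- The `n`-th polynomial approximates `g` on `[-n, n]`, an interval that eventually contains the
  -- spectrum of `h` for each seminorm. Removing the constant term doubles the error, hence the
  -- approximation to within half the tolerance.
  have hP (n : ℕ) : ∃ P : Polynomial ℝ, ∀ t ∈ Set.Icc (-n : ℝ) n,
      ‖P.eval t - P.eval 0 - g t‖ ≤ 1 / ((n : ℝ) + 1) := by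
    obtain ⟨P, hP⟩ := exists_polynomial_near_of_continuousOn (-n) n g hg.continuousOn
      (1 / ((n : ℝ) + 1) / 2) (by positivity)
    refine ⟨P, fun t ht => ?_⟩
    have h1 := hP t ht
    have h2 := hP 0 ⟨by simp, by simp⟩
    rw [hg0] at h2
    rw [show P.eval t - P.eval 0 - g t = (P.eval t - g t) - (P.eval 0 - 0) by ring]
    refine (norm_sub_le _ _).trans ?_
    simp only [Real.norm_eq_abs]
    linarith
  choose P hP using hP
  choose c hc using fun n => exists_map_eq_cfcₙ_polynomial hh (P n)
  have hcont (n : ℕ) : Continuous fun t => (P n).eval t - (P n).eval 0 := by fun_prop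
  have near (B : Type u) [NonUnitalCStarAlgebra B] (φ : A →⋆ₙₐ[ℂ] B) (n : ℕ) (hn : ‖φ h‖ ≤ n) :
      ‖φ (c n) - cfcₙ g (φ h)‖ ≤ 1 / ((n : ℝ) + 1) := by
    have hsa : IsSelfAdjoint (φ h) := by rw [IsSelfAdjoint, ← map_star, hh]
    rw [hc, ← cfcₙ_sub _ _ (φ h) (hcont n).continuousOn (by simp) hg.continuousOn hg0]
    refine norm_cfcₙ_le fun t ht => hP n t ?_
    refine Set.mem_Icc.2 (abs_le.1 ?_)
    exact (NonUnitalIsometricContinuousFunctionalCalculus.norm_quasispectrum_le _ ht).trans hn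
  have hlim : Tendsto (fun n : ℕ => 2 * (1 / ((n : ℝ) + 1))) atTop (𝓝 0) := by
    simpa using tendsto_one_div_add_atTop_nhds_zero_nat.const_mul (2 : ℝ)
  have hlim1 : Tendsto (fun n : ℕ => 1 / ((n : ℝ) + 1)) atTop (𝓝 0) :=
    tendsto_one_div_add_atTop_nhds_zero_nat
  obtain ⟨d, hd⟩ := hp.isSeminormFamily.exists_tendsto_of_dist_le hp.complete (u := c) hlim
    fun i => by
      obtain ⟨B, _, φ, hφ⟩ := hp.exists_cstarAlgebra i
      filter_upwards [eventually_ge_atTop ⌈‖φ h‖⌉₊] with n hn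
      filter_upwards [eventually_ge_atTop n] with m hm
      have h1 := near B φ n (Nat.ceil_le.1 hn)
      have h2 := near B φ m (Nat.ceil_le.1 (hn.trans hm))
      have h3 : 1 / ((m : ℝ) + 1) ≤ 1 / ((n : ℝ) + 1) := by gcongr
      rw [← hφ, map_sub, ← sub_sub_sub_cancel_right _ _ (cfcₙ g (φ h))]
      exact (norm_sub_le _ _).trans (by linarith)
  have key (B : Type u) [NonUnitalCStarAlgebra B] (φ : A →⋆ₙₐ[ℂ] B)
      (hφ : ∃ i, ∀ a, ‖φ a‖ ≤ p i a) : φ d = cfcₙ g (φ h) := by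
    obtain ⟨i, hi⟩ := hφ
    have h1 : Tendsto (fun n => φ (c n)) atTop (𝓝 (φ d)) := by
      rw [tendsto_iff_norm_sub_tendsto_zero]
      exact squeeze_zero (fun _ => norm_nonneg _)
        (fun n => by rw [← map_sub]; exact hi _) (hd i)
    have h2 : Tendsto (fun n => φ (c n)) atTop (𝓝 (cfcₙ g (φ h))) := by
      rw [tendsto_iff_norm_sub_tendsto_zero]
      refine squeeze_zero' (Eventually.of_forall fun _ => norm_nonneg _) ?_ hlim1
      filter_upwards [eventually_ge_atTop ⌈‖φ h‖⌉₊] with n hn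
      exact near B φ n (Nat.ceil_le.1 hn)
    exact tendsto_nhds_unique h1 h2
  refine ⟨d, hp.eq_of_sub_eq_zero fun i => ?_, fun B _ φ hφ => key B φ hφ⟩
  obtain ⟨B, _, φ, hφ⟩ := hp.exists_cstarAlgebra i
  rw [← hφ, map_sub, map_star, key B φ ⟨i, fun a => (hφ a).le⟩, norm_eq_zero, sub_eq_zero]
  exact cfcₙ_predicate (R := ℝ) g (φ h)

end IsProCStarAlgebra

/-! ### Positivity and the core of the Cauchy-Schwarz inequality -/

section Order

variable {A : Type u} [NonUnitalRing A] [StarRing A] [Module ℂ A]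
  [IsScalarTower ℂ A A] [SMulCommClass ℂ A A] [StarModule ℂ A] {q : A → ℝ}

/-- In the C*-completion the summand is positive and below the sum, and the norm is monotone on
positive elements. -/
theorem IsCStarSeminorm.le_sum_star_mul_self (hq : IsCStarSeminorm q) {κ : Type*} {s : Finset κ}
    (f : κ → A) {k : κ} (hk : k ∈ s) :
    q (star (f k) * f k) ≤ q (∑ j ∈ s, star (f j) * f j) := by
  obtain ⟨B, _, φ, hφ⟩ := hq.exists_cstarAlgebra
  let _ := CStarAlgebra.spectralOrder B
  have := CStarAlgebra.spectralOrderedRing B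
  simp only [← hφ, map_sum, map_mul, map_star]
  exact CStarAlgebra.norm_le_norm_of_nonneg_of_le (star_mul_self_nonneg _)
    (Finset.single_le_sum (f := fun j => star (φ (f j)) * φ (f j))
      (fun j _ => star_mul_self_nonneg _) hk)

theorem IsCStarSeminorm.le_add_of_isPositiveElt (hq : IsCStarSeminorm q) {a b : A}
    (ha : IsPositiveElt a) (hb : IsPositiveElt b) : q a ≤ q (a + b) := by
  obtain ⟨a, rfl⟩ := ha
  obtain ⟨b, rfl⟩ := hb
  simpa using hq.le_sum_star_mul_self (s := Finset.univ) ![a, b] (Finset.mem_univ 0)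

/-- This is the Cauchy-Schwarz inequality with `c = ⟨x, z⟩`, `k = ⟨x, x⟩`, `y = ⟨z, z⟩`: the
hypothesis is the positivity of the inner square of `x (t c) - z`. Since `c* k c ≤ ‖k‖ c* c`, it
gives `(2 t - t² ‖k‖) c* c ≤ y`, and `t = 1 / ‖k‖` is the optimal choice. -/
theorem norm_sq_le_of_forall_nonneg {B : Type*} [NonUnitalCStarAlgebra B] [PartialOrder B]
    [StarOrderedRing B] {k c y : B} (hk : IsSelfAdjoint k)
    (h : ∀ t : ℝ, 0 ≤ t ^ 2 • (star c * k * c) - (2 * t) • (star c * c) + y) :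
    ‖c‖ ^ 2 ≤ ‖k‖ * ‖y‖ := by
  have key (t : ℝ) (ht : 0 ≤ 2 * t - t ^ 2 * ‖k‖) : (2 * t - t ^ 2 * ‖k‖) * ‖c‖ ^ 2 ≤ ‖y‖ := by
    have h1 : t ^ 2 • (star c * k * c) ≤ t ^ 2 • (‖k‖ • (star c * c)) :=
      smul_le_smul_of_nonneg_left CStarAlgebra.star_left_conjugate_le_norm_smul (sq_nonneg t)
    have h2 : (2 * t - t ^ 2 * ‖k‖) • (star c * c) ≤ y := by
      have := h t
      rw [sub_smul, mul_smul (t ^ 2), sub_le_iff_le_add]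
      rw [sub_add_eq_add_sub, sub_nonneg] at this
      rw [add_comm y]
      exact this.trans (by gcongr)
    have h3 := CStarAlgebra.norm_le_norm_of_nonneg_of_le
      (smul_nonneg ht (star_mul_self_nonneg c)) h2
    rwa [norm_smul, CStarRing.norm_star_mul_self, Real.norm_of_nonneg ht, ← sq] at h3
  rcases (norm_nonneg k).eq_or_lt with h0 | h0
  · rw [← h0] at key ⊢
    by_contra! hc
    rw [zero_mul] at hc
    -- For `k = 0` any `t ≥ 0` is allowed; this one would force `2 (‖y‖ + 1) ≤ ‖y‖`.
    have h5 := key ((‖y‖ + 1) / ‖c‖ ^ 2) (by simp; positivity)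
    have h6 : 2 * ((‖y‖ + 1) / ‖c‖ ^ 2) * ‖c‖ ^ 2 = 2 * (‖y‖ + 1) := by
      rw [mul_assoc, div_mul_cancel₀ _ hc.ne']
    rw [mul_zero, sub_zero, h6] at h5
    linarith [norm_nonneg y]
  · have h1 : 2 * ‖k‖⁻¹ - ‖k‖⁻¹ ^ 2 * ‖k‖ = ‖k‖⁻¹ := by field_simp; ring
    have := key ‖k‖⁻¹ (by rw [h1]; positivity)
    rw [h1, inv_mul_le_iff₀ h0] at this
    exact this

end Order

/-! ### Calculus with elements `g(h)`; approximate units -/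

/-- `c = g(h)` in the sense of continuous functional calculus. -/
structure IsCfc {Λ : Type*} {A : Type u} [NonUnitalRing A] [StarRing A] [Module ℂ A]
    (p : Λ → A → ℝ) (h : A) (g : ℝ → ℝ) (c : A) : Prop where
  continuous : Continuous g
  map_zero : g 0 = 0
  isSelfAdjoint : star h = h
  map_eq : ∀ (B : Type u) [NonUnitalCStarAlgebra B] (φ : A →⋆ₙₐ[ℂ] B),
    (∃ i, ∀ a, ‖φ a‖ ≤ p i a) → φ c = cfcₙ g (φ h)

section Cfc

variable {Λ : Type*} {A : Type u} [NonUnitalRing A] [StarRing A] [Module ℂ A]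
  {p : Λ → A → ℝ}

namespace IsCfc

variable {h c d : A} {f g : ℝ → ℝ}

theorem map_isSelfAdjoint (hc : IsCfc p h g c) {B : Type u} [NonUnitalCStarAlgebra B]
    (φ : A →⋆ₙₐ[ℂ] B) : IsSelfAdjoint (φ h) := by
  rw [IsSelfAdjoint, ← map_star, hc.isSelfAdjoint]

theorem id (hh : star h = h) : IsCfc p h (fun t => t) h where
  continuous := continuous_id
  map_zero := rfl
  isSelfAdjoint := hh
  map_eq B _ φ _ := by
    have : IsSelfAdjoint (φ h) := by rw [IsSelfAdjoint, ← map_star, hh]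
    rw [cfcₙ_id' ℝ (φ h)]

theorem sub (hc : IsCfc p h f c) (hd : IsCfc p h g d) : IsCfc p h (fun t => f t - g t) (c - d) where
  continuous := hc.continuous.sub hd.continuous
  map_zero := by rw [hc.map_zero, hd.map_zero, sub_zero]
  isSelfAdjoint := hc.isSelfAdjoint
  map_eq B _ φ hφ := by
    rw [map_sub, hc.map_eq B φ hφ, hd.map_eq B φ hφ,
      ← cfcₙ_sub f g (φ h) hc.continuous.continuousOn hc.map_zero hd.continuous.continuousOn
        hd.map_zero]

theorem mul (hc : IsCfc p h f c) (hd : IsCfc p h g d) : IsCfc p h (fun t => f t * g t) (c * d) where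
  continuous := hc.continuous.mul hd.continuous
  map_zero := by rw [hc.map_zero, zero_mul]
  isSelfAdjoint := hc.isSelfAdjoint
  map_eq B _ φ hφ := by
    rw [map_mul, hc.map_eq B φ hφ, hd.map_eq B φ hφ,
      ← cfcₙ_mul f g (φ h) hc.continuous.continuousOn hc.map_zero hd.continuous.continuousOn
        hd.map_zero]

variable [IsScalarTower ℂ A A] [SMulCommClass ℂ A A] [StarModule ℂ A]

theorem unique (hp : IsProCStarAlgebra p) (hc : IsCfc p h g c) (hd : IsCfc p h g d) : c = d := by
  refine hp.eq_of_sub_eq_zero fun i => ?_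
  obtain ⟨B, _, φ, hφ⟩ := hp.exists_cstarAlgebra i
  have hi : ∃ i, ∀ a, ‖φ a‖ ≤ p i a := ⟨i, fun a => (hφ a).le⟩
  rw [← hφ, map_sub, hc.map_eq B φ hi, hd.map_eq B φ hi, sub_self, norm_zero]

theorem star_eq (hp : IsProCStarAlgebra p) (hc : IsCfc p h g c) : star c = c := by
  refine hp.eq_of_sub_eq_zero fun i => ?_
  obtain ⟨B, _, φ, hφ⟩ := hp.exists_cstarAlgebra i
  have hi : ∃ i, ∀ a, ‖φ a‖ ≤ p i a := ⟨i, fun a => (hφ a).le⟩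
  rw [← hφ, map_sub, map_star, hc.map_eq B φ hi, norm_eq_zero, sub_eq_zero]
  exact cfcₙ_predicate (R := ℝ) g (φ h)

/-- The spectrum of the image of `h` lies in `[-q h, q h]`. Here `q` may be any C*-seminorm
dominated by a defining one, which is what the comparison of seminorms in `le_of_ker_le` needs. -/
theorem seminorm_le (hc : IsCfc p h g c) {q : A → ℝ} (hq : IsCStarSeminorm q)
    (hqp : ∃ i, ∀ a, q a ≤ p i a) {C : ℝ} (hC : ∀ t, |t| ≤ q h → |g t| ≤ C) : q c ≤ C := by
  obtain ⟨B, _, φ, hφ⟩ := hq.exists_cstarAlgebra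
  rw [← hφ, hc.map_eq B φ (by simpa only [hφ] using hqp)]
  have := hc.map_isSelfAdjoint φ
  refine norm_cfcₙ_le fun t ht => hC t ?_
  rw [← hφ]
  exact NonUnitalIsometricContinuousFunctionalCalculus.norm_quasispectrum_le _ ht

/-- Positivity of `h` confines the spectrum to `[0, p i h]`, so `g` needs control only there. -/
theorem seminorm_le_of_nonneg (hp : IsProCStarAlgebra p) (hc : IsCfc p h g c)
    (hh : IsPositiveElt h) {i : Λ} {C : ℝ}
    (hC : ∀ t, 0 ≤ t → t ≤ p i h → |g t| ≤ C) : p i c ≤ C := by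
  obtain ⟨B, _, φ, hφ⟩ := hp.exists_cstarAlgebra i
  rw [← hφ, hc.map_eq B φ ⟨i, fun a => (hφ a).le⟩]
  have := hc.map_isSelfAdjoint φ
  let _ := CStarAlgebra.spectralOrder B
  have := CStarAlgebra.spectralOrderedRing B
  have hn : 0 ≤ φ h := by
    obtain ⟨b, rfl⟩ := hh
    rw [map_mul, map_star]
    exact star_mul_self_nonneg _
  refine norm_cfcₙ_le fun t ht => ?_
  have h0 : 0 ≤ t := quasispectrum_nonneg_of_nonneg _ hn t ht
  refine hC t h0 ?_
  rw [← hφ]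
  exact (le_abs_self t).trans
    (NonUnitalIsometricContinuousFunctionalCalculus.norm_quasispectrum_le _ ht)

end IsCfc

namespace IsProCStarAlgebra

variable [IsScalarTower ℂ A A] [SMulCommClass ℂ A A] [StarModule ℂ A]

theorem exists_isCfc (hp : IsProCStarAlgebra p) {h : A} (hh : star h = h) {g : ℝ → ℝ}
    (hg : Continuous g) (hg0 : g 0 = 0) : ∃ c, IsCfc p h g c := by
  obtain ⟨c, -, hc⟩ := hp.exists_cfcₙ hh hg hg0
  exact ⟨c, hg, hg0, hh, hc⟩

/-- A C*-seminorm dominated by one of the defining seminorms and with the same kernel is equal to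
it. -/
theorem le_of_ker_le (hp : IsProCStarAlgebra p) {q : A → ℝ} (hq : IsCStarSeminorm q) {i : Λ}
    (hqp : ∀ a, q a ≤ p i a) (hker : ∀ a, q a = 0 → p i a = 0) (a : A) : p i a ≤ q a := by
  by_contra! hlt
  set h := star a * a with hdef
  have hlt' : q h < p i h := by
    rw [hdef, hq.star_mul_self, hp.star_mul_self]
    exact pow_lt_pow_left₀ hlt (hq.nonneg a) two_ne_zero
  have hq0 := hq.nonneg h
  -- The function vanishes on `[-q h, q h]`, so `q` kills `c`. The spectrum for `p i` contains a
  -- point of modulus `p i h > q h`, where the function is positive; so `p i` does not kill `c`.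
  obtain ⟨c, hc⟩ := hp.exists_isCfc (h := h) (by simp [hdef])
    (g := fun t => max 0 (|t| - q h)) (by fun_prop) (by simp [hq0])
  have hqc : q c = 0 := by
    refine le_antisymm (hc.seminorm_le hq ⟨i, hqp⟩ fun t ht => ?_) (hq.nonneg c)
    simp [ht]
  have hpc := hker c hqc
  obtain ⟨B, _, φ, hφ⟩ := hp.exists_cstarAlgebra i
  have hsa := hc.map_isSelfAdjoint φ
  obtain ⟨t, ht, hteq⟩ :=
    (NonUnitalIsometricContinuousFunctionalCalculus.isGreatest_norm_quasispectrum
      (𝕜 := ℝ) (φ h)).1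
  have := norm_apply_le_norm_cfcₙ _ (φ h) ht hc.continuous.continuousOn hc.map_zero
  rw [← hc.map_eq B φ ⟨i, fun a => (hφ a).le⟩, hφ, hpc] at this
  simp only [Real.norm_eq_abs, hφ] at hteq this
  rw [hteq] at this
  have h3 := (le_abs_self _).trans this
  have h4 := (le_max_right 0 (p i h - q h)).trans h3
  linarith

theorem exists_approximateUnit (hp : IsProCStarAlgebra p) (s : Finset A) {ε : ℝ} (hε : 0 < ε) :
    ∃ e : A, star e = e ∧ ∀ i, ∀ a ∈ s, p i (e * a - a) ≤ ε := by
  classical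
  set h := ∑ a ∈ s, a * star a with hdef
  have hh : star h = h := by simp [hdef, star_sum]
  have hδ : 0 < ε ^ 2 := by positivity
  have hden (t : ℝ) : 0 < |t| + ε ^ 2 := by positivity
  -- With `h = ∑ a a*` and `e = |h| / (|h| + ε²)`, the sum of `(e a - a)(e a - a)*` over `s` is `h
  -- (1 - e)²`, which corresponds to `t (ε² / (|t| + ε²))²`. This is bounded by `ε²` on the whole
  -- line, so one `e` serves all seminorms.
  obtain ⟨e, he⟩ := hp.exists_isCfc hh (g := fun t => |t| / (|t| + ε ^ 2))
    (Continuous.div (by fun_prop) (by fun_prop) fun t => (hden t).ne') (by simp)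
  have hes := he.star_eq hp
  refine ⟨e, hes, fun i a ha => ?_⟩
  have h1 := ((IsCfc.id (p := p) hh).sub ((IsCfc.id hh).mul he)).sub
    ((he.mul (IsCfc.id hh)).sub ((he.mul (IsCfc.id hh)).mul he))
  have h2 : ∑ b ∈ s, star (star (e * b - b)) * star (e * b - b) =
      h - h * e - (e * h - e * h * e) := by
    rw [hdef, Finset.sum_mul, Finset.mul_sum, Finset.sum_mul, ← Finset.sum_sub_distrib,
      ← Finset.sum_sub_distrib, ← Finset.sum_sub_distrib]
    refine Finset.sum_congr rfl fun b _ => ?_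
    rw [star_star, star_sub, star_mul, hes]
    noncomm_ring
  have h3 := (hp.isCStarSeminorm i).le_sum_star_mul_self (fun b => star (e * b - b)) ha
  rw [h2, hp.star_mul_self, (hp.isCStarSeminorm i).star_eq] at h3
  refine abs_le_of_sq_le_sq' (h3.trans ?_) hε.le |>.2
  refine h1.seminorm_le (hp.isCStarSeminorm i) ⟨i, fun a => le_rfl⟩ fun t _ => ?_
  have h4 : t - t * (|t| / (|t| + ε ^ 2)) - (|t| / (|t| + ε ^ 2) * t -
      |t| / (|t| + ε ^ 2) * t * (|t| / (|t| + ε ^ 2))) = t * (ε ^ 2 / (|t| + ε ^ 2)) ^ 2 := by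
    field_simp [(hden t).ne']
    ring
  rw [h4, abs_mul, abs_of_nonneg (by positivity : 0 ≤ (ε ^ 2 / (|t| + ε ^ 2)) ^ 2), div_pow,
    mul_div_assoc', div_le_iff₀ (by have := hden t; positivity)]
  nlinarith [abs_nonneg t, mul_nonneg hδ.le (sq_nonneg |t|), pow_pos hδ 3,
    mul_nonneg (abs_nonneg t) (sq_nonneg (ε ^ 2))]

/-- An approximate unit, as a net of self-adjoint elements. -/
theorem exists_tendsto_mul (hp : IsProCStarAlgebra p) :
    ∃ e : Finset A × ℕ → A, (∀ k, star (e k) = e k) ∧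
      ∀ i a, Tendsto (fun k => p i (e k * a - a)) atTop (𝓝 0) := by
  -- The index records the finite set to be approximated and the tolerance `1 / (n + 1)`.
  choose e he hea using fun k : Finset A × ℕ =>
    hp.exists_approximateUnit k.1 (Nat.one_div_pos_of_nat (α := ℝ) (n := k.2))
  refine ⟨e, he, fun i a => ?_⟩
  refine squeeze_zero' (Eventually.of_forall fun k => hp.isSeminormFamily.nonneg i _)
    (g := fun k => 1 / ((k.2 : ℝ) + 1)) ?_ ?_
  · filter_upwards [eventually_ge_atTop ({a}, 0)] with k hk
    exact hea k i a (hk.1 (Finset.mem_singleton_self a))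
  · rw [← prod_atTop_atTop_eq]
    exact tendsto_one_div_add_atTop_nhds_zero_nat.comp tendsto_snd

end IsProCStarAlgebra

end Cfc

/-! ### Hilbert modules: Cauchy-Schwarz, cut-off, factorization -/

namespace RightInnerModule

section Algebra

variable {A X : Type*} [NonUnitalRing A] [StarRing A] [Module ℂ A] [AddCommGroup X] [Module ℂ X]
  (R : RightInnerModule A X)

theorem inner_sub_right (x y z : X) : R.inner x (y - z) = R.inner x y - R.inner x z := by
  rw [sub_eq_add_neg, R.inner_add_right, R.inner_neg_right, sub_eq_add_neg]

theorem inner_sub_left (x y z : X) : R.inner (x - y) z = R.inner x z - R.inner y z := by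
  rw [sub_eq_add_neg, R.inner_add_left, R.inner_neg_left, sub_eq_add_neg]

theorem sub_act (x y : X) (a : A) : R.act (x - y) a = R.act x a - R.act y a := by
  rw [sub_eq_add_neg, R.add_act, R.neg_act, sub_eq_add_neg]

theorem act_sub (x : X) (a b : A) : R.act x (a - b) = R.act x a - R.act x b := by
  rw [eq_sub_iff_add_eq, ← R.act_add, sub_add_cancel]

variable {R}

theorem ext_inner_right (h0 : ∀ x, R.inner x x = 0 ↔ x = 0) {x y : X}
    (h : ∀ z, R.inner x z = R.inner y z) : x = y := by
  rw [← sub_eq_zero, ← h0, R.inner_sub_left, h, sub_self]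

theorem ext_inner_left (h0 : ∀ x, R.inner x x = 0 ↔ x = 0) {x y : X}
    (h : ∀ z, R.inner z x = R.inner z y) : x = y := by
  rw [← sub_eq_zero, ← h0, R.inner_sub_right, h, sub_self]

end Algebra

variable {Λ : Type*} {A : Type u} {X : Type*} [NonUnitalRing A] [StarRing A] [Module ℂ A]
  [AddCommGroup X] [Module ℂ X] {R : RightInnerModule A X} {p : Λ → A → ℝ}

theorem seminorm_nonneg (i : Λ) (x : X) : 0 ≤ R.seminorm p i x := Real.sqrt_nonneg _

theorem sq_seminorm (hp : IsProCStarAlgebra p) (i : Λ) (x : X) :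
    R.seminorm p i x ^ 2 = p i (R.inner x x) :=
  Real.sq_sqrt (hp.isSeminormFamily.nonneg _ _)

theorem seminorm_act_le (hp : IsProCStarAlgebra p) (i : Λ) (x : X) (a : A) :
    R.seminorm p i (R.act x a) ≤ R.seminorm p i x * p i a := by
  have ha := hp.isSeminormFamily.nonneg i a
  refine abs_le_of_sq_le_sq' ?_ (mul_nonneg (seminorm_nonneg i x) ha) |>.2
  rw [sq_seminorm hp, R.inner_act_left, R.inner_act_right, mul_pow, sq_seminorm hp]
  refine (hp.mul_le i _ _).trans ?_
  rw [(hp.isCStarSeminorm i).star_eq]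
  nlinarith [hp.mul_le i (R.inner x x) a]

theorem seminorm_le_of_inner_le (hp : IsProCStarAlgebra p) {i : Λ} {x : X} {C : ℝ} (hC : 0 ≤ C)
    (h : p i (R.inner x x) ≤ C * R.seminorm p i x) : R.seminorm p i x ≤ C := by
  rw [← sq_seminorm hp, sq] at h
  rcases (seminorm_nonneg (R := R) (p := p) i x).eq_or_lt with h0 | h0
  · rwa [← h0]
  · exact le_of_mul_le_mul_right h h0

theorem IsHilbert.eq_of_sub_eq_zero (hp : IsProCStarAlgebra p) (hR : R.IsHilbert p) {x y : X}
    (h : ∀ i, R.seminorm p i (x - y) = 0) : x = y := by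
  rw [← sub_eq_zero, ← hR.definite]
  refine hp.separating _ fun i => ?_
  rw [← sq_seminorm hp, h i, zero_pow two_ne_zero]

variable [IsScalarTower ℂ A A] [SMulCommClass ℂ A A] [StarModule ℂ A]

/-- The Cauchy-Schwarz inequality. -/
theorem inner_le (hp : IsProCStarAlgebra p) (hR : ∀ x, IsPositiveElt (R.inner x x)) (i : Λ)
    (x y : X) : p i (R.inner x y) ≤ R.seminorm p i x * R.seminorm p i y := by
  obtain ⟨B, _, φ, hφ⟩ := hp.exists_cstarAlgebra i
  let _ := CStarAlgebra.spectralOrder B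
  have := CStarAlgebra.spectralOrderedRing B
  have h1 : ‖φ (R.inner x y)‖ ^ 2 ≤ ‖φ (R.inner x x)‖ * ‖φ (R.inner y y)‖ := by
    refine norm_sq_le_of_forall_nonneg ?_ fun t => ?_
    · rw [IsSelfAdjoint, ← map_star, R.star_inner]
    · obtain ⟨d, hd⟩ := hR (R.act x ((t : ℂ) • R.inner x y) - y)
      have h2 : 0 ≤ φ (R.inner (R.act x ((t : ℂ) • R.inner x y) - y)
          (R.act x ((t : ℂ) • R.inner x y) - y)) := by
        rw [hd, map_mul, map_star]
        exact star_mul_self_nonneg _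
      convert h2 using 1
      simp only [R.inner_sub_left, R.inner_sub_right, R.inner_act_left, R.inner_act_right,
        R.act_smul, R.inner_smul_left, R.inner_smul_right, map_sub, map_mul, map_smul,
        R.star_inner, Complex.star_def, Complex.conj_ofReal,
        ← map_star φ (R.inner x y)]
      simp only [mul_smul_comm, Complex.coe_smul, smul_smul]
      rw [← sq, two_mul, add_smul, mul_assoc]
      abel
  rw [hφ, hφ, hφ, ← sq_seminorm hp, ← sq_seminorm hp, ← mul_pow] at h1
  exact (abs_le_of_sq_le_sq' h1 (mul_nonneg (seminorm_nonneg i x) (seminorm_nonneg i y))).2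

theorem isSeminormFamily (hp : IsProCStarAlgebra p) (hR : ∀ x, IsPositiveElt (R.inner x x)) :
    IsSeminormFamily (R.seminorm p) := by
  refine .of_add_le_smul_eq (fun i x y => ?_) fun i c x => ?_
  · refine abs_le_of_sq_le_sq' ?_ (add_nonneg (seminorm_nonneg i x) (seminorm_nonneg i y)) |>.2
    rw [sq_seminorm hp, R.inner_add_left, R.inner_add_right, R.inner_add_right]
    have h1 := hp.add_le i (R.inner x x + R.inner x y) (R.inner y x + R.inner y y)
    have h2 := hp.add_le i (R.inner x x) (R.inner x y)
    have h3 := hp.add_le i (R.inner y x) (R.inner y y)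
    rw [← sq_seminorm hp] at h2 h3
    nlinarith [inner_le hp hR i x y, inner_le hp hR i y x]
  · rw [RightInnerModule.seminorm, R.inner_smul_left, R.inner_smul_right, smul_smul,
      hp.smul_eq, norm_mul, norm_star, ← sq, Real.sqrt_mul (sq_nonneg _),
      Real.sqrt_sq (norm_nonneg c)]
    rfl

theorem tendsto_inner_left (hp : IsProCStarAlgebra p) (hR : ∀ x, IsPositiveElt (R.inner x x))
    {κ : Type*} {l : Filter κ} {u : κ → X} {x : X} {i : Λ}
    (h : Tendsto (fun k => R.seminorm p i (u k - x)) l (𝓝 0)) (y : X) :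
    Tendsto (fun k => p i (R.inner (u k) y - R.inner x y)) l (𝓝 0) := by
  refine squeeze_zero (fun k => hp.isSeminormFamily.nonneg i _) (fun k => ?_)
    (by simpa using h.mul_const (R.seminorm p i y))
  rw [← R.inner_sub_left]
  exact inner_le hp hR i _ _

theorem tendsto_inner_right (hp : IsProCStarAlgebra p) (hR : ∀ x, IsPositiveElt (R.inner x x))
    {κ : Type*} {l : Filter κ} {u : κ → X} {x : X} {i : Λ}
    (h : Tendsto (fun k => R.seminorm p i (u k - x)) l (𝓝 0)) (y : X) :
    Tendsto (fun k => p i (R.inner y (u k) - R.inner y x)) l (𝓝 0) := by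
  refine squeeze_zero (fun k => hp.isSeminormFamily.nonneg i _) (fun k => ?_)
    (by simpa using h.const_mul (R.seminorm p i y))
  rw [← R.inner_sub_right]
  exact inner_le hp hR i _ _

section Cfc

variable {x : X} {c : A} {g : ℝ → ℝ}

/-- The inner square of `x g(⟨x, x⟩)` is the element given by `t g(t)²`, so vectors of this form are
estimated by one-variable calculus. -/
theorem seminorm_act_le_of_isCfc (hp : IsProCStarAlgebra p)
    (hR : ∀ x, IsPositiveElt (R.inner x x)) (hc : IsCfc p (R.inner x x) g c) {i : Λ} {C : ℝ}
    (hC : 0 ≤ C) (h : ∀ t, 0 ≤ t → t ≤ p i (R.inner x x) → t * g t ^ 2 ≤ C ^ 2) :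
    R.seminorm p i (R.act x c) ≤ C := by
  refine abs_le_of_sq_le_sq' ?_ hC |>.2
  rw [sq_seminorm hp, R.inner_act_left, R.inner_act_right, hc.star_eq hp]
  refine (hc.mul ((IsCfc.id hc.isSelfAdjoint).mul hc)).seminorm_le_of_nonneg hp (hR x)
    fun t h0 h1 => ?_
  rw [show g t * (t * g t) = t * g t ^ 2 by ring, abs_of_nonneg (by positivity)]
  exact h t h0 h1

theorem seminorm_act_sub_le_of_isCfc (hp : IsProCStarAlgebra p)
    (hR : ∀ x, IsPositiveElt (R.inner x x)) (hc : IsCfc p (R.inner x x) g c) {i : Λ} {C : ℝ}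
    (hC : 0 ≤ C) (h : ∀ t, 0 ≤ t → t ≤ p i (R.inner x x) → t * (g t - 1) ^ 2 ≤ C ^ 2) :
    R.seminorm p i (R.act x c - x) ≤ C := by
  refine abs_le_of_sq_le_sq' ?_ hC |>.2
  have hid := IsCfc.id (p := p) hc.isSelfAdjoint
  have h1 : R.inner (R.act x c - x) (R.act x c - x) =
      c * (R.inner x x * c) - c * R.inner x x - (R.inner x x * c - R.inner x x) := by
    simp only [R.inner_sub_left, R.inner_sub_right, R.inner_act_left, R.inner_act_right,
      hc.star_eq hp]
  rw [sq_seminorm hp, h1]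
  refine (((hc.mul (hid.mul hc)).sub (hc.mul hid)).sub
    ((hid.mul hc).sub hid)).seminorm_le_of_nonneg hp (hR x) fun t h0 h1 => ?_
  rw [show g t * (t * g t) - g t * t - (t * g t - t) = t * (g t - 1) ^ 2 by ring,
    abs_of_nonneg (by positivity)]
  exact h t h0 h1

end Cfc

/-- An element of the unit ball of one seminorm is equivalent to an element of all unit balls. -/
theorem exists_bounded (hp : IsProCStarAlgebra p) (hR : ∀ x, IsPositiveElt (R.inner x x)) {i : Λ}
    {x : X} (hx : R.seminorm p i x ≤ 1) :
    ∃ y, R.seminorm p i (y - x) = 0 ∧ ∀ j, R.seminorm p j y ≤ 1 := by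
  have hpos (t : ℝ) : 0 < √(max 1 t) := by positivity
  -- The vector wanted is `x / √(max 1 ⟨x, x⟩)`; subtracting from `1` gives a function vanishing at
  -- `0`, and `y = x - x c`. The function is zero on `[0, 1]`, where the `i`-th spectrum lies, and
  -- `t / max 1 t ≤ 1` bounds `y` in all seminorms.
  obtain ⟨c, hc⟩ := hp.exists_isCfc (h := R.inner x x) (R.star_inner x x)
    (g := fun t => 1 - 1 / √(max 1 t))
    (continuous_const.sub (continuous_const.div (by fun_prop) fun t => (hpos t).ne')) (by simp)
  have hneg (j : Λ) : R.seminorm p j (x - R.act x c) = R.seminorm p j (R.act x c - x) :=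
    (isSeminormFamily hp hR).sub_comm j _ _
  refine ⟨x - R.act x c, le_antisymm ?_ (seminorm_nonneg _ _), fun j => ?_⟩
  · rw [sub_sub_cancel_left, ← zero_sub, (isSeminormFamily hp hR).sub_comm, sub_zero]
    refine seminorm_act_le_of_isCfc hp hR hc le_rfl fun t h0 h1 => ?_
    have h2 : t ≤ 1 := h1.trans (by
      rw [← sq_seminorm hp]; exact pow_le_one₀ (seminorm_nonneg _ _) hx)
    simp [max_eq_left h2]
  · rw [hneg]
    refine seminorm_act_sub_le_of_isCfc hp hR hc zero_le_one fun t h0 _ => ?_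
    rw [sub_sub_cancel_left, neg_sq, div_pow, Real.sq_sqrt (by positivity), one_pow,
      mul_one_div, div_le_one (by positivity)]
    exact le_max_right _ _

/-- This bounds the error `s - s⁵ / (s⁴ + d⁴)` of the regularized quotient uniformly in `s`, as used
in `IsHilbert.exists_act_eq` with `s = t^(1/4)`. -/
theorem mul_pow_div_le {s d : ℝ} (hs : 0 ≤ s) (hd : 0 < d) : s * d ^ 4 / (s ^ 4 + d ^ 4) ≤ d := by
  rw [div_le_iff₀ (by positivity)]
  rcases le_total s d with h | h
  · nlinarith [mul_le_mul_of_nonneg_right h (by positivity : 0 ≤ d ^ 4),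
      mul_nonneg hd.le (by positivity : 0 ≤ s ^ 4)]
  · have h3 : d ^ 3 ≤ s ^ 3 := pow_le_pow_left₀ hd.le h 3
    nlinarith [mul_le_mul_of_nonneg_left h3 (mul_nonneg hs hd.le), pow_pos hd 5]

/-- Every element of a Hilbert module is a product. -/
theorem IsHilbert.exists_act_eq (hp : IsProCStarAlgebra p) (hR : R.IsHilbert p) (x : X) :
    ∃ y b, x = R.act y b := by
  have hpos := hR.positive
  have hsa := R.star_inner x x
  set s : ℝ → ℝ := fun t => √(√t) with hs
  have hs0 (t : ℝ) : 0 ≤ s t := Real.sqrt_nonneg _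
  have hs4 (t : ℝ) (ht : 0 ≤ t) : s t ^ 4 = t := by
    rw [show s t ^ 4 = (s t ^ 2) ^ 2 by ring, Real.sq_sqrt (Real.sqrt_nonneg t), Real.sq_sqrt ht]
  let δ : ℕ → ℝ := fun n => 1 / ((n : ℝ) + 1)
  have hδ (n : ℕ) : 0 < δ n := Nat.one_div_pos_of_nat
  have hδlim : Tendsto δ atTop (𝓝 0) := tendsto_one_div_add_atTop_nhds_zero_nat
  have hden (n : ℕ) (t : ℝ) : 0 < s t ^ 4 + δ n ^ 4 := by
    have := hδ n
    have := hs0 t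
    positivity
  obtain ⟨b, hb⟩ := hp.exists_isCfc hsa (g := s) (by fun_prop) (by simp [hs])
  -- Formally `x = (x s⁻¹) s` with `s = ⟨x, x⟩^(1/4)`. The inverse is regularized to `s³ / (s⁴ +
  -- δ⁴)`, and `y` is the limit of `x c_n`.
  choose c hc using fun n => hp.exists_isCfc hsa (g := fun t => s t ^ 3 / (s t ^ 4 + δ n ^ 4))
    (Continuous.div (by fun_prop) (by fun_prop) fun t => (hden n t).ne') (by simp [hs])
  have hlim2 : Tendsto (fun n => 2 * δ n) atTop (𝓝 0) := by simpa using hδlim.const_mul 2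
  have hfrac (n : ℕ) (t : ℝ) : s t ^ 2 * (s t ^ 3 / (s t ^ 4 + δ n ^ 4)) =
      s t - s t * δ n ^ 4 / (s t ^ 4 + δ n ^ 4) := by
    have := (hden n t).ne'
    field_simp
    ring
  have hfrac0 (n : ℕ) (t : ℝ) : 0 ≤ s t * δ n ^ 4 / (s t ^ 4 + δ n ^ 4) :=
    div_nonneg (mul_nonneg (hs0 t) (pow_nonneg (hδ n).le 4)) (hden n t).le
  obtain ⟨y, hy⟩ := (isSeminormFamily hp hpos).exists_tendsto_of_dist_le hR.complete
    (u := fun n => R.act x (c n)) hlim2 fun i => by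
      refine Eventually.of_forall fun n => ?_
      filter_upwards [eventually_ge_atTop n] with m hm
      rw [← R.act_sub]
      have hmn : δ m ≤ δ n := Nat.one_div_le_one_div hm
      refine seminorm_act_le_of_isCfc hp hpos ((hc n).sub (hc m))
        (mul_nonneg zero_le_two (hδ n).le) fun t ht _ => ?_
      nth_rw 1 [← hs4 t ht]
      -- Since `t = s⁴`, the inner square of `x (c_n - c_m)` is the square of `s² c_n - s² c_m`, and
      -- each `s² c_n` lies within `δ n` of `s`.
      rw [show ∀ a b c : ℝ, a ^ 4 * (b - c) ^ 2 = (a ^ 2 * b - a ^ 2 * c) ^ 2 by intros; ring,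
        hfrac, hfrac, sq_le_sq, abs_of_nonneg (mul_nonneg zero_le_two (hδ n).le), abs_le]
      have h1 := mul_pow_div_le (hs0 t) (hδ n)
      have h2 := mul_pow_div_le (hs0 t) (hδ m)
      constructor <;> linarith [hfrac0 n t, hfrac0 m t]
  refine ⟨y, b, hR.eq_of_sub_eq_zero hp fun i => ?_⟩
  have h1 : Tendsto (fun n => R.seminorm p i (R.act (R.act x (c n)) b - R.act y b)) atTop
      (𝓝 0) := by
    refine squeeze_zero (fun n => seminorm_nonneg _ _) (fun n => ?_)
      (by simpa using (hy i).mul_const (p i b))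
    rw [← R.sub_act]
    exact seminorm_act_le hp i _ _
  have h2 : Tendsto (fun n => R.seminorm p i (R.act (R.act x (c n)) b - x)) atTop (𝓝 0) := by
    have hlim : Tendsto (fun n => p i b * δ n) atTop (𝓝 0) := by
      simpa using hδlim.const_mul (p i b)
    have hS : Tendsto (fun n => (1 + p i (R.inner x x)) * δ n) atTop (𝓝 0) := by
      simpa using hδlim.const_mul (1 + p i (R.inner x x))
    have hnn := hp.isSeminormFamily.nonneg i (R.inner x x)
    refine squeeze_zero (fun n => seminorm_nonneg _ _) (fun n => ?_) hS
    rw [← R.act_mul]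
    refine seminorm_act_sub_le_of_isCfc hp hpos ((hc n).mul hb)
      (mul_nonneg (by linarith) (hδ n).le) fun t ht hti => ?_
    have h3 : s t ^ 3 / (s t ^ 4 + δ n ^ 4) * s t - 1 = - (δ n ^ 4 / (s t ^ 4 + δ n ^ 4)) := by
      have := (hden n t).ne'
      field_simp
      ring
    -- A crude bound for the fourth root on the `i`-th spectrum suffices, since only convergence in
    -- each seminorm is needed.
    have hst : s t ≤ 1 + p i (R.inner x x) := by
      by_contra! hlt
      have h5 : 1 < s t := by linarith
      have h6 : s t ≤ s t ^ 4 := le_self_pow₀ h5.le (by norm_num)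
      rw [hs4 t ht] at h6
      linarith
    have h4 : s t ^ 2 * (δ n ^ 4 / (s t ^ 4 + δ n ^ 4)) ≤ (1 + p i (R.inner x x)) * δ n := by
      calc s t ^ 2 * (δ n ^ 4 / (s t ^ 4 + δ n ^ 4))
          = s t * (s t * δ n ^ 4 / (s t ^ 4 + δ n ^ 4)) := by ring
        _ ≤ _ := mul_le_mul hst (mul_pow_div_le (hs0 t) (hδ n)) (hfrac0 n t) (by linarith)
    rw [h3, neg_sq]
    nth_rw 1 [← hs4 t ht]
    rw [show ∀ a b : ℝ, a ^ 4 * b ^ 2 = (a ^ 2 * b) ^ 2 by intros; ring]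
    exact pow_le_pow_left₀ (mul_nonneg (sq_nonneg _)
      (div_nonneg (pow_nonneg (hδ n).le 4) (hden n t).le)) h4 2
  exact (isSeminormFamily hp hpos).tendsto_unique h2 h1

end RightInnerModule

/-! ### A uniform boundedness principle -/

namespace IsSeminormFamily

variable {ι E : Type*} [AddCommGroup E] [Module ℂ E] {p : ι → E → ℝ}

/-- The subspace of elements at which all the seminorms of a family are uniformly bounded. -/
def boundedPart (hp : IsSeminormFamily p) : Submodule ℂ E where
  carrier := {x | BddAbove (Set.range fun j => p j x)}
  add_mem' := by
    rintro x y ⟨C, hC⟩ ⟨D, hD⟩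
    refine ⟨C + D, ?_⟩
    rintro _ ⟨j, rfl⟩
    exact (hp.add_le j x y).trans (add_le_add (hC ⟨j, rfl⟩) (hD ⟨j, rfl⟩))
  zero_mem' := ⟨0, by rintro _ ⟨j, rfl⟩; exact (hp.zero j).le⟩
  smul_mem' := by
    rintro c x ⟨C, hC⟩
    refine ⟨‖c‖ * C, ?_⟩
    rintro _ ⟨j, rfl⟩
    exact (hp.smul_eq j c x).le.trans (mul_le_mul_of_nonneg_left (hC ⟨j, rfl⟩) (norm_nonneg c))

/-- The supremum of the family, as a seminorm on its bounded part. -/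
noncomputable def supSeminorm [Nonempty ι] (hp : IsSeminormFamily p) :
    Seminorm ℂ hp.boundedPart :=
  Seminorm.of (fun x => ⨆ j, p j x)
    (fun x y => ciSup_le fun j => (hp.add_le j x y).trans
      (add_le_add (le_ciSup x.2 j) (le_ciSup y.2 j)))
    (fun c x => by
      rw [Real.mul_iSup_of_nonneg (norm_nonneg c)]
      exact iSup_congr fun j => hp.smul_eq j c x)

theorem le_supSeminorm [Nonempty ι] (hp : IsSeminormFamily p) (j : ι) (x : hp.boundedPart) :
    p j x ≤ hp.supSeminorm x :=
  le_ciSup x.2 j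

/-- A uniform boundedness principle: a seminorm that is a pointwise supremum of continuous seminorms
is bounded on the intersection of the unit balls. -/
theorem exists_le_of_isLUB [Nonempty ι] (hp : IsSeminormFamily p)
    (hc : @CompleteSpace E (seminormUniformity p)) (q : Seminorm ℂ E)
    (hq : ∀ x, ∀ c < q x, ∃ r : Seminorm ℂ E, (∃ j C, ∀ y, r y ≤ C * p j y) ∧ c < r x ∧
      ∀ y, r y ≤ q y) :
    ∃ C, ∀ x, (∀ j, p j x ≤ 1) → q x ≤ C := by
  let _ : SeminormedAddCommGroup hp.boundedPart :=
    hp.supSeminorm.toAddGroupSeminorm.toSeminormedAddCommGroup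
  let _ : NormedSpace ℂ hp.boundedPart :=
    { norm_smul_le := fun c x => (map_smul_eq_mul hp.supSeminorm c x).le }
  have hnorm (j : ι) (x : hp.boundedPart) : p j x ≤ ‖x‖ := hp.le_supSeminorm j x
  have hle {x : hp.boundedPart} {C : ℝ} (h : ∀ j, p j x ≤ C) : ‖x‖ ≤ C := ciSup_le h
  -- A sequence that is Cauchy for the supremum converges in `E`; its Cauchy bounds do not depend on
  -- `j`, so they pass to the limit, show that the limit is bounded, and give convergence for the
  -- supremum.
  have : CompleteSpace hp.boundedPart := by
    refine Metric.complete_of_cauchySeq_tendsto fun u hu => ?_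
    obtain ⟨b, hb0, hb, hblim⟩ := cauchySeq_iff_le_tendsto_0.1 hu
    have hd (j : ι) (n m : ℕ) (h : n ≤ m) : p j (u n - u m) ≤ b n :=
      (hnorm j (u n - u m)).trans (by
        rw [← dist_eq_norm]; exact hb n m n le_rfl h)
    obtain ⟨x, hx⟩ := hp.exists_tendsto_of_dist_le hc (u := fun n => (u n : E)) hblim fun j =>
      Eventually.of_forall fun n => (eventually_ge_atTop n).mono fun m hm => hd j n m hm
    have hux (j : ι) (n : ℕ) : p j (u n - x) ≤ b n :=
      hp.tendsto_sub_le (hx j) ((eventually_ge_atTop n).mono fun m hm => hd j n m hm)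
    have hmem (n : ℕ) : (u n - x : E) ∈ hp.boundedPart :=
      ⟨b n, by rintro _ ⟨j, rfl⟩; exact hux j n⟩
    have hxm : x ∈ hp.boundedPart := by
      simpa using hp.boundedPart.sub_mem (u 0).2 (hmem 0)
    refine ⟨⟨x, hxm⟩, ?_⟩
    rw [tendsto_iff_norm_sub_tendsto_zero]
    exact squeeze_zero (fun n => norm_nonneg _) (fun n => hle fun j => hux j n) hblim
  let Q : Seminorm ℂ hp.boundedPart := q.comp hp.boundedPart.subtype
  -- Being a pointwise supremum of continuous seminorms, `Q` is lower semicontinuous; completeness,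
  -- through Baire's theorem, makes it continuous.
  have hQ : Continuous Q := by
    refine Seminorm.continuous_of_lowerSemicontinuous Q fun x c hcx => ?_
    obtain ⟨r, ⟨j, C, hrC⟩, hcr, hrq⟩ := hq x c hcx
    let r' : Seminorm ℂ hp.boundedPart := r.comp hp.boundedPart.subtype
    have hr' : Continuous r' := by
      refine Seminorm.continuous_of_continuousAt_zero ?_
      rw [ContinuousAt, map_zero]
      have h0 : Tendsto (fun y : hp.boundedPart => |C| * ‖y‖) (𝓝 0) (𝓝 0) :=
        (continuous_const.mul continuous_norm).tendsto' 0 0 (by simp)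
      refine squeeze_zero (fun y => apply_nonneg r' y) (fun y => (hrC y).trans ?_) h0
      exact (mul_le_mul_of_nonneg_right (le_abs_self C) (hp.nonneg j y)).trans
        (mul_le_mul_of_nonneg_left (hnorm j y) (abs_nonneg C))
    filter_upwards [hr'.continuousAt.eventually (lt_mem_nhds hcr)] with y hy
    exact hy.trans_le (hrq y)
  obtain ⟨C, hC0, hC⟩ := Q.bound_of_continuous_normedSpace hQ
  refine ⟨C, fun x hx => ?_⟩
  have hxm : x ∈ hp.boundedPart := ⟨1, by rintro _ ⟨j, rfl⟩; exact hx j⟩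
  refine (hC ⟨x, hxm⟩).trans ?_
  exact mul_le_of_le_one_right hC0.le (hle hx)

end IsSeminormFamily

/-! ### Adjointable maps: boundedness, the C*-identity, completeness, positivity -/

namespace Adjointable

section Algebra

variable {A Y Z : Type*} [NonUnitalRing A] [StarRing A] [Module ℂ A]
  [AddCommGroup Y] [Module ℂ Y] [AddCommGroup Z] [Module ℂ Z]
  {R : RightInnerModule A Y} {S : RightInnerModule A Z}

theorem sub_map (T V : Adjointable R S) : (T - V).map = T.map - V.map := by
  rw [sub_eq_add_neg, add_map, neg_map, sub_eq_add_neg]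

theorem sub_adj (T V : Adjointable R S) : (T - V).adj = T.adj - V.adj := by
  rw [sub_eq_add_neg, add_adj, neg_adj, sub_eq_add_neg]

theorem inner_adj (T : Adjointable R S) (z : Z) (y : Y) :
    R.inner (T.adj z) y = S.inner z (T.map y) := by
  rw [← R.star_inner, ← T.inner_map, S.star_inner]

theorem ext_map (hR : ∀ y, R.inner y y = 0 ↔ y = 0) {T V : Adjointable R S}
    (h : ∀ y, T.map y = V.map y) : T = V := by
  refine Adjointable.ext (LinearMap.ext h) (LinearMap.ext fun z => ?_)
  refine RightInnerModule.ext_inner_left hR fun y => ?_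
  rw [← T.inner_map, ← V.inner_map, h]

/-- Mutually adjoint functions are linear and module maps. -/
def ofInner [StarModule ℂ A] (hR : ∀ y, R.inner y y = 0 ↔ y = 0)
    (hS : ∀ z, S.inner z z = 0 ↔ z = 0) (v : Y → Z) (w : Z → Y)
    (h : ∀ y z, S.inner (v y) z = R.inner y (w z)) : Adjointable R S where
  map :=
    { toFun := v
      map_add' := fun x y => RightInnerModule.ext_inner_right hS fun z => by
        rw [h, R.inner_add_left, S.inner_add_left, h, h]
      map_smul' := fun c y => RightInnerModule.ext_inner_right hS fun z => by
        rw [h, R.inner_smul_left, RingHom.id_apply, S.inner_smul_left, h] }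
  adj :=
    { toFun := w
      map_add' := fun x y => RightInnerModule.ext_inner_left hR fun z => by
        rw [← h, R.inner_add_right, S.inner_add_right, h, h]
      map_smul' := fun c y => RightInnerModule.ext_inner_left hR fun z => by
        rw [← h, S.inner_smul_right, RingHom.id_apply, R.inner_smul_right, h] }
  map_act x a := RightInnerModule.ext_inner_right hS fun z => by
    change S.inner (v _) z = S.inner (S.act (v x) a) z
    rw [h, R.inner_act_left, S.inner_act_left, h]
  adj_act x a := RightInnerModule.ext_inner_left hR fun z => by
    change R.inner z (w _) = R.inner z (R.act (w x) a)
    rw [← h, S.inner_act_right, R.inner_act_right, h]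
  inner_map := h

end Algebra

variable {Λ : Type*} {A : Type u} {Y Z W : Type*} [NonUnitalRing A] [StarRing A] [Module ℂ A]
  [AddCommGroup Y] [Module ℂ Y] [AddCommGroup Z] [Module ℂ Z] [AddCommGroup W] [Module ℂ W]
  {R : RightInnerModule A Y} {S : RightInnerModule A Z} {U : RightInnerModule A W} {p : Λ → A → ℝ}

theorem opSeminorm_nonneg (T : Adjointable R S) (i : Λ) : 0 ≤ T.opSeminorm p i :=
  Real.sSup_nonneg (by rintro _ ⟨y, -, rfl⟩; exact RightInnerModule.seminorm_nonneg _ _)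

variable [IsScalarTower ℂ A A] [SMulCommClass ℂ A A] [StarModule ℂ A]

/-- Cauchy-Schwarz is applied to `⟨T y, T y⟩ = ⟨y, T* T y⟩`. Boundedness of `T` is not assumed, so
this is available before it is known; it already shows that `T` respects the kernels of the
seminorms. -/
theorem sq_seminorm_map_le (hp : IsProCStarAlgebra p) (hR : ∀ y, IsPositiveElt (R.inner y y))
    (T : Adjointable R S) (i : Λ) (y : Y) :
    S.seminorm p i (T.map y) ^ 2 ≤ R.seminorm p i y * R.seminorm p i (T.adj (T.map y)) := by
  rw [RightInnerModule.sq_seminorm hp, T.inner_map]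
  exact RightInnerModule.inner_le hp hR i _ _

theorem seminorm_map_eq_zero (hp : IsProCStarAlgebra p) (hR : ∀ y, IsPositiveElt (R.inner y y))
    (T : Adjointable R S) {i : Λ} {y : Y} (hy : R.seminorm p i y = 0) :
    S.seminorm p i (T.map y) = 0 := by
  have := T.sq_seminorm_map_le hp hR i y
  rw [hy, zero_mul] at this
  exact pow_eq_zero_iff two_ne_zero |>.1 (le_antisymm this (sq_nonneg _))

/-- Adjointable maps are bounded for each of the seminorms. -/
theorem exists_bound (hp : IsProCStarAlgebra p) (hR : R.IsHilbert p) (hS : S.IsHilbert p)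
    (T : Adjointable R S) (i : Λ) :
    ∃ C, ∀ y, R.seminorm p i y ≤ 1 → S.seminorm p i (T.map y) ≤ C := by
  have : Nonempty Λ := ⟨i⟩
  have hfR := RightInnerModule.isSeminormFamily hp hR.positive
  have hfS := RightInnerModule.isSeminormFamily hp hS.positive
  obtain ⟨sS, hsS⟩ := id hfS
  obtain ⟨sA, hsA⟩ := hp.isSeminormFamily
  obtain ⟨C, hC⟩ := hfR.exists_le_of_isLUB hR.complete ((sS i).comp T.map) fun x c hcx => by
    have hq (x : Y) : (sS i).comp T.map x = S.seminorm p i (T.map x) := by rw [hsS]; rfl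
    rw [hq] at hcx
    have hnn : 0 ≤ S.seminorm p i (T.map x) := RightInnerModule.seminorm_nonneg _ _
    -- The seminorm `y ↦ ‖T y‖_i` is the supremum of `y ↦ p i ⟨z, T y⟩` over `‖z‖_i ≤ 1`, attained
    -- at `x` by the normalized `T x`. Each of these is continuous because `⟨z, T y⟩ = ⟨T* z, y⟩`.
    -- If `‖T x‖_i = 0`, the inverse is `0` and the claims remain true.
    let z := (((S.seminorm p i (T.map x))⁻¹ : ℝ) : ℂ) • T.map x
    let F : Y →ₗ[ℂ] A :=
      { toFun := fun y => S.inner z (T.map y)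
        map_add' := fun y y' => by rw [map_add, S.inner_add_right]
        map_smul' := fun c y => by rw [map_smul, S.inner_smul_right]; rfl }
    have hF (y : Y) : (sA i).comp F y = p i (S.inner z (T.map y)) := by rw [hsA]; rfl
    have hz : S.seminorm p i z ≤ 1 := by
      rw [hfS.smul_eq, Complex.norm_real, norm_inv, Real.norm_of_nonneg hnn]
      exact inv_mul_le_one
    have hfF : p i (S.inner z (T.map x)) = S.seminorm p i (T.map x) := by
      rw [S.inner_smul_left, hp.smul_eq, norm_star, Complex.norm_real, norm_inv,
        Real.norm_of_nonneg hnn, ← RightInnerModule.sq_seminorm hp, sq]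
      rcases hnn.eq_or_lt with h | h
      · rw [← h]; simp
      · field_simp
    refine ⟨(sA i).comp F, ⟨i, R.seminorm p i (T.adj z), fun y => ?_⟩, ?_, fun y => ?_⟩
    · rw [hF, ← T.inner_adj]
      exact RightInnerModule.inner_le hp hR.positive i _ _
    · rwa [hF, hfF]
    · rw [hF, hq]
      exact (RightInnerModule.inner_le hp hS.positive i _ _).trans
        (mul_le_of_le_one_left (RightInnerModule.seminorm_nonneg _ _) hz)
  refine ⟨C, fun y hy => ?_⟩
  -- The constant so far covers only vectors in all unit balls. The cut-off provides such a vector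
  -- with the same class for the `i`-th seminorm, and `T` respects these classes.
  obtain ⟨y', hy', hb⟩ := RightInnerModule.exists_bounded hp hR.positive hy
  have h1 := T.seminorm_map_eq_zero hp hR.positive hy'
  rw [map_sub] at h1
  rw [← hfS.eq_of_sub_eq_zero h1]
  have := hC y' hb
  rw [hsS]
  exact this

theorem bddAbove_unitBallValues (hp : IsProCStarAlgebra p) (hR : R.IsHilbert p)
    (hS : S.IsHilbert p) (T : Adjointable R S) (i : Λ) : BddAbove (T.unitBallValues p i) := by
  obtain ⟨C, hC⟩ := T.exists_bound hp hR hS i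
  refine ⟨C, ?_⟩
  rintro _ ⟨y, hy, rfl⟩
  exact hC y hy

theorem opSeminorm_le (hp : IsProCStarAlgebra p) (hR : R.IsHilbert p)
    {T : Adjointable R S} {i : Λ} {C : ℝ}
    (h : ∀ y, R.seminorm p i y ≤ 1 → S.seminorm p i (T.map y) ≤ C) : T.opSeminorm p i ≤ C := by
  refine csSup_le ⟨_, 0, ?_, rfl⟩ ?_
  · rw [(RightInnerModule.isSeminormFamily hp hR.positive).zero]
    exact zero_le_one
  · rintro _ ⟨y, hy, rfl⟩
    exact h y hy

theorem seminorm_map_le_of_le_one (hp : IsProCStarAlgebra p) (hR : R.IsHilbert p)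
    (hS : S.IsHilbert p) (T : Adjointable R S) {i : Λ} {y : Y} (hy : R.seminorm p i y ≤ 1) :
    S.seminorm p i (T.map y) ≤ T.opSeminorm p i :=
  le_csSup (T.bddAbove_unitBallValues hp hR hS i) ⟨y, hy, rfl⟩

theorem seminorm_map_le (hp : IsProCStarAlgebra p) (hR : R.IsHilbert p) (hS : S.IsHilbert p)
    (T : Adjointable R S) (i : Λ) (y : Y) :
    S.seminorm p i (T.map y) ≤ T.opSeminorm p i * R.seminorm p i y := by
  have hnn : 0 ≤ R.seminorm p i y := RightInnerModule.seminorm_nonneg _ _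
  rcases hnn.eq_or_lt with h | h
  · rw [T.seminorm_map_eq_zero hp hR.positive h.symm, ← h, mul_zero]
  · have := T.seminorm_map_le_of_le_one hp hR hS (i := i)
      (y := (((R.seminorm p i y)⁻¹ : ℝ) : ℂ) • y) (by
        rw [(RightInnerModule.isSeminormFamily hp hR.positive).smul_eq, Complex.norm_real, norm_inv,
          Real.norm_of_nonneg hnn]
        exact inv_mul_le_one)
    rw [map_smul, (RightInnerModule.isSeminormFamily hp hS.positive).smul_eq, Complex.norm_real,
      norm_inv, Real.norm_of_nonneg hnn, inv_mul_le_iff₀ h] at this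
    rwa [mul_comm]

theorem opSeminorm_le_of_forall_le_mul (hp : IsProCStarAlgebra p) (hR : R.IsHilbert p)
    {T : Adjointable R S} {i : Λ} {C : ℝ} (hC : 0 ≤ C)
    (h : ∀ y, S.seminorm p i (T.map y) ≤ C * R.seminorm p i y) : T.opSeminorm p i ≤ C :=
  opSeminorm_le hp hR fun y hy => (h y).trans (mul_le_of_le_one_right hC hy)

theorem isSeminormFamily_opSeminorm (hp : IsProCStarAlgebra p) (hR : R.IsHilbert p)
    (hS : S.IsHilbert p) :
    IsSeminormFamily (fun i (T : Adjointable R S) => T.opSeminorm p i) := by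
  have hf := RightInnerModule.isSeminormFamily hp hS.positive
  have hsmul (i : Λ) (c : ℂ) (T : Adjointable R S) :
      (c • T).opSeminorm p i ≤ ‖c‖ * T.opSeminorm p i := by
    refine opSeminorm_le hp hR fun y hy => ?_
    rw [smul_map, LinearMap.smul_apply, hf.smul_eq]
    exact mul_le_mul_of_nonneg_left (T.seminorm_map_le_of_le_one hp hR hS hy) (norm_nonneg c)
  refine .of_add_le_smul_eq (fun i T V => ?_) fun i c T => le_antisymm (hsmul i c T) ?_
  · refine opSeminorm_le hp hR fun y hy => ?_
    exact (hf.add_le i _ _).trans (add_le_add (T.seminorm_map_le_of_le_one hp hR hS hy)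
      (V.seminorm_map_le_of_le_one hp hR hS hy))
  · rcases eq_or_ne c 0 with rfl | hc
    · simpa using opSeminorm_nonneg _ _
    · have := hsmul i c⁻¹ (c • T)
      rw [inv_smul_smul₀ hc, norm_inv] at this
      rwa [← le_inv_mul_iff₀ (norm_pos_iff.2 hc)]

theorem opSeminorm_comp_le (hp : IsProCStarAlgebra p) (hR : R.IsHilbert p) (hS : S.IsHilbert p)
    (hU : U.IsHilbert p) (T : Adjointable S U) (V : Adjointable R S) (i : Λ) :
    (T.comp V).opSeminorm p i ≤ T.opSeminorm p i * V.opSeminorm p i :=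
  opSeminorm_le hp hR fun _ hy => (T.seminorm_map_le hp hS hU i _).trans
    (mul_le_mul_of_nonneg_left (V.seminorm_map_le_of_le_one hp hR hS hy) (opSeminorm_nonneg _ _))

/-- From `‖T* z‖² = p i ⟨z, T T* z⟩ ≤ ‖z‖ ‖T‖ ‖T* z‖`, cancel `‖T* z‖`. -/
theorem opSeminorm_adjoint_le (hp : IsProCStarAlgebra p) (hR : R.IsHilbert p)
    (hS : S.IsHilbert p) (T : Adjointable R S) (i : Λ) :
    T.adjoint.opSeminorm p i ≤ T.opSeminorm p i := by
  refine opSeminorm_le_of_forall_le_mul hp hS (opSeminorm_nonneg _ _) fun z => ?_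
  refine RightInnerModule.seminorm_le_of_inner_le hp (mul_nonneg (opSeminorm_nonneg _ _)
    (RightInnerModule.seminorm_nonneg _ _)) ?_
  rw [adjoint_map, T.inner_adj]
  refine (RightInnerModule.inner_le hp hS.positive i _ _).trans ?_
  rw [mul_comm (T.opSeminorm p i), mul_assoc]
  exact mul_le_mul_of_nonneg_left (T.seminorm_map_le hp hR hS i _)
    (RightInnerModule.seminorm_nonneg _ _)

theorem opSeminorm_adjoint (hp : IsProCStarAlgebra p) (hR : R.IsHilbert p) (hS : S.IsHilbert p)
    (T : Adjointable R S) (i : Λ) : T.adjoint.opSeminorm p i = T.opSeminorm p i :=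
  le_antisymm (T.opSeminorm_adjoint_le hp hR hS i) (T.adjoint.opSeminorm_adjoint_le hp hS hR i)

theorem opSeminorm_adjoint_comp_self (hp : IsProCStarAlgebra p) (hR : R.IsHilbert p)
    (hS : S.IsHilbert p) (T : Adjointable R S) (i : Λ) :
    (T.adjoint.comp T).opSeminorm p i = T.opSeminorm p i ^ 2 := by
  refine le_antisymm ?_ ?_
  · rw [sq]
    nth_rw 1 [← T.opSeminorm_adjoint hp hR hS]
    exact opSeminorm_comp_le hp hR hS hR _ _ i
  · rw [← Real.le_sqrt (opSeminorm_nonneg _ _) (opSeminorm_nonneg _ _)]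
    refine opSeminorm_le hp hR fun y hy => Real.le_sqrt_of_sq_le ?_
    refine (T.sq_seminorm_map_le hp hR.positive i y).trans ?_
    refine (mul_le_of_le_one_left (RightInnerModule.seminorm_nonneg _ _) hy).trans ?_
    exact (T.adjoint.comp T).seminorm_map_le_of_le_one hp hR hR hy

/-- A larger seminorm has a smaller unit ball, so monotonicity is not immediate; the cut-off
replaces a vector of the `i`-th ball by an equivalent one that also lies in the `j`-th ball. -/
theorem opSeminorm_mono (hp : IsProCStarAlgebra p) (hR : R.IsHilbert p) (hS : S.IsHilbert p)
    {i j : Λ} (hij : p i ≤ p j) (T : Adjointable R S) : T.opSeminorm p i ≤ T.opSeminorm p j := by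
  refine opSeminorm_le hp hR fun y hy => ?_
  obtain ⟨y', hy', hb⟩ := RightInnerModule.exists_bounded hp hR.positive hy
  have h1 := T.seminorm_map_eq_zero hp hR.positive hy'
  rw [map_sub] at h1
  rw [← (RightInnerModule.isSeminormFamily hp hS.positive).eq_of_sub_eq_zero h1]
  exact (Real.sqrt_le_sqrt (hij _)).trans (T.seminorm_map_le_of_le_one hp hR hS (hb j))

/-- Pointwise limits of adjointable maps, together with their adjoints, are adjointable. -/
theorem exists_of_tendsto (hp : IsProCStarAlgebra p) (hR : R.IsHilbert p) (hS : S.IsHilbert p)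
    {κ : Type*} {l : Filter κ} [l.NeBot] {u : κ → Adjointable R S}
    (hv : ∀ y, ∃ z, ∀ i, Tendsto (fun k => S.seminorm p i ((u k).map y - z)) l (𝓝 0))
    (hw : ∀ z, ∃ y, ∀ i, Tendsto (fun k => R.seminorm p i ((u k).adj z - y)) l (𝓝 0)) :
    ∃ T : Adjointable R S,
      (∀ y i, Tendsto (fun k => S.seminorm p i ((u k).map y - T.map y)) l (𝓝 0)) ∧
      ∀ z i, Tendsto (fun k => R.seminorm p i ((u k).adj z - T.adj z)) l (𝓝 0) := by
  choose v hv using hv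
  choose w hw using hw
  refine ⟨ofInner hR.definite hS.definite v w fun y z => hp.eq_of_sub_eq_zero fun i => ?_, hv, hw⟩
  have h1 := RightInnerModule.tendsto_inner_left hp hS.positive (hv y i) z
  simp only [inner_map] at h1
  exact hp.isSeminormFamily.tendsto_unique h1
    (RightInnerModule.tendsto_inner_right hp hR.positive (hw z i) y)

theorem completeSpace_opSeminorm (hp : IsProCStarAlgebra p) (hR : R.IsHilbert p)
    (hS : S.IsHilbert p) : @CompleteSpace (Adjointable R S)
      (seminormUniformity fun i (T : Adjointable R S) => T.opSeminorm p i) := by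
  have hfR := RightInnerModule.isSeminormFamily hp hR.positive
  have hfS := RightInnerModule.isSeminormFamily hp hS.positive
  have hf := isSeminormFamily_opSeminorm hp hR hS
  refine hf.completeSpace_iff.2 fun F hF hc => ?_
  obtain ⟨T, hT, -⟩ := exists_of_tendsto hp hR hS (l := F) (u := fun T => T)
    (fun y => hfS.exists_tendsto hS.complete fun i => by
      refine squeeze_zero (fun _ => hfS.nonneg _ _) (fun z => ?_)
        (by simpa using (hc i).mul_const (R.seminorm p i y))
      rw [← LinearMap.sub_apply, ← sub_map]
      exact seminorm_map_le hp hR hS _ i y)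
    (fun y => hfR.exists_tendsto hR.complete fun i => by
      refine squeeze_zero (fun _ => hfR.nonneg _ _) (fun z => ?_)
        (by simpa using (hc i).mul_const (S.seminorm p i y))
      rw [← LinearMap.sub_apply, ← sub_adj, ← adjoint_map]
      refine (seminorm_map_le hp hS hR _ i y).trans_eq ?_
      rw [opSeminorm_adjoint hp hR hS])
  refine ⟨T, fun i => ?_⟩
  rw [Metric.tendsto_nhds]
  intro ε hε
  have h1 := (hc i).eventually (gt_mem_nhds (half_pos hε))
  -- Fix `V`; the maps `V'` with `‖V - V'‖ < ε / 2` converge pointwise to `T`, so the estimate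
  -- passes to `V - T` uniformly on the unit ball.
  filter_upwards [h1.curry] with V hV
  rw [Real.dist_eq, sub_zero, abs_of_nonneg (opSeminorm_nonneg _ _)]
  refine (opSeminorm_le hp hR (C := ε / 2) fun y hy => ?_).trans_lt (half_lt_self hε)
  rw [sub_map, LinearMap.sub_apply]
  refine hfS.tendsto_sub_le (hT y i) (hV.mono fun V' hV' => ?_)
  rw [← LinearMap.sub_apply, ← sub_map]
  exact (seminorm_map_le_of_le_one hp hR hS _ hy).trans hV'.le

theorem isProCStarAlgebra (hp : IsProCStarAlgebra p) (hR : R.IsHilbert p) :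
    IsProCStarAlgebra (opSeminorm (R := R) (S := R) p) where
  add_le := (isSeminormFamily_opSeminorm hp hR hR).add_le
  smul_eq := (isSeminormFamily_opSeminorm hp hR hR).smul_eq
  mul_le i T V := T.opSeminorm_comp_le hp hR hR hR V i
  star_mul_self i T := T.opSeminorm_adjoint_comp_self hp hR hR i
  directed i j := by
    obtain ⟨k, hi, hj⟩ := hp.directed i j
    exact ⟨k, opSeminorm_mono hp hR hR hi, opSeminorm_mono hp hR hR hj⟩
  separating T hT := by
    refine ext_map hR.definite fun y => hR.eq_of_sub_eq_zero hp fun i => ?_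
    refine le_antisymm ?_ (RightInnerModule.seminorm_nonneg _ _)
    have := T.seminorm_map_le hp hR hR i y
    rw [hT, zero_mul] at this
    simpa using this
  complete := completeSpace_opSeminorm hp hR hR

/-- A self-adjoint operator with positive numerical values is positive. -/
theorem isPositiveElt_of_inner (hp : IsProCStarAlgebra p) (hR : R.IsHilbert p)
    {h : Adjointable R R} (hh : star h = h) (hpos : ∀ y, IsPositiveElt (R.inner y (h.map y))) :
    IsPositiveElt h := by
  have hL := isProCStarAlgebra hp hR
  -- `v` and `b` are the square roots of the negative and positive parts of `h`, so that `h = b² -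
  -- v²`.
  obtain ⟨v, hv⟩ := hL.exists_isCfc hh (g := fun t => √(max 0 (-t))) (by fun_prop) (by simp)
  obtain ⟨b, hb⟩ := hL.exists_isCfc hh (g := fun t => √(max 0 t)) (by fun_prop) (by simp)
  have hvs := hv.star_eq hL
  have hid := IsCfc.id (p := opSeminorm (R := R) (S := R) p) hh
  -- Thus `⟨v y, h v y⟩ = -⟨v² y, v² y⟩`. The left side is positive by hypothesis, and two positive
  -- elements with sum zero vanish, so `v² = 0`.
  have h1 : v * (h * v) = -((v * v) * (v * v)) := by
    rw [← zero_sub, ← sub_self h]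
    refine (hv.mul (hid.mul hv)).unique hL ?_
    convert (hid.sub hid).sub ((hv.mul hv).mul (hv.mul hv)) using 1
    ext t
    have h2 : √(max 0 (-t)) * √(max 0 (-t)) = max 0 (-t) := Real.mul_self_sqrt (le_max_left _ _)
    rw [mul_left_comm, h2]
    rcases le_total 0 t with ht | ht
    · simp [ht]
    · rw [max_eq_right (by linarith)]; ring
  have h2 : v * v = 0 := by
    refine ext_map hR.definite fun y => ?_
    change (v * v).map y = 0
    rw [← hR.definite]
    refine hp.separating _ fun i => ?_
    have h3 : R.inner (v.map y) (h.map (v.map y)) = -R.inner ((v * v).map y) ((v * v).map y) := by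
      have h4 : ∀ T V : Adjointable R R, star T = T → ∀ y z,
          R.inner (T.map y) z = R.inner y (T.map z) := fun T V hT y z => by
        rw [T.inner_map, ← adjoint_map, ← star_def, hT]
      rw [h4 v v hvs, h4 (v * v) v (by rw [star_mul, hvs]), ← R.inner_neg_right]
      exact congrArg (fun T : Adjointable R R => R.inner y (T.map y)) h1
    have h5 := (hp.isCStarSeminorm i).le_add_of_isPositiveElt
      (hR.positive ((v * v).map y)) (hpos (v.map y))
    rw [h3, add_neg_cancel, hp.isSeminormFamily.zero] at h5
    exact le_antisymm h5 (hp.isSeminormFamily.nonneg _ _)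
  refine ⟨b, ?_⟩
  rw [hb.star_eq hL, ← sub_zero (b * b), ← h2]
  refine hid.unique hL ?_
  convert (hb.mul hb).sub (hv.mul hv) using 1
  ext t
  rw [Real.mul_self_sqrt (le_max_left _ _), Real.mul_self_sqrt (le_max_left _ _)]
  rcases le_total 0 t with ht | ht
  · simp [ht]
  · simp [ht]

end Adjointable

/-! ### The algebra as a module; left modules over `A` as right modules over the opposite algebra -/

open MulOpposite

section SelfModule

variable {Λ : Type*} {A : Type u} [NonUnitalRing A] [StarRing A] [Module ℂ A]
  {p : Λ → A → ℝ}

theorem IsProCStarAlgebra.eq_zero_of_star_mul_self (hp : IsProCStarAlgebra p) {a : A}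
    (h : star a * a = 0) : a = 0 := by
  refine hp.separating _ fun i => ?_
  have := hp.star_mul_self i a
  rw [h, hp.isSeminormFamily.zero] at this
  exact pow_eq_zero_iff two_ne_zero |>.1 this.symm

variable [IsScalarTower ℂ A A] [SMulCommClass ℂ A A]

theorem RightInnerModule.self_seminorm (hp : IsProCStarAlgebra p) :
    (RightInnerModule.self A).seminorm p = p := by
  ext i a
  change √(p i (star a * a)) = p i a
  rw [hp.star_mul_self, Real.sqrt_sq (hp.isSeminormFamily.nonneg i a)]

theorem RightInnerModule.isHilbert_self (hp : IsProCStarAlgebra p) :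
    (RightInnerModule.self A).IsHilbert p where
  positive a := ⟨a, rfl⟩
  definite a := ⟨hp.eq_zero_of_star_mul_self, fun h => by rw [h, inner_zero_right]⟩
  complete := by
    rw [self_seminorm hp]
    exact hp.complete

end SelfModule

section Opposite

variable {Λ : Type*} {A : Type u} {X : Type*} [NonUnitalRing A] [StarRing A] [Module ℂ A]
  [AddCommGroup X] [Module ℂ X] {L : LeftInnerModule A X} {p : Λ → A → ℝ}

/-- A left inner product module, as a right module over the opposite algebra. -/
def LeftInnerModule.op (L : LeftInnerModule A X) : RightInnerModule Aᵐᵒᵖ X where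
  act x a := L.act a.unop x
  add_act x y a := L.act_add a.unop x y
  act_add x a b := L.add_act a.unop b.unop x
  act_mul x a b := L.mul_act b.unop a.unop x
  smul_act c x a := L.act_smul c a.unop x
  act_smul c x a := L.smul_act c a.unop x
  inner x y := MulOpposite.op (L.inner y x)
  inner_add_right x y z := by rw [L.inner_add_left, op_add]
  inner_smul_right c x y := by rw [L.inner_smul_left, op_smul]
  inner_act_right x y a := by rw [L.inner_act_left, op_mul, op_unop]
  star_inner x y := by rw [← op_star, L.star_inner]

/-- The opposite of a pro-C*-algebra. -/
theorem IsProCStarAlgebra.op (hp : IsProCStarAlgebra p) :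
    IsProCStarAlgebra fun i (a : Aᵐᵒᵖ) => p i a.unop where
  add_le i a b := hp.add_le i _ _
  smul_eq i c a := hp.smul_eq i c _
  mul_le i a b := (hp.mul_le i _ _).trans_eq (mul_comm _ _)
  star_mul_self i a := (hp.isCStarSeminorm i).self_mul_star a.unop
  directed i j := by
    obtain ⟨k, hi, hj⟩ := hp.directed i j
    exact ⟨k, fun a => hi a.unop, fun a => hj a.unop⟩
  separating a h := unop_injective (hp.separating _ h)
  complete := by
    refine (IsSeminormFamily.of_add_le_smul_eq (fun i a b => hp.add_le i a.unop b.unop)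
      fun i c a => hp.smul_eq i c a.unop).completeSpace_iff.2 fun F hF h => ?_
    obtain ⟨a, ha⟩ := hp.isSeminormFamily.exists_tendsto hp.complete (u := unop) h
    exact ⟨MulOpposite.op a, ha⟩

theorem LeftInnerModule.IsHilbert.op (hL : L.IsHilbert p) :
    L.op.IsHilbert fun i (a : Aᵐᵒᵖ) => p i a.unop where
  positive x := by
    obtain ⟨b, hb⟩ := hL.positive x
    refine ⟨MulOpposite.op (star b), ?_⟩
    change MulOpposite.op (L.inner x x) = _
    rw [hb, op_mul, ← op_star, star_star]
  definite x := by
    rw [← hL.definite]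
    exact op_eq_zero_iff _
  complete := hL.complete

variable [IsScalarTower ℂ A A] [SMulCommClass ℂ A A] [StarModule ℂ A]

theorem LeftInnerModule.inner_le (hp : IsProCStarAlgebra p) (hL : L.IsHilbert p) (i : Λ) (x y : X) :
    p i (L.inner x y) ≤ L.seminorm p i x * L.seminorm p i y :=
  (RightInnerModule.inner_le hp.op hL.op.positive i y x).trans_eq (mul_comm _ _)

theorem LeftInnerModule.IsHilbert.exists_act_eq (hp : IsProCStarAlgebra p) (hL : L.IsHilbert p)
    (x : X) : ∃ b y, x = L.act b y := by
  obtain ⟨y, b, h⟩ := RightInnerModule.IsHilbert.exists_act_eq hp.op hL.op x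
  exact ⟨b.unop, y, h⟩

end Opposite

/-- Fullness only says that inner products generate a dense *-subalgebra, so facts about all of `A`
are proved on generators and propagated. Limits run over filters on the subtype of elements
satisfying `P`, which keeps the property at hand for each term. -/
theorem IsSeminormFamily.induction_of_closure_adjoin {ι A : Type*} [NonUnitalRing A] [StarRing A]
    [Module ℂ A] [IsScalarTower ℂ A A] [SMulCommClass ℂ A A] [StarModule ℂ A] {p : ι → A → ℝ}
    (hp : IsSeminormFamily p) {S : Set A}
    (hS : @closure A (seminormTopology p) (NonUnitalStarAlgebra.adjoin ℂ S : Set A) = Set.univ)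
    {P : A → Prop} (mem : ∀ a ∈ S, P a) (zero : P 0) (add : ∀ a b, P a → P b → P (a + b))
    (smul : ∀ (c : ℂ) a, P a → P (c • a)) (mul : ∀ a b, P a → P b → P (a * b))
    (star : ∀ a, P a → P (star a))
    (closed : ∀ (l : Filter {a // P a}) [l.NeBot] a,
      (∀ i, Tendsto (fun k : {a // P a} => p i (k - a)) l (𝓝 0)) → P a) (a : A) : P a := by
  have ha : a ∈ @closure A (seminormTopology p) {a | P a} := by
    refine @closure_mono A (seminormTopology p) _ _ (fun b hb => ?_) _
      (hS.symm.subset (Set.mem_univ a))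
    exact NonUnitalStarAlgebra.adjoin_induction ℂ (p := fun a _ => P a) mem
      (fun a b _ _ => add a b) zero (fun a b _ _ => mul a b) (fun c a _ => smul c a)
      (fun a _ => star a) hb
  obtain ⟨l, hl, h⟩ := hp.exists_tendsto_of_mem_closure ha
  exact closed l a h

/-! ### The left action of a full Hilbert bimodule -/

namespace InnerBimodule

variable {Λ : Type*} {A : Type u} {X : Type*} [NonUnitalRing A] [StarRing A] [Module ℂ A]
  [AddCommGroup X] [Module ℂ X] {𝓧 : InnerBimodule A A X} {p : Λ → A → ℝ}

/-- Both sides equal `⟨x, v⟩⟨u, y⟩`. -/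
theorem inner_left_act_left_inner (u v x y : X) :
    𝓧.right.inner (𝓧.left.act (𝓧.left.inner u v) x) y =
      𝓧.right.inner x (𝓧.left.act (𝓧.left.inner v u) y) := by
  rw [𝓧.inner_act, 𝓧.inner_act, 𝓧.right.inner_act_left, 𝓧.right.inner_act_right,
    𝓧.right.star_inner]

theorem zero_left_act (x : X) : 𝓧.left.act 0 x = 0 := by
  simpa using 𝓧.left.add_act 0 0 x

theorem sub_left_act (a b : A) (x : X) :
    𝓧.left.act (a - b) x = 𝓧.left.act a x - 𝓧.left.act b x := by
  rw [eq_sub_iff_add_eq, ← 𝓧.left.add_act, sub_add_cancel]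

theorem left_act_sub (a : A) (x y : X) :
    𝓧.left.act a (x - y) = 𝓧.left.act a x - 𝓧.left.act a y := by
  rw [eq_sub_iff_add_eq, ← 𝓧.left.act_add, sub_add_cancel]

theorem IsHilbert.tendsto_left_act (h : 𝓧.IsHilbert p p) {κ : Type*} {l : Filter κ} {u : κ → A}
    {a : A} {i : Λ} (hu : Tendsto (fun k => p i (u k - a)) l (𝓝 0)) (x : X) :
    Tendsto (fun k => 𝓧.right.seminorm p i (𝓧.left.act (u k) x - 𝓧.left.act a x)) l (𝓝 0) := by
  refine squeeze_zero (fun _ => Real.sqrt_nonneg _) (fun k => ?_)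
    (by simpa using hu.mul_const (𝓧.right.seminorm p i x))
  rw [← sub_left_act]
  exact h.left_bound i _ x

variable [IsScalarTower ℂ A A] [SMulCommClass ℂ A A] [StarModule ℂ A]

/-- Let `l` and `r` be the left and right inner squares of `x`. Then `l² = ⟨l x, x⟩` on the left and
`l x = x r`, so Cauchy-Schwarz and `right_bound` give `p i l ^ 2 ≤ p i r * p i l`; the mirror
argument gives the reverse comparison. -/
theorem IsHilbert.seminorm_eq (h : 𝓧.IsHilbert p p) (i : Λ) (x : X) :
    𝓧.left.seminorm p i x = 𝓧.right.seminorm p i x := by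
  have hp := h.left_algebra
  have hL0 : 0 ≤ 𝓧.left.seminorm p i x := Real.sqrt_nonneg _
  have hR0 : 0 ≤ 𝓧.right.seminorm p i x := Real.sqrt_nonneg _
  have hnl := hp.isSeminormFamily.nonneg i (𝓧.left.inner x x)
  have hnr := hp.isSeminormFamily.nonneg i (𝓧.right.inner x x)
  have hsl : 𝓧.left.seminorm p i x ^ 2 = p i (𝓧.left.inner x x) := Real.sq_sqrt hnl
  have hsr : 𝓧.right.seminorm p i x ^ 2 = p i (𝓧.right.inner x x) := Real.sq_sqrt hnr
  have h1 : p i (𝓧.left.inner x x) ^ 2 ≤ p i (𝓧.right.inner x x) * p i (𝓧.left.inner x x) := by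
    rw [← hp.star_mul_self, 𝓧.left.star_inner, ← 𝓧.left.inner_act_left, 𝓧.inner_act, ← hsl, sq,
      ← mul_assoc]
    exact (LeftInnerModule.inner_le hp h.left_isHilbert i _ _).trans
      (mul_le_mul_of_nonneg_right (h.right_bound i _ _) hL0)
  have h2 : p i (𝓧.right.inner x x) ^ 2 ≤ p i (𝓧.left.inner x x) * p i (𝓧.right.inner x x) := by
    rw [← hp.star_mul_self, 𝓧.right.star_inner, ← 𝓧.right.inner_act_right, ← 𝓧.inner_act]
    refine (RightInnerModule.inner_le hp h.right_isHilbert.positive i _ _).trans ?_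
    have := mul_le_mul_of_nonneg_left (h.left_bound i (𝓧.left.inner x x) x) hR0
    refine this.trans_eq ?_
    rw [← hsr]
    ring
  have h3 : p i (𝓧.left.inner x x) = p i (𝓧.right.inner x x) := by
    rcases hnl.eq_or_lt with h0 | h0
    · rw [← h0, zero_mul] at h2
      rw [← h0, pow_eq_zero_iff two_ne_zero |>.1 (le_antisymm h2 (sq_nonneg _))]
    · rcases hnr.eq_or_lt with h0' | h0'
      · rw [← h0', zero_mul] at h1
        rw [← h0', pow_eq_zero_iff two_ne_zero |>.1 (le_antisymm h1 (sq_nonneg _))]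
      · rw [sq] at h1 h2
        exact le_antisymm (le_of_mul_le_mul_right h1 h0) (le_of_mul_le_mul_right h2 h0')
  rw [LeftInnerModule.seminorm, RightInnerModule.seminorm, h3]

/-- The left action on a full bimodule is by adjointable maps. -/
theorem IsHilbert.inner_left_act (h : 𝓧.IsHilbert p p) (hfull : 𝓧.IsFull p p) (a : A) (x y : X) :
    𝓧.right.inner (𝓧.left.act a x) y = 𝓧.right.inner x (𝓧.left.act (star a) y) := by
  have hp := h.left_algebra
  have hR := h.right_isHilbert.positive
  revert x y
  refine hp.isSeminormFamily.induction_of_closure_adjoin hfull.left_full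
    (P := fun a => ∀ x y, 𝓧.right.inner (𝓧.left.act a x) y =
      𝓧.right.inner x (𝓧.left.act (star a) y)) ?_ ?_ ?_ ?_ ?_ ?_ ?_ a
  · rintro _ ⟨u, v, rfl⟩ x y
    rw [𝓧.left.star_inner, inner_left_act_left_inner]
  · intro x y
    rw [star_zero, zero_left_act, zero_left_act, 𝓧.right.inner_zero_left,
      𝓧.right.inner_zero_right]
  · intro a b ha hb x y
    rw [star_add, 𝓧.left.add_act, 𝓧.left.add_act, 𝓧.right.inner_add_left,
      𝓧.right.inner_add_right, ha, hb]
  · intro c a ha x y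
    rw [star_smul, 𝓧.left.smul_act, 𝓧.left.smul_act, 𝓧.right.inner_smul_left,
      𝓧.right.inner_smul_right, ha]
  · intro a b ha hb x y
    rw [star_mul, 𝓧.left.mul_act, 𝓧.left.mul_act, ha, hb]
  · intro a ha x y
    rw [star_star, ← 𝓧.right.star_inner, ← ha, 𝓧.right.star_inner]
  · intro l _ a ha x y
    refine hp.eq_of_sub_eq_zero fun i => ?_
    have h1 := RightInnerModule.tendsto_inner_left hp hR (h.tendsto_left_act (ha i) x) y
    have h2 := RightInnerModule.tendsto_inner_right hp hR (h.tendsto_left_act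
      (u := fun k : {a // _} => star k.1) (a := star a) (i := i) (l := l) (by
        simpa only [← star_sub, (hp.isCStarSeminorm i).star_eq] using ha i) y) x
    refine hp.isSeminormFamily.tendsto_unique (l := l)
      (u := fun k => 𝓧.right.inner (𝓧.left.act k x) y) h1 ?_
    convert h2 using 4 with k
    exact k.2 x y

/-- The left action of a full Hilbert bimodule as a *-morphism into the adjointable maps. -/
def IsHilbert.leftMul (h : 𝓧.IsHilbert p p) (hfull : 𝓧.IsFull p p) :
    A →⋆ₙₐ[ℂ] Adjointable 𝓧.right 𝓧.right where
  toFun a := Adjointable.ofInner h.right_isHilbert.definite h.right_isHilbert.definite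
    (𝓧.left.act a) (𝓧.left.act (star a)) (h.inner_left_act hfull a)
  map_smul' c a := Adjointable.ext_map h.right_isHilbert.definite fun x => 𝓧.left.smul_act c a x
  map_zero' := Adjointable.ext_map h.right_isHilbert.definite zero_left_act
  map_add' a b := Adjointable.ext_map h.right_isHilbert.definite fun x => 𝓧.left.add_act a b x
  map_mul' a b := Adjointable.ext_map h.right_isHilbert.definite fun x => 𝓧.left.mul_act a b x
  map_star' _ := Adjointable.ext_map h.right_isHilbert.definite fun _ => rfl

theorem IsHilbert.leftMul_map (h : 𝓧.IsHilbert p p) (hfull : 𝓧.IsFull p p) (a : A) (x : X) :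
    (h.leftMul hfull a).map x = 𝓧.left.act a x := rfl

theorem IsHilbert.left_act_right_act (h : 𝓧.IsHilbert p p) (hfull : 𝓧.IsFull p p) (a b : A)
    (x : X) : 𝓧.left.act a (𝓧.right.act x b) = 𝓧.right.act (𝓧.left.act a x) b :=
  (h.leftMul hfull a).map_act x b

/-- One inequality is `left_bound`. By `le_of_ker_le` the other only requires that `p i a = 0`
whenever `a` acts as zero for the `i`-th seminorm. In that case `p i (a ⟨x, y⟩) = p i ⟨a x, y⟩ = 0`,
by fullness `p i (a b) = 0` for all `b`, and `b = a*` concludes. -/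
theorem IsHilbert.opSeminorm_leftMul (h : 𝓧.IsHilbert p p) (hfull : 𝓧.IsFull p p) (i : Λ)
    (a : A) : (h.leftMul hfull a).opSeminorm p i = p i a := by
  have hp := h.left_algebra
  have hR := h.right_isHilbert
  have hL := Adjointable.isProCStarAlgebra hp hR
  have hle (a : A) : (h.leftMul hfull a).opSeminorm p i ≤ p i a :=
    Adjointable.opSeminorm_le_of_forall_le_mul hp hR (hp.isSeminormFamily.nonneg i a)
      fun x => h.left_bound i a x
  refine le_antisymm (hle a) (hp.le_of_ker_le
    (q := fun a => (h.leftMul hfull a).opSeminorm p i) ⟨?_, ?_, ?_, ?_⟩ hle ?_ a)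
  · intro a b
    rw [map_add]
    exact hL.add_le i _ _
  · intro c a
    rw [map_smul]
    exact hL.smul_eq i c _
  · intro a b
    rw [map_mul]
    exact hL.mul_le i _ _
  · intro a
    rw [map_mul, map_star]
    exact hL.star_mul_self i _
  · intro a ha
    have hnn := hp.isSeminormFamily.nonneg i
    -- The annihilation property is a right ideal but not visibly closed under the involution, so it
    -- is carried for `b` and `b*` together.
    have key (b : A) : p i (a * b) = 0 ∧ p i (a * star b) = 0 := by
      refine hp.isSeminormFamily.induction_of_closure_adjoin hfull.left_full
        (P := fun b => p i (a * b) = 0 ∧ p i (a * star b) = 0) ?_ ?_ ?_ ?_ ?_ ?_ ?_ b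
      · have h1 (x y : X) : p i (a * 𝓧.left.inner x y) = 0 := by
          refine le_antisymm ?_ (hnn _)
          rw [← 𝓧.left.inner_act_left]
          refine (LeftInnerModule.inner_le hp h.left_isHilbert i _ _).trans ?_
          have h2 := (h.leftMul hfull a).seminorm_map_le hp hR hR i x
          rw [ha, zero_mul] at h2
          rw [h.seminorm_eq, ← h.leftMul_map hfull,
            le_antisymm h2 (RightInnerModule.seminorm_nonneg _ _), zero_mul]
        rintro _ ⟨x, y, rfl⟩
        rw [𝓧.left.star_inner]
        exact ⟨h1 x y, h1 y x⟩
      · simp [hp.isSeminormFamily.zero]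
      · rintro b c ⟨hb, hb'⟩ ⟨hc, hc'⟩
        rw [star_add, mul_add, mul_add]
        have h1 := hp.add_le i (a * b) (a * c)
        have h2 := hp.add_le i (a * star b) (a * star c)
        rw [hb, hc, add_zero] at h1
        rw [hb', hc', add_zero] at h2
        exact ⟨le_antisymm h1 (hnn _), le_antisymm h2 (hnn _)⟩
      · rintro c b ⟨hb, hb'⟩
        rw [star_smul, mul_smul_comm, mul_smul_comm, hp.smul_eq, hp.smul_eq, hb, hb', mul_zero,
          mul_zero]
        exact ⟨rfl, rfl⟩
      · rintro b c ⟨hb, hb'⟩ ⟨hc, hc'⟩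
        rw [star_mul, ← mul_assoc, ← mul_assoc]
        have h1 := hp.mul_le i (a * b) c
        have h2 := hp.mul_le i (a * star c) (star b)
        rw [hb, zero_mul] at h1
        rw [hc', zero_mul] at h2
        exact ⟨le_antisymm h1 (hnn _), le_antisymm h2 (hnn _)⟩
      · rintro b ⟨hb, hb'⟩
        rw [star_star]
        exact ⟨hb', hb⟩
      · intro l _ b hb
        have h1 (c : A) (u : {b // p i (a * b) = 0 ∧ p i (a * star b) = 0} → A)
            (hu : ∀ k, p i (a * u k) = 0) (hc : Tendsto (fun k => p i (u k - c)) l (𝓝 0)) :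
            p i (a * c) = 0 := by
          have h2 := hc.const_mul (p i a)
          rw [mul_zero] at h2
          refine le_antisymm (ge_of_tendsto' h2 fun k => ?_) (hnn _)
          refine le_trans ?_ (hp.mul_le i a (u k - c))
          have h3 := hp.isSeminormFamily.le_add_sub i (a * c) (a * u k)
          rwa [hu, zero_add, hp.isSeminormFamily.sub_comm, ← mul_sub] at h3
        refine ⟨h1 b (fun k => k) (fun k => k.2.1) (hb i),
          h1 (star b) (fun k => star k.1) (fun k => k.2.2) ?_⟩
        simpa only [← star_sub, (hp.isCStarSeminorm i).star_eq] using hb i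
    have h1 := (key (star a)).1
    rw [(hp.isCStarSeminorm i).self_mul_star] at h1
    exact pow_eq_zero_iff two_ne_zero |>.1 h1

theorem IsHilbert.eq_of_left_act_eq (h : 𝓧.IsHilbert p p) (hfull : 𝓧.IsFull p p) {a b : A}
    (hab : ∀ x, 𝓧.left.act a x = 𝓧.left.act b x) : a = b := by
  refine h.left_algebra.eq_of_sub_eq_zero fun i => ?_
  rw [← h.opSeminorm_leftMul hfull, map_sub,
    show h.leftMul hfull a = h.leftMul hfull b from
      Adjointable.ext_map h.right_isHilbert.definite hab, sub_self]
  exact (Adjointable.isSeminormFamily_opSeminorm h.left_algebra h.right_isHilbert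
    h.right_isHilbert).zero i

/-- Each `z` factors as `b w`, and `⟨b w, x⟩ = ⟨w, b* x⟩`. -/
theorem IsHilbert.eq_of_forall_left_act_eq (h : 𝓧.IsHilbert p p) (hfull : 𝓧.IsFull p p) {x y : X}
    (hxy : ∀ a, 𝓧.left.act a x = 𝓧.left.act a y) : x = y := by
  refine RightInnerModule.ext_inner_left h.right_isHilbert.definite fun z => ?_
  obtain ⟨b, w, rfl⟩ := h.left_isHilbert.exists_act_eq h.left_algebra z
  rw [h.inner_left_act hfull, h.inner_left_act hfull, hxy]

end InnerBimodule

/-! ### The isomorphism of `M(A)` with `L_A(X)` -/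

namespace InnerBimodule

variable {Λ : Type*} {A : Type u} {X : Type*} [NonUnitalRing A] [StarRing A] [Module ℂ A]
  [AddCommGroup X] [Module ℂ X] {𝓧 : InnerBimodule A A X} {p : Λ → A → ℝ}

theorem left_inner_act_right (a : A) (x y : X) :
    𝓧.left.inner x (𝓧.left.act a y) = 𝓧.left.inner x y * star a := by
  rw [← 𝓧.left.star_inner, 𝓧.left.inner_act_left, star_mul, 𝓧.left.star_inner]

variable [IsScalarTower ℂ A A] [SMulCommClass ℂ A A]

/-- `S` extends the multiplier `m` along the left action. -/
def IsExtension (𝓧 : InnerBimodule A A X) (m : MultiplierAlgebra A)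
    (S : Adjointable 𝓧.right 𝓧.right) : Prop :=
  ∀ a x, S.map (𝓧.left.act a x) = 𝓧.left.act (m.map a) x

theorem star_map_mul (m : MultiplierAlgebra A) (a b : A) :
    star (m.map a) * b = star a * m.adj b :=
  m.inner_map a b

theorem star_adj_mul (m : MultiplierAlgebra A) (a b : A) :
    star (m.adj a) * b = star a * m.map b :=
  m.inner_adj a b

namespace IsExtension

variable {m n : MultiplierAlgebra A} {S T : Adjointable 𝓧.right 𝓧.right}

theorem add (hS : 𝓧.IsExtension m S) (hT : 𝓧.IsExtension n T) :
    𝓧.IsExtension (m + n) (S + T) := fun a x => by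
  rw [Adjointable.add_map, Adjointable.add_map, LinearMap.add_apply, LinearMap.add_apply, hS, hT,
    𝓧.left.add_act]

theorem mul (hS : 𝓧.IsExtension m S) (hT : 𝓧.IsExtension n T) :
    𝓧.IsExtension (m * n) (S * T) := fun a x => by
  change S.map (T.map _) = 𝓧.left.act (m.map (n.map a)) x
  rw [hT, hS]

variable [StarModule ℂ A]

theorem smul (c : ℂ) (hS : 𝓧.IsExtension m S) : 𝓧.IsExtension (c • m) (c • S) := fun a x => by
  rw [Adjointable.smul_map, Adjointable.smul_map, LinearMap.smul_apply, LinearMap.smul_apply, hS,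
    𝓧.left.smul_act]

theorem star (h : 𝓧.IsHilbert p p) (hfull : 𝓧.IsFull p p) (hS : 𝓧.IsExtension m S) :
    𝓧.IsExtension (star m) (star S) := fun a x => by
  refine RightInnerModule.ext_inner_right h.right_isHilbert.definite fun y => ?_
  obtain ⟨b, z, rfl⟩ := h.left_isHilbert.exists_act_eq h.left_algebra y
  have h1 (c : A) (x y : X) : 𝓧.right.inner x (𝓧.left.act c y) =
      𝓧.right.inner (𝓧.left.act (Star.star c) x) y := by
    rw [h.inner_left_act hfull, star_star]
  change 𝓧.right.inner (S.adj _) _ = 𝓧.right.inner (𝓧.left.act (m.adj a) x) _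
  rw [S.inner_adj, hS, h1, h1, ← 𝓧.left.mul_act, ← 𝓧.left.mul_act, star_map_mul]

theorem unique_right (h : 𝓧.IsHilbert p p) (hS : 𝓧.IsExtension m S) (hT : 𝓧.IsExtension m T) :
    S = T := by
  refine Adjointable.ext_map h.right_isHilbert.definite fun x => ?_
  obtain ⟨b, y, rfl⟩ := h.left_isHilbert.exists_act_eq h.left_algebra x
  rw [hS, hT]

theorem unique_left (h : 𝓧.IsHilbert p p) (hfull : 𝓧.IsFull p p) (hm : 𝓧.IsExtension m S)
    (hn : 𝓧.IsExtension n S) : m = n := by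
  refine Adjointable.ext_map (RightInnerModule.isHilbert_self h.left_algebra).definite
    fun a => h.eq_of_left_act_eq hfull fun x => ?_
  rw [← hm, ← hn]

/-- Write `x = b y` and let `c* c` be the left inner square of `y`. Then `‖d y‖_i = p i (d c*)` for
every `d`, so the claim becomes the bound of `m` at the element `b c*`, because `m(b) c* = m(b c*)`.
-/
theorem opSeminorm_le (h : 𝓧.IsHilbert p p) (hS : 𝓧.IsExtension m S) (i : Λ) :
    S.opSeminorm p i ≤ m.opSeminorm p i := by
  have hp := h.left_algebra
  have hA := RightInnerModule.isHilbert_self hp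
  have hm0 : 0 ≤ m.opSeminorm p i := Adjointable.opSeminorm_nonneg _ _
  refine Adjointable.opSeminorm_le_of_forall_le_mul hp h.right_isHilbert hm0 fun x => ?_
  obtain ⟨b, y, rfl⟩ := h.left_isHilbert.exists_act_eq hp x
  obtain ⟨c, hc⟩ := h.left_isHilbert.positive y
  have key (d : A) : 𝓧.right.seminorm p i (𝓧.left.act d y) = p i (d * Star.star c) := by
    have h1 : 𝓧.left.inner (𝓧.left.act d y) (𝓧.left.act d y) =
        (d * Star.star c) * Star.star (d * Star.star c) := by
      rw [𝓧.left.inner_act_left, left_inner_act_right, hc, star_mul, star_star]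
      simp only [mul_assoc]
    rw [← h.seminorm_eq, LeftInnerModule.seminorm, h1, (hp.isCStarSeminorm i).self_mul_star,
      Real.sqrt_sq (hp.isSeminormFamily.nonneg _ _)]
  rw [hS, key, key]
  have h2 := m.seminorm_map_le hp hA hA i (b * Star.star c)
  rw [RightInnerModule.self_seminorm hp] at h2
  exact (congrArg (p i) (m.map_act b (Star.star c))).symm.trans_le h2

/-- The left action is isometric and turns `m(a)` into `S` composed with the action of `a`. -/
theorem le_opSeminorm (h : 𝓧.IsHilbert p p) (hfull : 𝓧.IsFull p p) (hS : 𝓧.IsExtension m S)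
    (i : Λ) : m.opSeminorm p i ≤ S.opSeminorm p i := by
  have hp := h.left_algebra
  have hR := h.right_isHilbert
  refine Adjointable.opSeminorm_le_of_forall_le_mul hp (RightInnerModule.isHilbert_self hp)
    (Adjointable.opSeminorm_nonneg _ _) fun a => ?_
  rw [RightInnerModule.self_seminorm hp, ← h.opSeminorm_leftMul hfull,
    ← h.opSeminorm_leftMul hfull i a,
    show h.leftMul hfull (m.map a) = S.comp (h.leftMul hfull a) from
      Adjointable.ext_map hR.definite fun x => (hS a x).symm]
  exact Adjointable.opSeminorm_comp_le hp hR hR hR _ _ i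

end IsExtension

variable [StarModule ℂ A]

theorem IsHilbert.exists_isExtension_right (h : 𝓧.IsHilbert p p) (hfull : 𝓧.IsFull p p)
    (m : MultiplierAlgebra A) : ∃ S, 𝓧.IsExtension m S := by
  choose b y hby using h.left_isHilbert.exists_act_eq h.left_algebra
  -- The extension sends `x = b y` to `m(b) y` for a chosen factorization. Multiplying by `a` gives
  -- `a m(b) y = (m*(a*))* x`, which does not involve the factorization; vectors are determined by
  -- such products.
  have key (m : MultiplierAlgebra A) (a : A) (x : X) :
      𝓧.left.act a (𝓧.left.act (m.map (b x)) (y x)) =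
        𝓧.left.act (star (m.adj (star a))) x := by
    nth_rw 3 [hby x]
    rw [← 𝓧.left.mul_act, ← 𝓧.left.mul_act, star_adj_mul, star_star]
  refine ⟨Adjointable.ofInner h.right_isHilbert.definite h.right_isHilbert.definite
    (fun x => 𝓧.left.act (m.map (b x)) (y x))
    (fun x => 𝓧.left.act ((star m).map (b x)) (y x)) fun x w => ?_, fun a x => ?_⟩
  · nth_rw 3 [hby x]
    rw [h.inner_left_act hfull, h.inner_left_act hfull, key, star_star]
    rfl
  · refine h.eq_of_forall_left_act_eq hfull fun c => ?_
    refine (key m c (𝓧.left.act a x)).trans ?_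
    rw [← 𝓧.left.mul_act, ← 𝓧.left.mul_act, star_adj_mul, star_star]

/-- As the left action is isometric, the elements representing `S` composed with `u k` form a Cauchy
net in the complete algebra `A`. -/
theorem IsHilbert.exists_left_act_eq_of_tendsto (h : 𝓧.IsHilbert p p) (hfull : 𝓧.IsFull p p)
    (S : Adjointable 𝓧.right 𝓧.right) {κ : Type*} {l : Filter κ} [l.NeBot] {u : κ → A} {a : A}
    (hu : ∀ k, ∃ c, ∀ x, 𝓧.left.act c x = S.map (𝓧.left.act (u k) x))
    (ha : ∀ i, Tendsto (fun k => p i (u k - a)) l (𝓝 0)) :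
    ∃ c, ∀ x, 𝓧.left.act c x = S.map (𝓧.left.act a x) := by
  have hp := h.left_algebra
  have hR := h.right_isHilbert
  have hf := hp.isSeminormFamily
  choose c hc using hu
  have hle (i : Λ) (z : κ × κ) :
      p i (c z.1 - c z.2) ≤ S.opSeminorm p i * (p i (u z.1 - a) + p i (u z.2 - a)) := by
    have h1 : h.leftMul hfull (c z.1 - c z.2) = S.comp (h.leftMul hfull (u z.1 - u z.2)) := by
      refine Adjointable.ext_map hR.definite fun x => ?_
      change 𝓧.left.act _ x = S.map (𝓧.left.act _ x)
      rw [sub_left_act, sub_left_act, map_sub, hc, hc]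
    rw [← h.opSeminorm_leftMul hfull, h1]
    refine (Adjointable.opSeminorm_comp_le hp hR hR hR _ _ i).trans ?_
    refine mul_le_mul_of_nonneg_left ?_ (Adjointable.opSeminorm_nonneg _ _)
    rw [h.opSeminorm_leftMul hfull, ← sub_sub_sub_cancel_right _ _ a]
    exact hf.sub_le i _ _
  obtain ⟨d, hd⟩ := hf.exists_tendsto hp.complete (u := c) (l := l) fun i => by
    refine squeeze_zero (fun z => hf.nonneg i _) (hle i) ?_
    simpa using (((ha i).comp tendsto_fst).add ((ha i).comp tendsto_snd)).const_mul
      (S.opSeminorm p i)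
  refine ⟨d, fun x => hR.eq_of_sub_eq_zero hp fun i => ?_⟩
  have h1 := h.tendsto_left_act (hd i) x
  refine (RightInnerModule.isSeminormFamily hp hR.positive).tendsto_unique h1 ?_
  refine squeeze_zero (fun k => RightInnerModule.seminorm_nonneg _ _) (fun k => ?_)
    (by simpa using (h.tendsto_left_act (ha i) x).const_mul (S.opSeminorm p i))
  rw [hc, ← map_sub]
  exact S.seminorm_map_le hp hR hR i _

/-- On a generator, `S (⟨x, y⟩ z) = S (x ⟨y, z⟩) = (S x) ⟨y, z⟩ = ⟨S x, y⟩ z`. The elements `a` with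
the property form a closed right ideal, so fullness gives all of `A`; again `a` and `a*` are treated
together. -/
theorem IsHilbert.exists_left_act_eq (h : 𝓧.IsHilbert p p) (hfull : 𝓧.IsFull p p)
    (S : Adjointable 𝓧.right 𝓧.right) (a : A) :
    ∃ c, ∀ x, 𝓧.left.act c x = S.map (𝓧.left.act a x) := by
  have hp := h.left_algebra
  let Q : A → Prop := fun a => ∃ c, ∀ x, 𝓧.left.act c x = S.map (𝓧.left.act a x)
  have h1 (x y : X) : Q (𝓧.left.inner x y) :=
    ⟨𝓧.left.inner (S.map x) y, fun z => by rw [𝓧.inner_act, 𝓧.inner_act, S.map_act]⟩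
  have h2 (a b : A) (ha : Q a) : Q (a * b) := by
    obtain ⟨c, hc⟩ := ha
    exact ⟨c * b, fun x => by rw [𝓧.left.mul_act, 𝓧.left.mul_act, hc]⟩
  have h3 (a b : A) (ha : Q a) (hb : Q b) : Q (a + b) := by
    obtain ⟨c, hc⟩ := ha
    obtain ⟨d, hd⟩ := hb
    exact ⟨c + d, fun x => by rw [𝓧.left.add_act, 𝓧.left.add_act, hc, hd, map_add]⟩
  have h4 (r : ℂ) (a : A) (ha : Q a) : Q (r • a) := by
    obtain ⟨c, hc⟩ := ha
    exact ⟨r • c, fun x => by rw [𝓧.left.smul_act, 𝓧.left.smul_act, hc, map_smul]⟩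
  have h5 : Q 0 := ⟨0, fun x => by rw [zero_left_act, map_zero]⟩
  refine (hp.isSeminormFamily.induction_of_closure_adjoin hfull.left_full
    (P := fun a => Q a ∧ Q (star a)) ?_ ?_ ?_ ?_ ?_ ?_ ?_ a).1
  · rintro _ ⟨x, y, rfl⟩
    rw [𝓧.left.star_inner]
    exact ⟨h1 x y, h1 y x⟩
  · rw [star_zero]
    exact ⟨h5, h5⟩
  · intro a b ha hb
    rw [star_add]
    exact ⟨h3 a b ha.1 hb.1, h3 _ _ ha.2 hb.2⟩
  · intro r a ha
    rw [star_smul]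
    exact ⟨h4 r a ha.1, h4 _ _ ha.2⟩
  · intro a b ha hb
    rw [star_mul]
    exact ⟨h2 a b ha.1, h2 _ _ hb.2⟩
  · intro a ha
    rw [star_star]
    exact ⟨ha.2, ha.1⟩
  · intro l _ a ha
    refine ⟨h.exists_left_act_eq_of_tendsto hfull S (fun k => k.2.1) ha,
      h.exists_left_act_eq_of_tendsto hfull S (l := l)
        (u := fun k : {a // _} => star k.1) (fun k => k.2.2)
        fun i => ?_⟩
    simpa only [← star_sub, (hp.isCStarSeminorm i).star_eq] using ha i

/-- The multiplier sends `a` to the element acting as `S` composed with `a`; its adjoint is built in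
the same way from `S*`. Faithfulness of the left action turns the adjoint relation of the operators
into that of the multipliers. -/
theorem IsHilbert.exists_isExtension_left (h : 𝓧.IsHilbert p p) (hfull : 𝓧.IsFull p p)
    (S : Adjointable 𝓧.right 𝓧.right) : ∃ m, 𝓧.IsExtension m S := by
  choose v hv using h.exists_left_act_eq hfull S
  choose w hw using h.exists_left_act_eq hfull S.adjoint
  have hA := (RightInnerModule.isHilbert_self h.left_algebra).definite
  refine ⟨Adjointable.ofInner hA hA v w fun a b => h.eq_of_left_act_eq hfull fun x => ?_,
    fun a x => (hv a x).symm⟩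
  refine RightInnerModule.ext_inner_right h.right_isHilbert.definite fun y => ?_
  change 𝓧.right.inner (𝓧.left.act (star (v a) * b) x) y =
    𝓧.right.inner (𝓧.left.act (star a * w b) x) y
  rw [𝓧.left.mul_act, 𝓧.left.mul_act, h.inner_left_act hfull (star (v a)),
    h.inner_left_act hfull (star a), star_star, star_star, hv, hw, Adjointable.adjoint_map,
    S.inner_adj]

/-- The isomorphism `M(A) ≅ L_A(X)` for a full Hilbert bimodule `X`. -/
noncomputable def IsHilbert.multiplierEquiv (h : 𝓧.IsHilbert p p) (hfull : 𝓧.IsFull p p) :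
    MultiplierAlgebra A ≃⋆ₐ[ℂ] Adjointable 𝓧.right 𝓧.right where
  toFun m := (h.exists_isExtension_right hfull m).choose
  invFun S := (h.exists_isExtension_left hfull S).choose
  left_inv m := (h.exists_isExtension_left hfull _).choose_spec.unique_left h hfull
    (h.exists_isExtension_right hfull m).choose_spec
  right_inv S := (h.exists_isExtension_right hfull _).choose_spec.unique_right h
    (h.exists_isExtension_left hfull S).choose_spec
  map_mul' m n := (h.exists_isExtension_right hfull (m * n)).choose_spec.unique_right h
    ((h.exists_isExtension_right hfull m).choose_spec.mul
      (h.exists_isExtension_right hfull n).choose_spec)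
  map_add' m n := (h.exists_isExtension_right hfull (m + n)).choose_spec.unique_right h
    ((h.exists_isExtension_right hfull m).choose_spec.add
      (h.exists_isExtension_right hfull n).choose_spec)
  map_star' m := (h.exists_isExtension_right hfull (star m)).choose_spec.unique_right h
    ((h.exists_isExtension_right hfull m).choose_spec.star h hfull)
  map_smul' c m := (h.exists_isExtension_right hfull (c • m)).choose_spec.unique_right h
    ((h.exists_isExtension_right hfull m).choose_spec.smul c)

theorem IsHilbert.isExtension_multiplierEquiv (h : 𝓧.IsHilbert p p) (hfull : 𝓧.IsFull p p)
    (m : MultiplierAlgebra A) : 𝓧.IsExtension m (h.multiplierEquiv hfull m) :=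
  (h.exists_isExtension_right hfull m).choose_spec

theorem mul_iotaA (h : 𝓧.IsHilbert p p) (m : MultiplierAlgebra A) (a : A) :
    m * iotaA A a = iotaA A (m.map a) :=
  Adjointable.ext_map (RightInnerModule.isHilbert_self h.left_algebra).definite
    fun b => m.map_act a b

/-- Since `m ι_A(a) = ι_A(m(a))`, multiplicativity of `Ψ` determines it on vectors `a x`. Uniqueness
of `Ψ` is therefore purely algebraic. -/
theorem isExtension_of_extends_act (h : 𝓧.IsHilbert p p)
    {Ψ : MultiplierAlgebra A ≃⋆ₐ[ℂ] Adjointable 𝓧.right 𝓧.right}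
    (hΨ : ∀ a x, (Ψ (iotaA A a)).map x = 𝓧.left.act a x) (m : MultiplierAlgebra A) :
    𝓧.IsExtension m (Ψ m) := fun a x => by
  rw [← hΨ, ← hΨ, ← mul_iotaA h, map_mul]
  rfl

theorem IsHilbert.existsUnique_isLeftActionExtension (h : 𝓧.IsHilbert p p)
    (hfull : 𝓧.IsFull p p) :
    ∃! Ψ : MultiplierAlgebra A ≃⋆ₐ[ℂ] Adjointable 𝓧.right 𝓧.right,
      IsLeftActionExtension p 𝓧 Ψ := by
  have hext := h.isExtension_multiplierEquiv hfull
  refine ⟨h.multiplierEquiv hfull, ⟨fun a x => ?_, fun i => ⟨i, fun m => ?_⟩,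
    fun i => ⟨i, fun S => ?_⟩⟩, fun Ψ hΨ => ?_⟩
  · obtain ⟨b, y, rfl⟩ := h.left_isHilbert.exists_act_eq h.left_algebra x
    rw [hext, ← 𝓧.left.mul_act]
    rfl
  · exact (hext m).opSeminorm_le h i
  · have := (hext ((h.multiplierEquiv hfull).symm S)).le_opSeminorm h hfull i
    rwa [(h.multiplierEquiv hfull).apply_symm_apply] at this
  · exact StarAlgEquiv.ext fun m =>
      (isExtension_of_extends_act h hΨ.extends_act m).unique_right h (hext m)

end InnerBimodule

/-! ### The canonical maps into the multiplier algebra and the multiplier module -/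

section General

variable {Λ : Type*} {A : Type u} {Y Z : Type*} [NonUnitalRing A] [StarRing A] [Module ℂ A]
  [IsScalarTower ℂ A A] [SMulCommClass ℂ A A] [StarModule ℂ A]
  [AddCommGroup Y] [Module ℂ Y] [AddCommGroup Z] [Module ℂ Z]
  {R : RightInnerModule A Y} {S : RightInnerModule A Z} {p : Λ → A → ℝ}

theorem Adjointable.eq_of_opSeminorm_sub_eq_zero (hp : IsProCStarAlgebra p) (hR : R.IsHilbert p)
    (hS : S.IsHilbert p) {T V : Adjointable R S} (h : ∀ i, (T - V).opSeminorm p i = 0) :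
    T = V := by
  refine ext_map hR.definite fun y => hS.eq_of_sub_eq_zero hp fun i => ?_
  have h1 := (T - V).seminorm_map_le hp hR hS i y
  rw [h, zero_mul, sub_map, LinearMap.sub_apply] at h1
  exact le_antisymm h1 (RightInnerModule.seminorm_nonneg _ _)

theorem opSeminorm_iotaA (hp : IsProCStarAlgebra p) (i : Λ) (a : A) :
    (iotaA A a).opSeminorm p i = p i a := by
  have hA := RightInnerModule.isHilbert_self hp
  have hnn := hp.isSeminormFamily.nonneg i a
  refine le_antisymm (Adjointable.opSeminorm_le_of_forall_le_mul hp hA hnn fun b => ?_) ?_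
  · rw [RightInnerModule.self_seminorm hp]
    exact hp.mul_le i a b
  · have h1 := (iotaA A a).seminorm_map_le hp hA hA i (star a)
    rw [RightInnerModule.self_seminorm hp, (hp.isCStarSeminorm i).star_eq] at h1
    have h2 : p i (a * star a) ≤ (iotaA A a).opSeminorm p i * p i a := h1
    rw [(hp.isCStarSeminorm i).self_mul_star, sq] at h2
    rcases hnn.eq_or_lt with h0 | h0
    · rw [← h0]; exact Adjointable.opSeminorm_nonneg _ _
    · exact le_of_mul_le_mul_right h2 h0

theorem adjoint_iotaX_comp_iotaX (hp : IsProCStarAlgebra p) (x y : Y) :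
    (iotaX R x).adjoint.comp (iotaX R y) = iotaA A (R.inner x y) :=
  Adjointable.ext_map (RightInnerModule.isHilbert_self hp).definite
    fun a => R.inner_act_right x y a

theorem opSeminorm_iotaX (hp : IsProCStarAlgebra p) (hR : R.IsHilbert p) (i : Λ) (x : Y) :
    (iotaX R x).opSeminorm p i = R.seminorm p i x := by
  have h1 := (iotaX R x).opSeminorm_adjoint_comp_self hp (RightInnerModule.isHilbert_self hp) hR i
  rw [adjoint_iotaX_comp_iotaX hp, opSeminorm_iotaA hp] at h1
  rw [RightInnerModule.seminorm, h1, Real.sqrt_sq (Adjointable.opSeminorm_nonneg _ _)]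

theorem comp_iotaA (hp : IsProCStarAlgebra p) (T : MultiplierSpace R) (a : A) :
    T.comp (iotaA A a) = iotaX R (T.map a) :=
  Adjointable.ext_map (RightInnerModule.isHilbert_self hp).definite fun b => T.map_act a b

theorem comp_iotaX (hp : IsProCStarAlgebra p) (T : Adjointable R S) (x : Y) :
    T.comp (iotaX R x) = iotaX S (T.map x) :=
  Adjointable.ext_map (RightInnerModule.isHilbert_self hp).definite fun b => T.map_act x b

theorem iotaX_injective (hp : IsProCStarAlgebra p) (hR : R.IsHilbert p) :
    Function.Injective (iotaX R) := by
  refine (injective_iff_map_eq_zero _).2 fun x hx => ?_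
  refine hR.eq_of_sub_eq_zero hp fun i => ?_
  rw [sub_zero, ← opSeminorm_iotaX hp hR, hx]
  exact (Adjointable.isSeminormFamily_opSeminorm hp (RightInnerModule.isHilbert_self hp) hR).zero i

/-- With `x = y b`, one has `x m(a) = y (b m(a)) = y (m*(b*))* a`. -/
theorem exists_iotaX_comp_eq (hp : IsProCStarAlgebra p) (hR : R.IsHilbert p) (x : Y)
    (m : MultiplierAlgebra A) : ∃ z, (iotaX R x).comp m = iotaX R z := by
  obtain ⟨y, b, rfl⟩ := hR.exists_act_eq hp x
  refine ⟨R.act y (star (m.adj (star b))),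
    Adjointable.ext_map (RightInnerModule.isHilbert_self hp).definite fun a => ?_⟩
  change R.act (R.act y b) (m.map a) = R.act (R.act y _) a
  rw [← R.act_mul, ← R.act_mul, InnerBimodule.star_adj_mul, star_star]

/-- A limit of elements of the module in the multiplier module belongs to the module. -/
theorem exists_eq_iotaX_of_tendsto (hp : IsProCStarAlgebra p) (hR : R.IsHilbert p)
    {κ : Type*} {l : Filter κ} [l.NeBot] {u : κ → Y} {T : MultiplierSpace R}
    (hT : ∀ i, Tendsto (fun k => (iotaX R (u k) - T).opSeminorm p i) l (𝓝 0)) :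
    ∃ x, T = iotaX R x := by
  have hA := RightInnerModule.isHilbert_self hp
  have hf := Adjointable.isSeminormFamily_opSeminorm hp hA hR
  obtain ⟨x, hx⟩ := (RightInnerModule.isSeminormFamily hp hR.positive).exists_tendsto hR.complete
    (u := u) (l := l) fun i => by
      refine squeeze_zero (fun z => RightInnerModule.seminorm_nonneg _ _) (fun z => ?_)
        (by simpa using ((hT i).comp tendsto_fst).add ((hT i).comp tendsto_snd))
      rw [← opSeminorm_iotaX hp hR, map_sub, ← sub_sub_sub_cancel_right _ _ T]
      exact hf.sub_le i _ _
  refine ⟨x, Adjointable.eq_of_opSeminorm_sub_eq_zero hp hA hR fun i => ?_⟩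
  refine hf.tendsto_unique (hT i) (y := iotaX R x) ?_
  simpa only [← map_sub, opSeminorm_iotaX hp hR] using hx i

/-- By factorization every element is already a product, so neither spans nor closures are needed.
-/
theorem isNondegenerateMorphism_iota (hp : IsProCStarAlgebra p) (hR : R.IsHilbert p) :
    IsNondegenerateMorphism p R (iotaX R) (iotaA A) where
  algebra := by
    refine Set.eq_univ_of_forall fun c => @subset_closure A (seminormTopology p) _ c
      (Submodule.subset_span ?_)
    obtain ⟨y, b, h⟩ := (RightInnerModule.isHilbert_self hp).exists_act_eq hp c
    exact ⟨y, b, h⟩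
  module := by
    refine Set.eq_univ_of_forall fun c => @subset_closure Y (seminormTopology _) _ c
      (Submodule.subset_span ?_)
    obtain ⟨y, b, h⟩ := hR.exists_act_eq hp c
    exact ⟨y, b, h⟩

end General

/-! ### The multiplier bimodule and its strict topology -/

namespace InnerBimodule

variable {Λ : Type*} {A : Type u} {X : Type*} [NonUnitalRing A] [StarRing A] [Module ℂ A]
  [IsScalarTower ℂ A A] [SMulCommClass ℂ A A] [AddCommGroup X] [Module ℂ X]

theorem comp_sub {R : RightInnerModule A X} (S : Adjointable R R) (T V : MultiplierSpace R) :
    S.comp (T - V) = S.comp T - S.comp V := by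
  ext <;> simp [Adjointable.sub_map, Adjointable.sub_adj]

variable [StarModule ℂ A] {𝓧 : InnerBimodule A A X} {p : Λ → A → ℝ}
  {Ψ : MultiplierAlgebra A ≃⋆ₐ[ℂ] Adjointable 𝓧.right 𝓧.right}

theorem multiplierBimodule_right_seminorm (h : 𝓧.IsHilbert p p) :
    (multiplierBimodule 𝓧 Ψ).right.seminorm (Adjointable.opSeminorm p) =
      fun i T => T.opSeminorm p i := by
  ext i T
  refine Eq.trans ?_ (Real.sqrt_sq (Adjointable.opSeminorm_nonneg T i))
  rw [← T.opSeminorm_adjoint_comp_self h.left_algebra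
    (RightInnerModule.isHilbert_self h.left_algebra) h.right_isHilbert i]
  rfl

/-- `Ψ` is isometric for each seminorm and `‖T T*‖ = ‖T*‖² = ‖T‖²`, so the left and right seminorms
of the multiplier bimodule coincide. -/
theorem multiplierBimodule_left_seminorm (h : 𝓧.IsHilbert p p) (hfull : 𝓧.IsFull p p)
    (hΨ : ∀ m, 𝓧.IsExtension m (Ψ m)) :
    (multiplierBimodule 𝓧 Ψ).left.seminorm (Adjointable.opSeminorm p) =
      fun i T => T.opSeminorm p i := by
  have hA := RightInnerModule.isHilbert_self h.left_algebra
  ext i T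
  refine Eq.trans ?_ (Real.sqrt_sq (Adjointable.opSeminorm_nonneg T i))
  rw [← T.opSeminorm_adjoint h.left_algebra hA h.right_isHilbert,
    ← T.adjoint.opSeminorm_adjoint_comp_self h.left_algebra h.right_isHilbert hA i]
  have h1 := hΨ (Ψ.symm (T.comp T.adjoint))
  have h2 := (h1.opSeminorm_le h i).antisymm (h1.le_opSeminorm h hfull i)
  rw [Ψ.apply_symm_apply] at h2
  exact congrArg Real.sqrt h2.symm

theorem isHilbert_multiplierBimodule (h : 𝓧.IsHilbert p p) (hfull : 𝓧.IsFull p p)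
    (hΨ : ∀ m, 𝓧.IsExtension m (Ψ m)) :
    (multiplierBimodule 𝓧 Ψ).IsHilbert (Adjointable.opSeminorm p) (Adjointable.opSeminorm p) := by
  have hp := h.left_algebra
  have hR := h.right_isHilbert
  have hA := RightInnerModule.isHilbert_self hp
  have hzero {T : MultiplierSpace 𝓧.right} (hT : T.adjoint.comp T = 0) : T = 0 := by
    refine Adjointable.ext_map hA.definite fun a => (hR.definite _).1 ?_
    rw [T.inner_map, ← Adjointable.adjoint_map, ← LinearMap.comp_apply, ← Adjointable.comp_map, hT]
    exact RightInnerModule.inner_zero_right _ a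
  have hzero' {T : MultiplierSpace 𝓧.right} (hT : T.comp T.adjoint = 0) : T = 0 := by
    have h1 : T.adjoint = 0 := by
      refine Adjointable.ext_map hR.definite fun x => (hA.definite _).1 ?_
      rw [Adjointable.adjoint_map, T.inner_adj, ← Adjointable.adjoint_map,
        ← LinearMap.comp_apply, ← Adjointable.comp_map, hT]
      exact RightInnerModule.inner_zero_right _ x
    exact congrArg Adjointable.adjoint h1
  refine ⟨Adjointable.isProCStarAlgebra hp hA, Adjointable.isProCStarAlgebra hp hA,
    ⟨fun T => ?_, fun T => ⟨fun hT => ?_, ?_⟩, ?_⟩,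
    ⟨fun T => ?_, fun T => ⟨hzero, ?_⟩, ?_⟩, fun i m T => ?_, fun i T m => ?_⟩
  -- Here `⟨x, T T* x⟩ = (T* x)* (T* x)`; the operator is a square in `L_A(X)`, and `Ψ⁻¹` carries
  -- the square root to `M(A)`.
  · obtain ⟨b, hb⟩ : IsPositiveElt (T.comp T.adjoint) :=
      Adjointable.isPositiveElt_of_inner hp hR rfl fun x =>
        ⟨T.adj x, (T.inner_adj x (T.adj x)).symm⟩
    refine ⟨Ψ.symm b, ?_⟩
    rw [← map_star, ← map_mul, ← hb]
    rfl
  · refine hzero' (Ψ.symm.injective ?_)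
    rw [map_zero]
    exact hT
  · rintro rfl
    exact map_zero Ψ.symm
  · rw [multiplierBimodule_left_seminorm h hfull hΨ]
    exact Adjointable.completeSpace_opSeminorm hp hA hR
  · refine Adjointable.isPositiveElt_of_inner hp hA rfl fun a => ?_
    have h1 := hR.positive (T.map a)
    rw [T.inner_map] at h1
    exact h1
  · rintro rfl
    rfl
  · rw [multiplierBimodule_right_seminorm h]
    exact Adjointable.completeSpace_opSeminorm hp hA hR
  · rw [multiplierBimodule_right_seminorm h]
    exact (Adjointable.opSeminorm_comp_le hp hA hR hR (Ψ m) T i).trans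
      (mul_le_mul_of_nonneg_right ((hΨ m).opSeminorm_le h i) (Adjointable.opSeminorm_nonneg _ _))
  · rw [multiplierBimodule_left_seminorm h hfull hΨ, mul_comm]
    exact Adjointable.opSeminorm_comp_le hp hA hA hR T m i

theorem isBimoduleMorphism_iota (h : 𝓧.IsHilbert p p)
    (hext : ∀ a x, (Ψ (iotaA A a)).map x = 𝓧.left.act a x) :
    IsBimoduleMorphism p (Adjointable.opSeminorm p) 𝓧 (multiplierBimodule 𝓧 Ψ)
      (iotaX 𝓧.right) (iotaA A) where
  continuous i := ⟨i, fun a => (opSeminorm_iotaA h.left_algebra i a).le⟩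
  map_right_act x a := (comp_iotaA h.left_algebra (iotaX 𝓧.right x) a).symm
  map_left_act a x := by
    rw [← hext]
    exact (comp_iotaX h.left_algebra (Ψ (iotaA A a)) x).symm
  map_right_inner x y := adjoint_iotaX_comp_iotaX h.left_algebra x y
  map_left_inner x y := by
    apply Ψ.injective
    refine (Ψ.apply_symm_apply _).trans ?_
    refine Adjointable.ext_map h.right_isHilbert.definite fun z => ?_
    exact ((hext _ z).trans (𝓧.inner_act x y z)).symm

theorem isSubBimodule_range_iotaX (h : 𝓧.IsHilbert p p) :
    (multiplierBimodule 𝓧 Ψ).IsSubBimodule (LinearMap.range (iotaX 𝓧.right)) := by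
  refine ⟨?_, ?_⟩
  · rintro m _ ⟨x, rfl⟩
    exact ⟨(Ψ m).map x, (comp_iotaX h.left_algebra (Ψ m) x).symm⟩
  · rintro _ ⟨x, rfl⟩ m
    obtain ⟨z, hz⟩ := exists_iotaX_comp_eq h.left_algebra h.right_isHilbert x m
    exact ⟨z, hz.symm⟩

theorem isClosed_range_iotaX (h : 𝓧.IsHilbert p p) :
    @IsClosed (MultiplierSpace 𝓧.right)
      (seminormTopology ((multiplierBimodule 𝓧 Ψ).right.seminorm (Adjointable.opSeminorm p)))
      (Set.range (iotaX 𝓧.right)) := by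
  have hp := h.left_algebra
  rw [multiplierBimodule_right_seminorm h]
  have hf := Adjointable.isSeminormFamily_opSeminorm hp (RightInnerModule.isHilbert_self hp)
    h.right_isHilbert
  let _ := seminormTopology fun i (T : MultiplierSpace 𝓧.right) => T.opSeminorm p i
  refine isClosed_of_closure_subset fun T hT => ?_
  obtain ⟨l, hl, hlT⟩ := hf.exists_tendsto_of_mem_closure hT
  obtain ⟨x, hx⟩ := exists_eq_iotaX_of_tendsto hp h.right_isHilbert (l := l)
    (u := fun k : Set.range (iotaX 𝓧.right) => k.2.choose) (T := T) fun i => by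
      simpa only [Exists.choose_spec (Set.mem_range.1 (Subtype.prop _))] using hlT i
  exact ⟨x, hx.symm⟩

/-- For `a = ⟨x, y⟩`, one has `a T(b) = x ⟨y, T b⟩ = x (T* y)* b`, so `z = x (T* y)*`. The elements
`a` with `a T` in the range of `ι_X` form a left ideal, closed because that range is closed;
fullness finishes. -/
theorem IsHilbert.exists_leftMul_comp_eq (h : 𝓧.IsHilbert p p) (hfull : 𝓧.IsFull p p)
    (T : MultiplierSpace 𝓧.right) (a : A) :
    ∃ z, (h.leftMul hfull a).comp T = iotaX 𝓧.right z := by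
  have hp := h.left_algebra
  have hR := h.right_isHilbert
  have hA := RightInnerModule.isHilbert_self hp
  let Q : A → Prop := fun a => ∃ z, (h.leftMul hfull a).comp T = iotaX 𝓧.right z
  have hmap {a : A} {z : X} (hz : ∀ b, 𝓧.left.act a (T.map b) = 𝓧.right.act z b) : Q a :=
    ⟨z, Adjointable.ext_map hA.definite hz⟩
  have hQ {a : A} (ha : Q a) : ∃ z, ∀ b, 𝓧.left.act a (T.map b) = 𝓧.right.act z b := by
    obtain ⟨z, hz⟩ := ha
    exact ⟨z, fun b => congrArg (fun V : MultiplierSpace 𝓧.right => V.map b) hz⟩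
  have h1 (x y : X) : Q (𝓧.left.inner x y) :=
    hmap (z := 𝓧.right.act x (star (T.adj y))) fun b => by
      rw [𝓧.inner_act, ← 𝓧.right.act_mul, ← T.inner_adj]
      rfl
  have h2 (a b : A) (hb : Q b) : Q (a * b) := by
    obtain ⟨z, hz⟩ := hQ hb
    exact hmap (z := 𝓧.left.act a z) fun c => by
      rw [𝓧.left.mul_act, hz, h.left_act_right_act hfull]
  have h3 (a b : A) (ha : Q a) (hb : Q b) : Q (a + b) := by
    obtain ⟨z, hz⟩ := hQ ha
    obtain ⟨w, hw⟩ := hQ hb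
    exact hmap (z := z + w) fun c => by rw [𝓧.left.add_act, hz, hw, 𝓧.right.add_act]
  have h4 (r : ℂ) (a : A) (ha : Q a) : Q (r • a) := by
    obtain ⟨z, hz⟩ := hQ ha
    exact hmap (z := r • z) fun c => by rw [𝓧.left.smul_act, hz, 𝓧.right.smul_act]
  have h5 : Q 0 := hmap (z := 0) fun c => by rw [zero_left_act, 𝓧.right.zero_act]
  have h6 {κ : Type u} (l : Filter κ) [l.NeBot] (u : κ → A) (a : A) (hu : ∀ k, Q (u k))
      (ha : ∀ i, Tendsto (fun k => p i (u k - a)) l (𝓝 0)) : Q a := by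
    choose z hz using hu
    refine exists_eq_iotaX_of_tendsto hp hR (l := l) (u := z) fun i => ?_
    refine squeeze_zero (fun k => Adjointable.opSeminorm_nonneg _ _) (fun k => ?_)
      (by simpa using (ha i).mul_const (T.opSeminorm p i))
    rw [← hz, ← h.opSeminorm_leftMul hfull]
    refine le_of_eq_of_le ?_ (Adjointable.opSeminorm_comp_le hp hA hR hR _ T i)
    congr 1
    refine Adjointable.ext_map hA.definite fun b => ?_
    rw [Adjointable.sub_map]
    exact (sub_left_act _ _ _).symm
  refine (hp.isSeminormFamily.induction_of_closure_adjoin hfull.left_full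
    (P := fun a => Q a ∧ Q (star a)) ?_ ?_ ?_ ?_ ?_ ?_ ?_ a).1
  · rintro _ ⟨x, y, rfl⟩
    rw [𝓧.left.star_inner]
    exact ⟨h1 x y, h1 y x⟩
  · rw [star_zero]
    exact ⟨h5, h5⟩
  · intro a b ha hb
    rw [star_add]
    exact ⟨h3 a b ha.1 hb.1, h3 _ _ ha.2 hb.2⟩
  · intro r a ha
    rw [star_smul]
    exact ⟨h4 r a ha.1, h4 _ _ ha.2⟩
  · intro a b ha hb
    rw [star_mul]
    exact ⟨h2 a b hb.1, h2 _ _ ha.2⟩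
  · intro a ha
    rw [star_star]
    exact ⟨ha.2, ha.1⟩
  · intro l _ a ha
    refine ⟨h6 l (fun k => k.1) a (fun k => k.2.1) ha,
      h6 l (fun k => star k.1) (star a) (fun k => k.2.2) fun i => ?_⟩
    simpa only [← star_sub, (hp.isCStarSeminorm i).star_eq] using ha i

theorem strictSeminorm_eq (h : 𝓧.IsHilbert p p) (hfull : 𝓧.IsFull p p)
    (hext : ∀ a x, (Ψ (iotaA A a)).map x = 𝓧.left.act a x) :
    strictSeminorm p 𝓧 Ψ = fun ia T => 𝓧.right.seminorm p ia.1 (T.map ia.2) +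
      ((h.leftMul hfull ia.2).comp T).opSeminorm p ia.1 := by
  ext ia T
  rw [strictSeminorm, multiplierBimodule_right_seminorm h,
    ← opSeminorm_iotaX h.left_algebra h.right_isHilbert, ← comp_iotaA h.left_algebra,
    show h.leftMul hfull ia.2 = Ψ (iotaA A ia.2) from
      Adjointable.ext_map h.right_isHilbert.definite fun x => (hext ia.2 x).symm]
  rfl

theorem isSeminormFamily_strictSeminorm (h : 𝓧.IsHilbert p p) (hfull : 𝓧.IsFull p p)
    (hext : ∀ a x, (Ψ (iotaA A a)).map x = 𝓧.left.act a x) :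
    IsSeminormFamily (strictSeminorm p 𝓧 Ψ) := by
  have hfR := RightInnerModule.isSeminormFamily h.left_algebra h.right_isHilbert.positive
  have hf := Adjointable.isSeminormFamily_opSeminorm h.left_algebra
    (RightInnerModule.isHilbert_self h.left_algebra) h.right_isHilbert
  rw [strictSeminorm_eq h hfull hext]
  refine .of_add_le_smul_eq (fun ia T V => ?_) fun ia c T => ?_
  · have h1 : (h.leftMul hfull ia.2).comp (T + V) =
        (h.leftMul hfull ia.2).comp T + (h.leftMul hfull ia.2).comp V := by
      ext <;> simp
    rw [h1, Adjointable.add_map, LinearMap.add_apply]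
    exact (add_le_add (hfR.add_le _ _ _) (hf.add_le _ _ _)).trans_eq (add_add_add_comm _ _ _ _)
  · have h1 : (h.leftMul hfull ia.2).comp (c • T) = c • (h.leftMul hfull ia.2).comp T := by
      ext <;> simp
    rw [h1, hf.smul_eq, Adjointable.smul_map, LinearMap.smul_apply, hfR.smul_eq, mul_add]

theorem completeSpace_strictSeminorm (h : 𝓧.IsHilbert p p) (hfull : 𝓧.IsFull p p)
    (hext : ∀ a x, (Ψ (iotaA A a)).map x = 𝓧.left.act a x) :
    @CompleteSpace (MultiplierSpace 𝓧.right) (seminormUniformity (strictSeminorm p 𝓧 Ψ)) := by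
  have hp := h.left_algebra
  have hR := h.right_isHilbert
  have hA := RightInnerModule.isHilbert_self hp
  have hfR := RightInnerModule.isSeminormFamily hp hR.positive
  have hfA := RightInnerModule.isSeminormFamily hp hA.positive
  refine (isSeminormFamily_strictSeminorm h hfull hext).completeSpace_iff.2 fun F hF hc => ?_
  rw [strictSeminorm_eq h hfull hext] at hc ⊢
  have hc1 (i : Λ) (a : A) : Tendsto (fun z : MultiplierSpace 𝓧.right × MultiplierSpace 𝓧.right =>
      𝓧.right.seminorm p i ((z.1 - z.2).map a)) (F ×ˢ F) (𝓝 0) :=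
    squeeze_zero (fun _ => RightInnerModule.seminorm_nonneg _ _)
      (fun _ => le_add_of_nonneg_right (Adjointable.opSeminorm_nonneg _ _)) (hc (i, a))
  have hc2 (i : Λ) (a : A) : Tendsto (fun z : MultiplierSpace 𝓧.right × MultiplierSpace 𝓧.right =>
      ((h.leftMul hfull a).comp (z.1 - z.2)).opSeminorm p i) (F ×ˢ F) (𝓝 0) :=
    squeeze_zero (fun _ => Adjointable.opSeminorm_nonneg _ _)
      (fun _ => le_add_of_nonneg_left (RightInnerModule.seminorm_nonneg _ _)) (hc (i, a))
  obtain ⟨T, hT, -⟩ := Adjointable.exists_of_tendsto hp hA hR (l := F) (u := fun T => T)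
    (fun a => hfR.exists_tendsto hR.complete fun i => by
      simpa only [Adjointable.sub_map, LinearMap.sub_apply] using hc1 i a)
    (fun x => hfA.exists_tendsto hA.complete fun i => by
      -- The strict seminorms control `T a` and `a T` but not adjoints directly. Writing `x = b y`
      -- gives `T* x = (b* T)* y`, which the left half of the strict seminorm controls.
      obtain ⟨b, y, rfl⟩ := h.left_isHilbert.exists_act_eq hp x
      refine squeeze_zero (fun _ => RightInnerModule.seminorm_nonneg _ _) (fun z => ?_)
        (by simpa using (hc2 i (star b)).mul_const (𝓧.right.seminorm p i y))
      have h1 := ((h.leftMul hfull (star b)).comp (z.1 - z.2)).adjoint.seminorm_map_le hp hR hA i y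
      rw [Adjointable.opSeminorm_adjoint hp hA hR] at h1
      refine le_of_eq_of_le ?_ h1
      rw [← LinearMap.sub_apply, ← Adjointable.sub_adj]
      change _ = (RightInnerModule.self A).seminorm p i
        ((z.1 - z.2).adj (𝓧.left.act (star (star b)) y))
      rw [star_star])
  refine ⟨T, fun ⟨i, a⟩ => ?_⟩
  rw [← add_zero (0 : ℝ)]
  refine Tendsto.add (by
    simpa only [Adjointable.sub_map, LinearMap.sub_apply] using hT a i) ?_
  rw [Metric.tendsto_nhds]
  intro ε hε
  have h1 := (hc2 i a).eventually (gt_mem_nhds (half_pos hε))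
  -- Pointwise convergence gives `a V' → a T` pointwise; the Cauchy estimate in operator seminorm,
  -- with `V` fixed, then passes to the limit uniformly on the unit ball.
  filter_upwards [h1.curry] with V hV
  rw [Real.dist_eq, sub_zero, abs_of_nonneg (Adjointable.opSeminorm_nonneg _ _)]
  refine (Adjointable.opSeminorm_le hp hA (C := ε / 2) fun b hb => ?_).trans_lt (half_lt_self hε)
  have h2 : Tendsto (fun V : MultiplierSpace 𝓧.right => 𝓧.right.seminorm p i
      (𝓧.left.act a (V.map b) - 𝓧.left.act a (T.map b))) F (𝓝 0) := by
    refine squeeze_zero (fun _ => RightInnerModule.seminorm_nonneg _ _) (fun V => ?_)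
      (by simpa using (hT b i).const_mul (p i a))
    rw [← left_act_sub]
    exact h.left_bound i a _
  rw [comp_sub, Adjointable.sub_map]
  refine hfR.tendsto_sub_le h2 (hV.mono fun V' hV' => ?_)
  rw [comp_sub] at hV'
  have h3 := (Adjointable.seminorm_map_le_of_le_one hp hA hR _ hb).trans hV'.le
  rwa [Adjointable.sub_map] at h3

theorem dense_range_iotaX (h : 𝓧.IsHilbert p p) (hfull : 𝓧.IsFull p p)
    (hext : ∀ a x, (Ψ (iotaA A a)).map x = 𝓧.left.act a x) :
    @Dense (MultiplierSpace 𝓧.right) (seminormTopology (strictSeminorm p 𝓧 Ψ))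
      (Set.range (iotaX 𝓧.right)) := by
  have hp := h.left_algebra
  have hR := h.right_isHilbert
  have hA := RightInnerModule.isHilbert_self hp
  classical
  intro T
  obtain ⟨e, he, hea⟩ := hp.exists_tendsto_mul
  refine (isSeminormFamily_strictSeminorm h hfull hext).mem_closure_of_tendsto
    (l := (atTop : Filter (Finset A × ℕ)))
    -- These are the products `T e_k`, which belong to the range of `ι_X`.
    (u := fun k => iotaX 𝓧.right (T.map (e k))) (fun ⟨i, a⟩ => ?_) fun k => ⟨_, rfl⟩
  rw [strictSeminorm_eq h hfull hext, ← add_zero (0 : ℝ)]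
  refine Tendsto.add ?_ ?_
  · refine squeeze_zero (fun _ => RightInnerModule.seminorm_nonneg _ _) (fun k => ?_)
      (by simpa using (hea i a).const_mul (T.opSeminorm p i))
    rw [Adjointable.sub_map, LinearMap.sub_apply]
    change 𝓧.right.seminorm p i (𝓧.right.act (T.map (e k)) a - T.map a) ≤ _
    rw [← T.map_act, ← map_sub]
    have h1 := T.seminorm_map_le hp hA hR i (e k * a - a)
    rwa [RightInnerModule.self_seminorm hp] at h1
  · obtain ⟨z, hz⟩ := h.exists_leftMul_comp_eq hfull T a
    have hz' (b : A) : 𝓧.left.act a (T.map b) = 𝓧.right.act z b :=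
      congrArg (fun V : MultiplierSpace 𝓧.right => V.map b) hz
    -- Since `a T = ι_X(y b)`, the error is `y (b e_k - b)`. The approximate unit is only known to
    -- act from the left, and self-adjointness of `e_k` converts `b e_k - b` into `e_k b* - b*`.
    obtain ⟨y, b, rfl⟩ := hR.exists_act_eq hp z
    refine squeeze_zero (fun _ => Adjointable.opSeminorm_nonneg _ _) (fun k => ?_)
      (by simpa using (hea i (star b)).const_mul (𝓧.right.seminorm p i y))
    change ((h.leftMul hfull a).comp (iotaX 𝓧.right (T.map (e k)) - T)).opSeminorm p i ≤ _
    rw [comp_sub, hz, comp_iotaX hp, h.leftMul_map, hz', ← map_sub, opSeminorm_iotaX hp hR,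
      ← 𝓧.right.act_mul, ← 𝓧.right.act_sub]
    refine (RightInnerModule.seminorm_act_le hp i _ _).trans_eq ?_
    rw [← (hp.isCStarSeminorm i).star_eq, star_sub, star_mul, he]

end InnerBimodule

theorem mainTheorem1 {Λ A X : Type*}
    [NonUnitalRing A] [StarRing A] [Module ℂ A]
    [IsScalarTower ℂ A A] [SMulCommClass ℂ A A] [StarModule ℂ A]
    [AddCommGroup X] [Module ℂ X]
    (p : Λ → A → ℝ) (𝓧 : InnerBimodule A A X)
    (h𝓧 : 𝓧.IsHilbert p p) (hfull : 𝓧.IsFull p p) :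
    -- the left action of `A` extends uniquely to a pro-C*-isomorphism `M(A) ≅ L_A(X)`
    (∃! Ψ : MultiplierAlgebra A ≃⋆ₐ[ℂ] Adjointable 𝓧.right 𝓧.right,
      IsLeftActionExtension p 𝓧 Ψ) ∧
    -- the operator seminorms on `M(A)`, `L_A(X)` and `M(X)` are finite
    (∀ i (m : MultiplierAlgebra A), BddAbove (m.unitBallValues p i)) ∧
    (∀ i (S : Adjointable 𝓧.right 𝓧.right), BddAbove (S.unitBallValues p i)) ∧
    (∀ i (T : MultiplierSpace 𝓧.right), BddAbove (T.unitBallValues p i)) ∧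
    ∀ Ψ : MultiplierAlgebra A ≃⋆ₐ[ℂ] Adjointable 𝓧.right 𝓧.right,
      IsLeftActionExtension p 𝓧 Ψ →
      -- `M(X)` is a Hilbert pro-C*-bimodule over `M(A)`
      (multiplierBimodule 𝓧 Ψ).IsHilbert (Adjointable.opSeminorm p) (Adjointable.opSeminorm p) ∧
      -- `M(X)` is strictly complete
      @CompleteSpace (MultiplierSpace 𝓧.right) (seminormUniformity (strictSeminorm p 𝓧 Ψ)) ∧
      -- `(ι_X, ι_A)` is a nondegenerate morphism
      IsBimoduleMorphism p (Adjointable.opSeminorm p) 𝓧 (multiplierBimodule 𝓧 Ψ)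
        (iotaX 𝓧.right) (iotaA A) ∧
      IsNondegenerateMorphism p 𝓧.right (iotaX 𝓧.right) (iotaA A) ∧
      -- `ι_X` identifies `X` with a closed sub-bimodule of `M(X)` that is strictly dense
      Function.Injective (iotaX 𝓧.right) ∧
      (∀ i x, (multiplierBimodule 𝓧 Ψ).right.seminorm (Adjointable.opSeminorm p) i
        (iotaX 𝓧.right x) = 𝓧.right.seminorm p i x) ∧
      (multiplierBimodule 𝓧 Ψ).IsSubBimodule (LinearMap.range (iotaX 𝓧.right)) ∧
      @IsClosed (MultiplierSpace 𝓧.right)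
        (seminormTopology ((multiplierBimodule 𝓧 Ψ).right.seminorm (Adjointable.opSeminorm p)))
        (Set.range (iotaX 𝓧.right)) ∧
      @Dense (MultiplierSpace 𝓧.right) (seminormTopology (strictSeminorm p 𝓧 Ψ))
        (Set.range (iotaX 𝓧.right)) := by
  have hp := h𝓧.left_algebra
  have hR := h𝓧.right_isHilbert
  have hA := RightInnerModule.isHilbert_self hp
  refine ⟨h𝓧.existsUnique_isLeftActionExtension hfull,
    fun i m => m.bddAbove_unitBallValues hp hA hA i,
    fun i S => S.bddAbove_unitBallValues hp hR hR i,
    fun i T => T.bddAbove_unitBallValues hp hA hR i, fun Ψ hΨ => ?_⟩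
  have hext := hΨ.extends_act
  refine ⟨InnerBimodule.isHilbert_multiplierBimodule h𝓧 hfull
      (InnerBimodule.isExtension_of_extends_act h𝓧 hext),
    InnerBimodule.completeSpace_strictSeminorm h𝓧 hfull hext,
    InnerBimodule.isBimoduleMorphism_iota h𝓧 hext,
    isNondegenerateMorphism_iota hp hR, iotaX_injective hp hR, fun i x => ?_,
    InnerBimodule.isSubBimodule_range_iotaX h𝓧, InnerBimodule.isClosed_range_iotaX h𝓧,
    InnerBimodule.dense_range_iotaX h𝓧 hfull hext⟩
  rw [InnerBimodule.multiplierBimodule_right_seminorm h𝓧]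
  exact opSeminorm_iotaX hp hR i x
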